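/- Fix $n\ge 1$ and points $0<x_1<\dots<x_n<1$. An $n$-component virtual string link diagram $S$ is an immersion of $n$ oriented intervals into $[0,1]\times[0,1]$, the $i$th one running from $(x_i,0)$ to $(x_i,1)$, whose only singularities are finitely many transverse double points, each marked either as a classical crossing (with over- and under-strand) or as a virtual crossing. Diagrams are taken up to planar isotopy fixing the boundary of the square. A welded isotopy is a finite sequence of Reidemeister moves R1, R2, R3, virtual moves V1, V2, V3 (the same moves with all crossings virtual), V4 (a strand with only virtual crossings is moved across a classical crossing) and over-crossings commute moves OC (a strand passing over two others is moved across the virtual crossing of these two). A self-crossing virtualization replaces a classical crossing of a component with itself by a virtual crossing. The classical under-crossings cut the $i$th component into arcs $a_{i,1},\dots,a_{i,m_i+1}$, numbered along the orientation. Let $u_{i,j}$ be the over-passing arc and $\varepsilon_{i,j}=\pm1$ the sign of the crossing between $a_{i,j}$ and $a_{i,j+1}$, and put $v_{i,j}=u_{i,1}^{\varepsilon_{i,1}}\cdots u_{i,j}^{\varepsilon_{i,j}}$ (so $v_{i,0}=1$), in the free group $\overline A$ on the arcs. Let $w_i$ be the sum of the signs of the classical self-crossings of the $i$th component and $l_i=a_{i,1}^{-w_i}v_{i,m_i}$.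 Let $A$ be the free group on $\alpha_1,\dots,\alpha_n$, and define homomorphisms $\eta_q:\overline A\to A$, $q\ge1$, by $\eta_1(a_{i,j})=\alpha_i$ and $\eta_{q+1}(a_{i,j})=\eta_q(v_{i,j-1})^{-1}\alpha_i\,\eta_q(v_{i,j-1})$. Let $E$ be the Magnus expansion, i.e. the homomorphism from $A$ to the group of units of the ring $\mathbb Z\langle\langle X_1,\dots,X_n\rangle\rangle$ of formal power series in non-commuting variables with $E(\alpha_i)=1+X_i$. For a sequence $I=j_1\dots j_s i$ of indices in $\{1,\dots,n\}$ with $1\le s<q$, let $\mu_S^{(q)}(I)$ be the coefficient of $X_{j_1}\cdots X_{j_s}$ in $E(\eta_q(l_i))$. The Milnor number $\mu_S(I)$ is the common value of $\mu_S^{(q)}(I)$ for all $q>s$. Statement: If two virtual string link diagrams $S$ and $S'$ are related by a finite sequence of self-crossing virtualizations (and their inverses) and welded isotopies, then $\mu_S(I)=\mu_{S'}(I)$ for every non-repeated sequence $I=j_1\dots j_s i$ (pairwise different indices, $s\ge1$); that is, $\mu_S^{(q)}(I)=\mu_{S'}^{(q')}(I)$ for all $q,q'>s$. -/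

import Mathlib

open scoped ContDiff

namespace StringLink

noncomputable section

/-! ### Formal power series in non-commuting variables and the Magnus expansion -/

/-- The ring `ℤ⟨⟨X₁, …, Xₙ⟩⟩` of formal power series in `n` non-commuting variables: a series is
the family of its coefficients, indexed by the words `X_{j₁} ⋯ X_{jₛ}`, i.e. lists of indices. -/
def NCSeries (n : ℕ) : Type := List (Fin n) → ℤ

namespace NCSeries

variable {n : ℕ}

instance : AddCommGroup (NCSeries n) := inferInstanceAs (AddCommGroup (List (Fin n) → ℤ))

/-- The coefficient of the word `w`. -/
def coeff (w : List (Fin n)) (f : NCSeries n) : ℤ := f w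

@[ext] theorem ext {f g : NCSeries n} (h : ∀ w, coeff w f = coeff w g) : f = g := funext h

/-- The constant series `1`. -/
instance : One (NCSeries n) := ⟨fun w => if w = [] then 1 else 0⟩

/-- The Cauchy product: sum over all ways of cutting a word into two pieces. -/
instance : Mul (NCSeries n) :=
  ⟨fun f g w => ∑ k ∈ Finset.range (w.length + 1), f (w.take k) * g (w.drop k)⟩

/-- The variable `X_i`. -/
def X (i : Fin n) : NCSeries n := fun w => if w = [i] then 1 else 0

theorem coeff_one (w : List (Fin n)) : coeff w (1 : NCSeries n) = if w = [] then 1 else 0 := rfl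

theorem coeff_X (i : Fin n) (w : List (Fin n)) : coeff w (X i) = if w = [i] then 1 else 0 := rfl

theorem coeff_add (w : List (Fin n)) (f g : NCSeries n) :
    coeff w (f + g) = coeff w f + coeff w g := rfl

theorem coeff_zero (w : List (Fin n)) : coeff w (0 : NCSeries n) = 0 := rfl

theorem coeff_mul (w : List (Fin n)) (f g : NCSeries n) :
    coeff w (f * g) =
      ∑ k ∈ Finset.range (w.length + 1), coeff (w.take k) f * coeff (w.drop k) g := rfl

theorem coeff_nil_mul (f g : NCSeries n) :
    coeff [] (f * g) = coeff [] f * coeff [] g := by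
  simp [coeff_mul]

/-- The series of the coefficients of the words that begin with the letter `a`. -/
def tail (a : Fin n) (f : NCSeries n) : NCSeries n := fun w => coeff (a :: w) f

theorem coeff_tail (a : Fin n) (w : List (Fin n)) (f : NCSeries n) :
    coeff w (tail a f) = coeff (a :: w) f := rfl

theorem coeff_cons_mul (a : Fin n) (w : List (Fin n)) (f g : NCSeries n) :
    coeff (a :: w) (f * g) =
      coeff [] f * coeff (a :: w) g + coeff w (tail a f * g) := by
  rw [coeff_mul, coeff_mul, List.length_cons, Finset.sum_range_succ']
  simp [coeff_tail, add_comm]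

theorem coeff_add_mul (w : List (Fin n)) (f g h : NCSeries n) :
    coeff w ((f + g) * h) = coeff w (f * h) + coeff w (g * h) := by
  simp [coeff_mul, coeff_add, add_mul, Finset.sum_add_distrib]

/-- The multiple of a series by an integer. -/
def scale (c : ℤ) (f : NCSeries n) : NCSeries n := fun w => c * coeff w f

theorem coeff_scale (c : ℤ) (w : List (Fin n)) (f : NCSeries n) :
    coeff w (scale c f) = c * coeff w f := rfl

theorem coeff_mul_assoc (w : List (Fin n)) :
    ∀ f g h : NCSeries n, coeff w (f * g * h) = coeff w (f * (g * h)) := by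
  induction w with
  | nil => intro f g h; simp [coeff_nil_mul, mul_assoc]
  | cons a w ih =>
    intro f g h
    have key : tail a (f * g) = scale (coeff [] f) (tail a g) + tail a f * g := by
      ext v
      rw [coeff_tail, coeff_cons_mul, coeff_add, coeff_scale, coeff_tail]
    have key2 : coeff w (scale (coeff [] f) (tail a g) * h) =
        coeff [] f * coeff w (tail a g * h) := by
      rw [coeff_mul, coeff_mul, Finset.mul_sum]
      refine Finset.sum_congr rfl fun k _ => ?_
      rw [coeff_scale, mul_assoc]
    rw [coeff_cons_mul, coeff_cons_mul, coeff_cons_mul, key, coeff_add_mul, key2, ih,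
      coeff_nil_mul]
    ring

instance : Ring (NCSeries n) where
  left_distrib f g h := by
    ext w; simp [coeff_mul, coeff_add, mul_add, Finset.sum_add_distrib]
  right_distrib f g h := by ext w; exact coeff_add_mul w f g h
  zero_mul f := by ext w; simp [coeff_mul, coeff_zero]
  mul_zero f := by ext w; simp [coeff_mul, coeff_zero]
  mul_assoc f g h := by ext w; exact coeff_mul_assoc w f g h
  one_mul f := by
    ext w
    rw [coeff_mul, Finset.sum_eq_single 0]
    · simp [coeff_one]
    · intro k hk hk0
      have : w.take k ≠ [] := by
        simp only [Finset.mem_range] at hk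
        intro h
        have := congrArg List.length h
        simp at this
        rcases this with h | h
        · exact hk0 h
        · subst h; simp at hk; exact hk0 hk
      simp [coeff_one, this]
    · simp
  mul_one f := by
    ext w
    rw [coeff_mul, Finset.sum_eq_single w.length]
    · simp [coeff_one]
    · intro k hk hk0
      simp only [Finset.mem_range] at hk
      have : w.drop k ≠ [] := by
        intro h
        rw [List.drop_eq_nil_iff] at h
        omega
      simp [coeff_one, this]
    · simp
  neg_add_cancel := neg_add_cancel
  zsmul := zsmulRec

/-- The geometric series `1 - X_i + X_i² - X_i³ + ⋯`. -/
def geom (i : Fin n) : NCSeries n :=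
  fun w => if ∀ a ∈ w, a = i then (-1) ^ w.length else 0

theorem coeff_geom (i : Fin n) (w : List (Fin n)) :
    coeff w (geom i) = if ∀ a ∈ w, a = i then (-1) ^ w.length else 0 := rfl

theorem X_mul_geom (i : Fin n) : (1 + X i) * geom i = 1 := by
  ext w
  rw [add_mul, one_mul, coeff_add]
  cases w with
  | nil => simp [coeff_nil_mul, coeff_X, coeff_one, coeff_geom]
  | cons a w =>
    have ht : tail a (X i) = if a = i then (1 : NCSeries n) else 0 := by
      ext v
      by_cases h : a = i <;> simp [coeff_tail, coeff_X, h, coeff_one, coeff_zero]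
    rw [coeff_cons_mul, ht]
    by_cases h : a = i
    · subst h
      by_cases hw : ∀ b ∈ w, b = a
      · have : ∀ b ∈ a :: w, b = a := by simpa using hw
        simp only [coeff_geom, coeff_X, coeff_one, if_pos this, if_true, one_mul, if_pos hw]
        simp [pow_succ]
      · have : ¬ ∀ b ∈ a :: w, b = a := by simpa using hw
        simp only [coeff_geom, coeff_X, coeff_one, if_neg this, if_true, one_mul, if_neg hw]
        simp
    · simp [coeff_geom, coeff_X, coeff_one, h, coeff_zero]

theorem geom_mul_X (i : Fin n) : geom i * (1 + X i) = 1 := by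
  ext w
  induction w with
  | nil => simp [coeff_nil_mul, coeff_X, coeff_one, coeff_geom, coeff_add]
  | cons a w ih =>
    have ht : tail a (geom i) = if a = i then -geom i else 0 := by
      ext v
      by_cases h : a = i
      · subst h
        change coeff (a :: v) (geom a) = coeff v (if a = a then -geom a else 0)
        rw [if_pos rfl]
        change coeff (a :: v) (geom a) = - coeff v (geom a)
        by_cases hv : ∀ b ∈ v, b = a
        · have : ∀ b ∈ a :: v, b = a := by simpa using hv
          rw [coeff_geom, coeff_geom, if_pos this, if_pos hv]
          simp [pow_succ]
        · have : ¬ ∀ b ∈ a :: v, b = a := by simpa using hv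
          rw [coeff_geom, coeff_geom, if_neg this, if_neg hv]
          simp
      · simp [coeff_tail, coeff_geom, h, coeff_zero]
    rw [coeff_cons_mul, ht]
    by_cases h : a = i
    · subst h
      rw [if_pos rfl, neg_mul]
      change _ + - coeff w (geom a * (1 + X a)) = _
      rw [ih]
      cases w <;> simp [coeff_one, coeff_add, coeff_X, coeff_geom]
    · simp [coeff_geom, coeff_X, coeff_one, h, coeff_zero, coeff_add]

end NCSeries

/-- The Magnus expansion `E`, the homomorphism from the free group on `α₁, …, αₙ` to the units of
`ℤ⟨⟨X₁, …, Xₙ⟩⟩` with `E(α_i) = 1 + X_i`, `E(α_i⁻¹) = 1 - X_i + X_i² - ⋯`. -/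
def magnus (n : ℕ) : FreeGroup (Fin n) →* (NCSeries n)ˣ :=
  FreeGroup.lift fun i =>
    ⟨1 + NCSeries.X i, NCSeries.geom i, NCSeries.X_mul_geom i, NCSeries.geom_mul_X i⟩

/-! ### Virtual string link diagrams -/

/-- The three ways in which a strand can pass through a double point: as the over-strand or the
under-strand of a classical crossing, or as a strand of a virtual crossing. -/
inductive Passage
  | above
  | below
  | virt

/-- The passage of the other strand at the same double point. -/
def Passage.opp : Passage → Passage
  | above => below
  | below => above
  | virt => virt

/-- `u₁ v₂ - u₂ v₁`. -/
def cross (u v : ℝ × ℝ) : ℝ := u.1 * v.2 - u.2 * v.1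

section Curves

variable {n : ℕ} (γ : Fin n × ℝ → ℝ × ℝ)

/-- The velocity of the `i`-th curve at time `t`, where `p = (i, t)`. -/
def velocity (p : Fin n × ℝ) : ℝ × ℝ := deriv (fun t => γ (p.1, t)) p.2

/-- `p` and `q` are two different points of `[0,1]₁ ⊔ ⋯ ⊔ [0,1]ₙ` with the same image. -/
def Meet (p q : Fin n × ℝ) : Prop :=
  p.2 ∈ Set.Icc (0 : ℝ) 1 ∧ q.2 ∈ Set.Icc (0 : ℝ) 1 ∧ p ≠ q ∧ γ p = γ q

end Curves

/-- An `n`-component virtual string link diagram in `[0,1] × [0,1]` whose `i`-th component runs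
from `(x i, 0)` to `(x i, 1)`: an immersion of `n` intervals, given by `n` parametrized curves
`t ↦ curve (i, t)`, of which only the part `0 ≤ t ≤ 1` is significant, whose singularities are
finitely many transverse double points, each of them marked as a classical crossing (with
over- and under-strand) or as a virtual crossing. The mark of a double point is recorded at both
of its preimages; the value of `kind` elsewhere has no significance. -/
structure Diagram (n : ℕ) (x : Fin n → ℝ) where
  /-- The point at time `t` of the `i`-th component is `curve (i, t)`. -/
  curve : Fin n × ℝ → ℝ × ℝ
  smooth : ∀ i, ContDiff ℝ ∞ fun t => curve (i, t)
  immersed : ∀ i, ∀ t ∈ Set.Icc (0 : ℝ) 1, velocity curve (i, t) ≠ 0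
  source : ∀ i, curve (i, 0) = (x i, 0)
  target : ∀ i, curve (i, 1) = (x i, 1)
  proper : ∀ i, ∀ t ∈ Set.Ioo (0 : ℝ) 1,
    curve (i, t) ∈ Set.Ioo (0 : ℝ) 1 ×ˢ Set.Ioo (0 : ℝ) 1
  finite_double : {p | ∃ q, Meet curve p q}.Finite
  no_triple : ∀ p q r, Meet curve p q → Meet curve p r → q = r
  transverse : ∀ p q, Meet curve p q → cross (velocity curve p) (velocity curve q) ≠ 0
  /-- How the curve passes through the double point `curve p`. -/
  kind : Fin n × ℝ → Passage
  kind_opp : ∀ p q, Meet curve p q → kind q = (kind p).opp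

namespace Diagram

variable {n : ℕ} {x : Fin n → ℝ} (S : Diagram n x)

/-! ### Arcs, longitudes and Milnor numbers

Closing up `S` turns the two ends of the `i`-th component into the base point `p_i` and creates no
crossing, so cutting the closed diagram at its base points and classical under-crossings is the
same as cutting `S` at its classical under-crossings. -/

theorem finite_under (i : Fin n) :
    {t : ℝ | (∃ q, Meet S.curve (i, t) q) ∧ S.kind (i, t) = Passage.below}.Finite :=
  (S.finite_double.preimage (f := fun t : ℝ => (i, t))
    (fun _ _ _ _ h => (Prod.ext_iff.mp h).2)).subset fun _ ht => ht.1

/-- The times of the classical under-crossings of the `i`-th component. -/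
def underTimes (i : Fin n) : Finset ℝ := (S.finite_under i).toFinset

/-- The number `m_i` of classical under-crossings of the `i`-th component. -/
abbrev numUnder (i : Fin n) : ℕ := (S.underTimes i).card

/-- The arcs: the `i`-th component has the arcs `a_{i,1}, …, a_{i,m_i+1}`, in the order in which
they are passed; here `a_{i,j+1}` is the pair `⟨i, j⟩` with `0 ≤ j ≤ m_i`. -/
abbrev Arc : Type := Σ i : Fin n, Fin (S.numUnder i + 1)

/-- The arc on which a point (that is not an under-crossing) lies. -/
def arcAt (p : Fin n × ℝ) : S.Arc :=
  ⟨p.1, ⟨((S.underTimes p.1).filter (· < p.2)).card,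
    Nat.lt_succ_of_le (Finset.card_filter_le _ _)⟩⟩

/-- The `k`-th under-crossing of the `i`-th component, `k = 0, …, m_i - 1`. -/
def underPoint (i : Fin n) (k : Fin (S.numUnder i)) : Fin n × ℝ :=
  (i, (S.underTimes i).orderEmbOfFin rfl k)

open Classical in
/-- The other preimage of the double point `curve p`. -/
def partner (p : Fin n × ℝ) : Fin n × ℝ :=
  if h : ∃ q, Meet S.curve p q then h.choose else p

/-- The sign of the classical crossing with under-strand at `p`: it is `1` if the velocities of the
over-strand and of the under-strand, in this order, form a positively oriented basis of the plane,
and `-1` otherwise. -/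
def sign (p : Fin n × ℝ) : ℤ :=
  (SignType.sign (cross (velocity S.curve (S.partner p)) (velocity S.curve p)) : ℤ)

/-- The word `u_{i,1}^{ε_{i,1}} ⋯ u_{i,j}^{ε_{i,j}}` (the partial longitude `v_{i,j}`), where
`u_{i,k}` is the over-passing arc and `ε_{i,k}` the sign of the `k`-th under-crossing of the `i`-th
component. It is empty for `j = 0`. -/
def partialLongitude (i : Fin n) (j : ℕ) : FreeGroup S.Arc :=
  (((List.finRange (S.numUnder i)).take j).map fun k =>
    FreeGroup.of (S.arcAt (S.partner (S.underPoint i k))) ^ S.sign (S.underPoint i k)).prod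

/-- The sum `w_i` of the signs of all classical self-crossings of the `i`-th component. -/
def selfWrithe (i : Fin n) : ℤ :=
  ∑ k : Fin (S.numUnder i),
    if (S.partner (S.underPoint i k)).1 = i then S.sign (S.underPoint i k) else 0

/-- The preferred longitude `l_i = a_{i,1}^{-w_i} v_{i,m_i}`. -/
def longitude (i : Fin n) : FreeGroup S.Arc :=
  FreeGroup.of (⟨i, 0⟩ : S.Arc) ^ (-S.selfWrithe i) * S.partialLongitude i (S.numUnder i)

/-- The homomorphisms `η_q` for `q ≥ 1`: `η_1(a_{i,j}) = α_i`, and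
`η_{q+1}(a_{i,j+1}) = η_q(v_{i,j})⁻¹ α_i η_q(v_{i,j})`, with `v_{i,0} = 1`. Starting the recursion
with the trivial homomorphism at `q = 0` gives exactly this. -/
def eta : ℕ → FreeGroup S.Arc →* FreeGroup (Fin n)
  | 0 => 1
  | q + 1 => FreeGroup.lift fun a =>
      (eta q (S.partialLongitude a.1 a.2))⁻¹ * FreeGroup.of a.1 *
        eta q (S.partialLongitude a.1 a.2)

theorem eta_one_of (a : S.Arc) : S.eta 1 (FreeGroup.of a) = FreeGroup.of a.1 := by
  simp [eta]

/-- The Milnor number `μ_S^{(q)}(j₁ … jₛ i)`, `1 ≤ s < q`: the coefficient of `X_{j₁} ⋯ X_{jₛ}` in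
the Magnus expansion of `η_q(l_i)`. Here `J = [j₁, …, jₛ]`. -/
def milnor (q : ℕ) (J : List (Fin n)) (i : Fin n) : ℤ :=
  NCSeries.coeff J (magnus n (S.eta q (S.longitude i)) : NCSeries n)

end Diagram

/-! ### Planar isotopy and change of parametrization -/

section Moves

variable {n : ℕ} {x : Fin n → ℝ}

/-- `S` and `S'` are the same diagram with different parametrizations of the components. -/
def Reparametrization (S S' : Diagram n x) : Prop :=
  ∃ ρ : Fin n → ℝ → ℝ,
    (∀ i, ContDiff ℝ ∞ (ρ i) ∧ ρ i 0 = 0 ∧ ρ i 1 = 1 ∧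
      ∀ t ∈ Set.Icc (0 : ℝ) 1, 0 < deriv (ρ i) t) ∧
    (∀ i, ∀ t ∈ Set.Icc (0 : ℝ) 1, S'.curve (i, t) = S.curve (i, ρ i t)) ∧
    ∀ i t, (∃ q, Meet S'.curve (i, t) q) → S'.kind (i, t) = S.kind (i, ρ i t)

/-- `S'` is the image of `S` under a homeomorphism of the square that is the identity on the
boundary and an orientation preserving diffeomorphism of the interior. -/
def PlanarIsotopy (S S' : Diagram n x) : Prop :=
  ∃ Φ : ℝ × ℝ → ℝ × ℝ,
    ContinuousOn Φ (Set.Icc 0 1 ×ˢ Set.Icc 0 1) ∧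
    Set.BijOn Φ (Set.Icc 0 1 ×ˢ Set.Icc 0 1) (Set.Icc 0 1 ×ˢ Set.Icc 0 1) ∧
    (∀ z ∈ frontier (Set.Icc (0 : ℝ) 1 ×ˢ Set.Icc (0 : ℝ) 1), Φ z = z) ∧
    ContDiffOn ℝ ∞ Φ (Set.Ioo 0 1 ×ˢ Set.Ioo 0 1) ∧
    (∀ z ∈ Set.Ioo (0 : ℝ) 1 ×ˢ Set.Ioo (0 : ℝ) 1, 0 < (fderiv ℝ Φ z).det) ∧
    (∀ i, ∀ t ∈ Set.Icc (0 : ℝ) 1, S'.curve (i, t) = Φ (S.curve (i, t))) ∧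
    ∀ p, (∃ q, Meet S.curve p q) → S'.kind p = S.kind p

/-! ### Local moves

A local move takes place in a disk `δ` in the interior of the square, given with an orientation
preserving chart. Up to planar isotopy and change of parametrization, the two sides of each of the
moves can be drawn so that they differ in the position of one strand only. -/

/-- The square `[-1,1] × [-1,1]`, the model of a disk. -/
def Model : Set (ℝ × ℝ) := Set.Icc (-1) 1 ×ˢ Set.Icc (-1) 1

/-- A disk in the interior of `[0,1] × [0,1]`, as the image of the model disk under an orientation
preserving smooth embedding. -/
structure Disk where
  chart : ℝ × ℝ → ℝ × ℝ
  smooth : ContDiff ℝ ∞ chart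
  injOn : Set.InjOn chart Model
  det_pos : ∀ z ∈ Model, 0 < (fderiv ℝ chart z).det
  inside : Set.MapsTo chart Model (Set.Ioo 0 1 ×ˢ Set.Ioo 0 1)

/-- A part of the component `comp`, the one that is passed from time `lo` to time `hi`. -/
structure Strand (n : ℕ) where
  comp : Fin n
  lo : ℝ
  hi : ℝ
  pos : 0 < lo
  lt : lo < hi
  lt_one : hi < 1

/-- The set of all points of a strand. -/
def Strand.points (s : Strand n) : Set (Fin n × ℝ) :=
  {p | p.1 = s.comp ∧ p.2 ∈ Set.Icc s.lo s.hi}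

/-- The part of `S` that lies in the disk `δ` consists of the disjoint strands `s 0, …, s (k-1)`,
and `τ j` describes the strand `s j` in the chart of `δ`. -/
structure Tangle (S : Diagram n x) (δ : Disk) {k : ℕ} (s : Fin k → Strand n)
    (τ : Fin k → ℝ → ℝ × ℝ) : Prop where
  disjoint : ∀ j l, j ≠ l → Disjoint (s j).points (s l).points
  mem_iff : ∀ p : Fin n × ℝ, p.2 ∈ Set.Icc (0 : ℝ) 1 →
    (S.curve p ∈ δ.chart '' Model ↔ ∃ j, p ∈ (s j).points)
  smooth : ∀ j, ContDiff ℝ ∞ (τ j)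
  mem_model : ∀ j, ∀ t ∈ Set.Icc (s j).lo (s j).hi, τ j t ∈ Model
  chart_eq : ∀ j, ∀ t ∈ Set.Icc (s j).lo (s j).hi, S.curve ((s j).comp, t) = δ.chart (τ j t)

/-- `S` and `S'` coincide, except for the position of the strand `s m` and for the marks of the
double points on the strands `s 0, …, s (k-1)`. -/
def AgreeExcept (S S' : Diagram n x) {k : ℕ} (s : Fin k → Strand n) (m : Fin k) : Prop :=
  (∀ p : Fin n × ℝ, p.2 ∈ Set.Icc (0 : ℝ) 1 → p ∉ (s m).points → S'.curve p = S.curve p) ∧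
  ∀ p, (∃ q, Meet S.curve p q) → (∀ j, p ∉ (s j).points) → S'.kind p = S.kind p

/-- The moves with one strand. In `S` the strand has exactly one double point, in `S'` it has none.
The first passage of the strand through the double point is of the kind `c`. -/
def KinkMove (S S' : Diagram n x) (c : Passage) : Prop :=
  ∃ (δ : Disk) (s : Fin 1 → Strand n) (τ τ' : Fin 1 → ℝ → ℝ × ℝ),
    Tangle S δ s τ ∧ Tangle S' δ s τ' ∧ AgreeExcept S S' s 0 ∧
    Set.InjOn (τ' 0) (Set.Icc (s 0).lo (s 0).hi) ∧
    ∃ t₁ t₂, (s 0).lo < t₁ ∧ t₁ < t₂ ∧ t₂ < (s 0).hi ∧ τ 0 t₁ = τ 0 t₂ ∧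
      (∀ u ∈ Set.Icc (s 0).lo (s 0).hi, ∀ v ∈ Set.Icc (s 0).lo (s 0).hi,
        u < v → τ 0 u = τ 0 v → u = t₁ ∧ v = t₂) ∧
      S.kind ((s 0).comp, t₁) = c

/-- The curve runs from the left edge of the model disk to the right edge, or from right to left. -/
def RunsAcross (τ : ℝ → ℝ × ℝ) (lo hi : ℝ) : Prop :=
  (τ lo).1 = -1 ∧ (τ hi).1 = 1 ∨ (τ lo).1 = 1 ∧ (τ hi).1 = -1

/-- The moves with two strands. The strand `s 0` runs along the horizontal axis. In `S`, the strand
`s 1` begins and ends above the axis and is below the axis between two crossings with it; both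
passages of `s 1` through these crossings are of the kind `c`. In `S'`, the strand `s 1` stays
above the axis. -/
def BigonMove (S S' : Diagram n x) (c : Passage) : Prop :=
  ∃ (δ : Disk) (s : Fin 2 → Strand n) (τ τ' : Fin 2 → ℝ → ℝ × ℝ),
    Tangle S δ s τ ∧ Tangle S' δ s τ' ∧ AgreeExcept S S' s 1 ∧
    RunsAcross (τ 0) (s 0).lo (s 0).hi ∧
    (∀ t ∈ Set.Icc (s 0).lo (s 0).hi, (τ 0 t).2 = 0) ∧
    Set.InjOn (τ 1) (Set.Icc (s 1).lo (s 1).hi) ∧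
    Set.InjOn (τ' 1) (Set.Icc (s 1).lo (s 1).hi) ∧
    (∀ t ∈ Set.Icc (s 1).lo (s 1).hi, 0 < (τ' 1 t).2) ∧
    ∃ t₁ t₂, (s 1).lo < t₁ ∧ t₁ < t₂ ∧ t₂ < (s 1).hi ∧
      (∀ t ∈ Set.Ico (s 1).lo t₁, 0 < (τ 1 t).2) ∧
      (τ 1 t₁).2 = 0 ∧
      (∀ t ∈ Set.Ioo t₁ t₂, (τ 1 t).2 < 0) ∧
      (τ 1 t₂).2 = 0 ∧
      (∀ t ∈ Set.Ioc t₂ (s 1).hi, 0 < (τ 1 t).2) ∧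
      S.kind ((s 1).comp, t₁) = c ∧ S.kind ((s 1).comp, t₂) = c

/-- A curve in the model disk that runs, in one of the two directions, from the left edge to the
right edge, as the graph of a function of the horizontal coordinate whose slopes are smaller
than one in absolute value. -/
def Transversal (τ : ℝ → ℝ × ℝ) (lo hi : ℝ) : Prop :=
  RunsAcross τ lo hi ∧
  |(τ lo).2| < 1 ∧ |(τ hi).2| < 1 ∧
  ∀ t ∈ Set.Icc lo hi, |(deriv τ t).2| < |(deriv τ t).1|

/-- The moves with three strands. The strands `s 0` and `s 1` run along the two diagonals of the model
disk. The strand `s 2` goes from one side to the other, crossing each of the diagonals once; it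
passes above their intersection in `S` and below it in `S'`. At the crossing of the strands `s j`
and `s l` the passage of `s j` is of the kind `c j l`, both in `S` and in `S'`. -/
def TriangleMove (S S' : Diagram n x) (c : Fin 3 → Fin 3 → Passage) : Prop :=
  ∃ (δ : Disk) (s : Fin 3 → Strand n) (τ τ' : Fin 3 → ℝ → ℝ × ℝ),
    Tangle S δ s τ ∧ Tangle S' δ s τ' ∧ AgreeExcept S S' s 2 ∧
    RunsAcross (τ 0) (s 0).lo (s 0).hi ∧ RunsAcross (τ 1) (s 1).lo (s 1).hi ∧
    (∀ t ∈ Set.Icc (s 0).lo (s 0).hi, (τ 0 t).2 = (τ 0 t).1) ∧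
    (∀ t ∈ Set.Icc (s 1).lo (s 1).hi, (τ 1 t).2 = -(τ 1 t).1) ∧
    Transversal (τ 2) (s 2).lo (s 2).hi ∧ Transversal (τ' 2) (s 2).lo (s 2).hi ∧
    (∀ t ∈ Set.Icc (s 2).lo (s 2).hi, (τ 2 t).1 = 0 → 0 < (τ 2 t).2) ∧
    (∀ t ∈ Set.Icc (s 2).lo (s 2).hi, (τ' 2 t).1 = 0 → (τ' 2 t).2 < 0) ∧
    ∀ j l, j ≠ l → ∀ p ∈ (s j).points, ∀ q ∈ (s l).points,
      (Meet S.curve p q → S.kind p = c j l) ∧ (Meet S'.curve p q → S'.kind p = c j l)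

/-- The welded Reidemeister moves: the Reidemeister moves R1, R2, R3, the virtual moves V1, V2, V3,
V4 and the over-crossings commute move OC. -/
inductive WeldedMove (S S' : Diagram n x) : Prop
  | R1 (c : Passage) (hc : c ≠ Passage.virt) (h : KinkMove S S' c)
  | V1 (h : KinkMove S S' Passage.virt)
  | R2 (c : Passage) (hc : c ≠ Passage.virt) (h : BigonMove S S' c)
  | V2 (h : BigonMove S S' Passage.virt)
  /-- Three classical crossings; the strands lie at different heights. -/
  | R3 (height : Fin 3 → ℕ) (hheight : Function.Injective height)
      (h : TriangleMove S S' fun j l =>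
        if height l < height j then Passage.above else Passage.below)
  /-- Three virtual crossings. -/
  | V3 (h : TriangleMove S S' fun _ _ => Passage.virt)
  /-- The strand `m` crosses the two others virtually; these cross classically. -/
  | V4 (c : Fin 3 → Fin 3 → Passage) (m : Fin 3)
      (hm : ∀ l, l ≠ m → c m l = Passage.virt ∧ c l m = Passage.virt)
      (hc : ∀ j l, j ≠ m → l ≠ m → j ≠ l → c j l ≠ Passage.virt)
      (h : TriangleMove S S' c)
  /-- The strand `m` passes over the two others; these cross virtually. -/
  | OC (c : Fin 3 → Fin 3 → Passage) (m : Fin 3)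
      (hm : ∀ l, l ≠ m → c m l = Passage.above ∧ c l m = Passage.below)
      (hc : ∀ j l, j ≠ m → l ≠ m → j ≠ l → c j l = Passage.virt)
      (h : TriangleMove S S' c)

/-- A self-crossing virtualization: one classical crossing of a component with itself is replaced
with a virtual crossing. -/
def SelfVirtualization (S S' : Diagram n x) : Prop :=
  (∀ p : Fin n × ℝ, p.2 ∈ Set.Icc (0 : ℝ) 1 → S'.curve p = S.curve p) ∧
  ∃ p q, Meet S.curve p q ∧ p.1 = q.1 ∧
    S.kind p ≠ Passage.virt ∧ S'.kind p = Passage.virt ∧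
    ∀ r, (∃ r', Meet S.curve r r') → r ≠ p → r ≠ q → S'.kind r = S.kind r

/-- Welded isotopy of virtual string link diagrams, which are regarded up to planar isotopy. -/
def WeldedIsotopic : Diagram n x → Diagram n x → Prop :=
  Relation.EqvGen fun S S' =>
    Reparametrization S S' ∨ PlanarIsotopy S S' ∨ WeldedMove S S'

/-- `S` and `S'` are related by a finite sequence of self-crossing virtualizations (and their
inverses) and welded isotopies. -/
def SVEquivalent : Diagram n x → Diagram n x → Prop :=
  Relation.EqvGen fun S S' => SelfVirtualization S S' ∨ WeldedIsotopic S S'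

end Moves

end

end StringLink

/-! The coefficients in question belong to words without repetition that avoid the letter `i`. It
therefore suffices to know the longitude of the `i`-th component modulo the normal subgroup
`avoidKer q i`. This subgroup contains every conjugate of `α_i`, so self-crossings of the component
contribute nothing to its own longitude. In particular the framing factor and the choice of
classical or virtual self-crossings do not matter there.

The point is that these errors do not spread to other components. The colour of an arc is a
conjugate of `α_i` by a partial longitude. An error `z` in `avoidKer q i` in the conjugating element
changes the colour by a conjugate of the commutator of `z` with `α_i`. With `Z = E(z)` its expansion
minus 1 is `(Z - 1) X_i - X_i (Z - 1)` times a unit. Removing an end letter `i` from a non-repeated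
word leaves a shorter word without `i`, on which `Z - 1` vanishes. Hence colours agree modulo
`simpleKer n (q + 1)`: this is `conj_inv_mul_conj_mem_simpleKer`. It drives two inductions on `q`:
the independence of the level (`color_stable`, `longitude_stable`) and the comparison of two
diagrams (`LocallyEquivalent.color_mem_simpleKer`).

The topology enters only through Gauss data: times of under-crossings, over-passing points and
signs. Each local move alters them in finitely many windows. By
`LocallyEquivalent.longitude_mem_avoidKer` it is enough to compare the products of crossing
contributions over each window, for arbitrary group-valued colourings with equal initial colours, up
to normal subgroups that contain the colours of the respective components. For virtualization and
kinks all contributions are self-contributions (`inside_of_self`); for bigons two contributions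
cancel; for triangles a conjugation identity (`prodOn_lowest`) or the constancy of the relevant
colours (`prodOn_eq_of_simple`) suffices. The signs and orders of the crossings are read off in the
chart of the disk. Reparametrizations transport the Gauss data exactly, and planar isotopies do not
change them. -/

namespace StringLink

noncomputable section

open Filter Topology

/-! ### Subgroups of the free group cut out by coefficients of the Magnus expansion -/

section Magnus

variable {n : ℕ}

namespace NCSeries

theorem coeff_sub (w : List (Fin n)) (f g : NCSeries n) :
    coeff w (f - g) = coeff w f - coeff w g := rfl

theorem coeff_neg (w : List (Fin n)) (f : NCSeries n) : coeff w (-f) = -coeff w f := rfl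

/-- A set of words that contains all prefixes and suffixes of its members. -/
def FactorClosed (W : Set (List (Fin n))) : Prop :=
  ∀ w ∈ W, ∀ k, w.take k ∈ W ∧ w.drop k ∈ W

/-- The coefficients of the words in `W` vanish. -/
def VanishOn (W : Set (List (Fin n))) (f : NCSeries n) : Prop := ∀ w ∈ W, coeff w f = 0

variable {W : Set (List (Fin n))}

/-- Every summand of the Cauchy product at `w` pairs a prefix with a suffix of `w`, so for
factor-closed `W` the series vanishing on `W` form a two-sided ideal. This makes `magnusKer` a
normal subgroup. -/
theorem VanishOn.mul_left {f : NCSeries n} (hW : FactorClosed W) (h : VanishOn W f)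
    (g : NCSeries n) : VanishOn W (g * f) := fun w hw => by
  rw [coeff_mul]
  exact Finset.sum_eq_zero fun k _ => by rw [h _ (hW w hw k).2, mul_zero]

theorem VanishOn.mul_right {f : NCSeries n} (hW : FactorClosed W) (h : VanishOn W f)
    (g : NCSeries n) : VanishOn W (f * g) := fun w hw => by
  rw [coeff_mul]
  exact Finset.sum_eq_zero fun k _ => by rw [h _ (hW w hw k).1, zero_mul]

theorem VanishOn.add {f g : NCSeries n} (hf : VanishOn W f) (hg : VanishOn W g) :
    VanishOn W (f + g) := fun w hw => by rw [coeff_add, hf w hw, hg w hw, add_zero]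

theorem VanishOn.neg {f : NCSeries n} (hf : VanishOn W f) : VanishOn W (-f) :=
  fun w hw => by rw [coeff_neg, hf w hw, neg_zero]

theorem coeff_mul_X (w : List (Fin n)) (i : Fin n) (f : NCSeries n) :
    coeff w (f * X i) = if w.drop (w.length - 1) = [i] then coeff (w.take (w.length - 1)) f
      else 0 := by
  rw [coeff_mul, Finset.sum_eq_single (w.length - 1)]
  · rw [coeff_X]; split_ifs <;> simp
  · intro k hk hk'
    simp only [Finset.mem_range] at hk
    rw [coeff_X, if_neg, mul_zero]
    intro h
    have := congrArg List.length h
    simp at this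
    omega
  · intro h
    simp at h

theorem coeff_X_mul (w : List (Fin n)) (i : Fin n) (f : NCSeries n) :
    coeff w (X i * f) = if w.take 1 = [i] then coeff (w.drop 1) f else 0 := by
  rw [coeff_mul]
  cases w with
  | nil => simp [coeff_X]
  | cons a v =>
    rw [Finset.sum_eq_single 1]
    · rw [coeff_X]; split_ifs <;> simp
    · intro k hk hk'
      simp only [Finset.mem_range, List.length_cons] at hk
      rw [coeff_X, if_neg, zero_mul]
      intro h
      have := congrArg List.length h
      simp at this
      omega
    · intro h
      simp at h

end NCSeries

open NCSeries

theorem coe_magnus_of (i : Fin n) : (magnus n (FreeGroup.of i) : NCSeries n) = 1 + X i := by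
  simp [magnus]

/-- The elements of the free group whose Magnus expansion coincides with `1` on the words in `W`. -/
def magnusKer (W : Set (List (Fin n))) (hW : FactorClosed W) : Subgroup (FreeGroup (Fin n)) where
  carrier := {g | VanishOn W ((magnus n g : NCSeries n) - 1)}
  one_mem' := by intro w _; simp [coeff_zero]
  mul_mem' := by
    intro a b ha hb
    have : ((magnus n (a * b) : NCSeries n) - 1) =
        (magnus n a : NCSeries n) * ((magnus n b : NCSeries n) - 1) +
          ((magnus n a : NCSeries n) - 1) := by
      rw [map_mul, Units.val_mul]; noncomm_ring
    rw [Set.mem_ofPred_eq, this]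
    exact (hb.mul_left hW _).add ha
  inv_mem' := by
    intro a ha
    have : ((magnus n a⁻¹ : NCSeries n) - 1) =
        -((magnus n a⁻¹ : NCSeries n) * ((magnus n a : NCSeries n) - 1)) := by
      rw [map_inv, mul_sub, Units.inv_mul, mul_one, neg_sub]
    rw [Set.mem_ofPred_eq, this]
    exact (ha.mul_left hW _).neg

theorem mem_magnusKer {W : Set (List (Fin n))} {hW : FactorClosed W} {g : FreeGroup (Fin n)} :
    g ∈ magnusKer W hW ↔ VanishOn W ((magnus n g : NCSeries n) - 1) := Iff.rfl

instance magnusKer_normal (W : Set (List (Fin n))) (hW : FactorClosed W) :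
    (magnusKer W hW).Normal where
  conj_mem a ha g := by
    have : ((magnus n (g * a * g⁻¹) : NCSeries n) - 1) =
        (magnus n g : NCSeries n) * ((magnus n a : NCSeries n) - 1) *
          (magnus n g⁻¹ : NCSeries n) := by
      rw [map_mul, map_mul, Units.val_mul, Units.val_mul, mul_sub, sub_mul, mul_one, map_inv,
        Units.mul_inv]
    rw [mem_magnusKer, this]
    exact (ha.mul_left hW _).mul_right hW _

/-- The non-repeated words of length at most `q`. -/
def simpleWords (n q : ℕ) : Set (List (Fin n)) := {w | w.Nodup ∧ w.length ≤ q}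

/-- The non-repeated words of length at most `q` without the letter `i`. -/
def simpleWordsAvoiding (q : ℕ) (i : Fin n) : Set (List (Fin n)) :=
  {w | w ∈ simpleWords n q ∧ i ∉ w}

theorem factorClosed_simpleWords (q : ℕ) : FactorClosed (simpleWords n q) := fun w hw k =>
  ⟨⟨hw.1.sublist (w.take_sublist k), (w.take_sublist k).length_le.trans hw.2⟩,
    ⟨hw.1.sublist (w.drop_sublist k), (w.drop_sublist k).length_le.trans hw.2⟩⟩

theorem factorClosed_simpleWordsAvoiding (q : ℕ) (i : Fin n) :
    FactorClosed (simpleWordsAvoiding q i) := fun w hw k =>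
  ⟨⟨(factorClosed_simpleWords q w hw.1 k).1, fun h => hw.2 (List.mem_of_mem_take h)⟩,
    ⟨(factorClosed_simpleWords q w hw.1 k).2, fun h => hw.2 (List.mem_of_mem_drop h)⟩⟩

/-- The elements of the free group that are trivial up to degree `q` on non-repeated words. -/
abbrev simpleKer (n q : ℕ) : Subgroup (FreeGroup (Fin n)) :=
  magnusKer (simpleWords n q) (factorClosed_simpleWords q)

/-- The elements of the free group that are trivial up to degree `q` on non-repeated words
without the letter `i`. -/
abbrev avoidKer (q : ℕ) (i : Fin n) : Subgroup (FreeGroup (Fin n)) :=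
  magnusKer (simpleWordsAvoiding q i) (factorClosed_simpleWordsAvoiding q i)

theorem simpleKer_le_avoidKer (q : ℕ) (i : Fin n) : simpleKer n q ≤ avoidKer q i :=
  fun _ hg w hw => hg w hw.1

theorem simpleKer_anti {q r : ℕ} (h : q ≤ r) : simpleKer n r ≤ simpleKer n q :=
  fun _ hg w hw => hg w ⟨hw.1, hw.2.trans h⟩

theorem of_mem_avoidKer (q : ℕ) (i : Fin n) : FreeGroup.of i ∈ avoidKer q i := by
  intro w hw
  rw [coe_magnus_of, add_sub_cancel_left, coeff_X, if_neg]
  rintro rfl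
  exact hw.2 (by simp)

theorem of_mem_simpleKer_zero (i : Fin n) : FreeGroup.of i ∈ simpleKer n 0 := by
  intro w hw
  rw [coe_magnus_of, add_sub_cancel_left, coeff_X, if_neg]
  rintro rfl
  exact absurd hw.2 (by simp)

/-- This is where non-repetition is used. Since `E(α_i) = 1 + X_i`, the expansion minus 1 is `((Z -
1) X_i - X_i (Z - 1)) Z⁻¹ Y⁻¹`. A non-repeated word beginning or ending in `i` has its remaining
letters different from `i`, and there are at most `q` of them, so `hz` applies to the remaining
word. One degree is gained. -/
theorem commutator_mem_simpleKer {q : ℕ} {i : Fin n} {z : FreeGroup (Fin n)}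
    (hz : z ∈ avoidKer q i) :
    z * FreeGroup.of i * z⁻¹ * (FreeGroup.of i)⁻¹ ∈ simpleKer n (q + 1) := by
  set Z := magnus n z
  set Y := magnus n (FreeGroup.of i) with hY
  have hYX : (Y : NCSeries n) = 1 + X i := coe_magnus_of i
  have key : ((Z * Y * Z⁻¹ * Y⁻¹ : (NCSeries n)ˣ) : NCSeries n) - 1 =
      (((Z : NCSeries n) - 1) * X i - X i * ((Z : NCSeries n) - 1)) *
        ((Z⁻¹ * Y⁻¹ : (NCSeries n)ˣ) : NCSeries n) := by
    have h1 : ((Z : NCSeries n) - 1) * X i - X i * ((Z : NCSeries n) - 1) =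
        ((Z * Y : (NCSeries n)ˣ) : NCSeries n) - ((Y * Z : (NCSeries n)ˣ) : NCSeries n) := by
      rw [Units.val_mul, Units.val_mul, hYX]; noncomm_ring
    rw [h1, sub_mul, ← Units.val_mul, ← Units.val_mul,
      show Y * Z * (Z⁻¹ * Y⁻¹) = 1 by group, ← mul_assoc, Units.val_one]
  rw [mem_magnusKer, map_mul, map_mul, map_mul, map_inv, map_inv, key]
  refine VanishOn.mul_right (factorClosed_simpleWords _) ?_ _
  intro w hw
  rw [coeff_sub, coeff_mul_X, coeff_X_mul]
  have h1 : (if w.drop (w.length - 1) = [i] then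
      coeff (w.take (w.length - 1)) ((Z : NCSeries n) - 1) else 0) = 0 := by
    split_ifs with h
    · have hw' := w.take_append_drop (w.length - 1)
      rw [h] at hw'
      have hnd := hw.1
      rw [← hw'] at hnd
      refine hz _ ⟨⟨(factorClosed_simpleWords _ w hw _).1.1, ?_⟩, ?_⟩
      · have := hw.2; simp; omega
      · intro hi
        exact List.disjoint_of_nodup_append hnd hi (by simp)
    · rfl
  have h2 : (if w.take 1 = [i] then coeff (w.drop 1) ((Z : NCSeries n) - 1) else 0) = 0 := by
    split_ifs with h
    · have hw' := w.take_append_drop 1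
      rw [h] at hw'
      have hnd := hw.1
      rw [← hw'] at hnd
      refine hz _ ⟨⟨(factorClosed_simpleWords _ w hw _).2.1, ?_⟩, ?_⟩
      · have := hw.2; simp; omega
      · intro hi
        exact List.disjoint_of_nodup_append hnd (by simp) hi
    · rfl
  rw [h1, h2, sub_zero]

/-- The inductive engine: a partial longitude known only modulo `avoidKer q i` determines the next
colour modulo `simpleKer n (q + 1)`. The quotient of the two conjugates is a conjugate of the
commutator of `x * y⁻¹` with `α_i`. -/
theorem conj_inv_mul_conj_mem_simpleKer {q : ℕ} {i : Fin n} {x y : FreeGroup (Fin n)}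
    (h : x⁻¹ * y ∈ avoidKer q i) :
    (x⁻¹ * FreeGroup.of i * x)⁻¹ * (y⁻¹ * FreeGroup.of i * y) ∈ simpleKer n (q + 1) := by
  have hz : (y * x⁻¹)⁻¹ ∈ avoidKer q i := by
    have := (magnusKer_normal _ (factorClosed_simpleWordsAvoiding q i)).conj_mem _ h x
    rw [show x * (x⁻¹ * y) * x⁻¹ = y * x⁻¹ by group] at this
    exact inv_mem this
  have := (magnusKer_normal _ (factorClosed_simpleWords (q + 1))).conj_mem _
    (commutator_mem_simpleKer hz) (x⁻¹ * (FreeGroup.of i)⁻¹)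
  convert this using 1
  group

/-- Follows from `E(y) - E(x) = E(x) (E(x⁻¹ y) - 1)` and the ideal property. -/
theorem coeff_magnus_eq_of_mem_avoidKer {q : ℕ} {i : Fin n} {x y : FreeGroup (Fin n)}
    (h : x⁻¹ * y ∈ avoidKer q i) {J : List (Fin n)} (hJ : J ∈ simpleWordsAvoiding q i) :
    coeff J (magnus n x : NCSeries n) = coeff J (magnus n y : NCSeries n) := by
  have h1 := (VanishOn.mul_left (factorClosed_simpleWordsAvoiding q i) h
    (magnus n x : NCSeries n)) J hJ
  rw [mul_sub, mul_one, ← Units.val_mul, ← map_mul, mul_inv_cancel_left, coeff_sub] at h1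
  omega

end Magnus

/-! ### Gauss data -/

/-- The combinatorial data of a diagram: the times of the classical under-crossings, the points
on the over-strands and the signs. -/
structure GaussData (n : ℕ) where
  under : Fin n → Finset ℝ
  upper : Fin n × ℝ → Fin n × ℝ
  sgn : Fin n × ℝ → ℤ

/-- The part of a component that is passed from time `lo` to time `hi`. -/
structure Window (n : ℕ) where
  comp : Fin n
  lo : ℝ
  hi : ℝ
  le : lo ≤ hi

/-- The set of all points of a window. -/
def Window.points {n : ℕ} (W : Window n) : Set (Fin n × ℝ) :=
  {p | p.1 = W.comp ∧ p.2 ∈ Set.Icc W.lo W.hi}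

namespace GaussData

variable {n : ℕ} (D D' : GaussData n) {G : Type*} [Group G] (c c' : Fin n × ℝ → G) (i : Fin n)
  (I J : Set ℝ)

open Classical in
/-- The times of the under-crossings of the `i`-th component that belong to `I`, in order. -/
def timesIn : List ℝ := ((D.under i).sort).filter fun t => decide (t ∈ I)

/-- The contribution of the under-crossing `p` to the longitudes, for given colours of the points
of the diagram. -/
def factor (p : Fin n × ℝ) : G := c (D.upper p) ^ D.sgn p

/-- The product of the contributions of the under-crossings with times in `I`. -/
def prodOn : G := ((D.timesIn i I).map fun t => D.factor c (i, t)).prod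

variable {D D' c c' i I J}

@[simp] theorem mem_timesIn {t : ℝ} : t ∈ D.timesIn i I ↔ t ∈ D.under i ∧ t ∈ I := by
  simp [timesIn]

theorem timesIn_sortedLT : (D.timesIn i I).SortedLT :=
  (List.Pairwise.filter _ ((D.under i).sortedLT_sort).pairwise).sortedLT

/-- A strictly increasing list is determined by its members. All later products are computed by
exhibiting such a list. -/
theorem timesIn_eq {l : List ℝ} (hl : l.SortedLT) (h : ∀ t, t ∈ l ↔ t ∈ D.under i ∧ t ∈ I) :
    D.timesIn i I = l := by
  refine List.Perm.eq_of_pairwise (le := (· ≤ ·)) (fun a b _ _ => le_antisymm)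
    timesIn_sortedLT.sortedLE.pairwise hl.sortedLE.pairwise ?_
  rw [List.perm_ext_iff_of_nodup timesIn_sortedLT.nodup hl.nodup]
  intro t
  rw [mem_timesIn, h]

theorem prodOn_eq {l : List ℝ} (hl : l.SortedLT) (h : ∀ t, t ∈ l ↔ t ∈ D.under i ∧ t ∈ I) :
    D.prodOn c i I = (l.map fun t => D.factor c (i, t)).prod := by
  rw [prodOn, timesIn_eq hl h]

theorem prodOn_eq_one (h : ∀ t ∈ I, t ∉ D.under i) : D.prodOn c i I = 1 :=
  prodOn_eq (l := []) (List.Pairwise.nil.sortedLT) fun t => by simpa using fun h1 h2 => h t h2 h1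

theorem prodOn_singleton {t : ℝ} (h : ∀ u, u ∈ D.under i ∧ u ∈ I ↔ u = t) :
    D.prodOn c i I = D.factor c (i, t) := by
  rw [prodOn_eq (l := [t]) (List.pairwise_singleton _ _).sortedLT fun u => by rw [h]; simp]
  simp

theorem prodOn_pair {t u : ℝ} (htu : t < u) (h : ∀ v, v ∈ D.under i ∧ v ∈ I ↔ v = t ∨ v = u) :
    D.prodOn c i I = D.factor c (i, t) * D.factor c (i, u) := by
  rw [prodOn_eq (l := [t, u]) (List.pairwise_pair.mpr htu).sortedLT fun v => by rw [h]; simp]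
  simp

theorem prodOn_union (h : ∀ t ∈ I, ∀ u ∈ J, t < u) :
    D.prodOn c i (I ∪ J) = D.prodOn c i I * D.prodOn c i J := by
  rw [prodOn_eq (l := D.timesIn i I ++ D.timesIn i J), List.map_append, List.prod_append]
  · rfl
  · refine (List.pairwise_append.mpr ⟨timesIn_sortedLT.pairwise, timesIn_sortedLT.pairwise,
      ?_⟩).sortedLT
    intro a ha b hb
    exact h a (mem_timesIn.mp ha).2 b (mem_timesIn.mp hb).2
  · intro t
    simp [and_or_left]

theorem prodOn_congr (h : ∀ t ∈ I, t ∈ D.under i ↔ t ∈ D'.under i)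
    (hf : ∀ t ∈ I, t ∈ D.under i → D.factor c (i, t) = D'.factor c' (i, t)) :
    D.prodOn c i I = D'.prodOn c' i I := by
  rw [prodOn_eq (timesIn_sortedLT (D := D') (i := i) (I := I))]
  · rw [prodOn]
    refine congrArg List.prod (List.map_congr_left fun t ht => ?_)
    rw [mem_timesIn] at ht
    exact hf t ht.2 ((h t ht.2).mpr ht.1)
  · intro t
    rw [mem_timesIn]
    exact ⟨fun ht => ⟨(h t ht.2).mpr ht.1, ht.2⟩, fun ht => ⟨(h t ht.2).mp ht.1, ht.2⟩⟩

theorem prodOn_inter (I J : Set ℝ) (h : ∀ t ∈ D.under i, t ∈ I ↔ t ∈ J) :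
    D.prodOn c i I = D.prodOn c i J := by
  rw [prodOn_eq timesIn_sortedLT, prodOn]
  intro t
  rw [mem_timesIn]
  exact and_congr_right fun ht => (h t ht).symm

theorem prodOn_mem (N : Subgroup G)
    (h : ∀ t ∈ I, t ∈ D.under i → D.factor c (i, t) ∈ N) : D.prodOn c i I ∈ N := by
  refine N.list_prod_mem fun x hx => ?_
  obtain ⟨t, ht, rfl⟩ := List.mem_map.mp hx
  rw [mem_timesIn] at ht
  exact h t ht.2 ht.1

theorem map_prodOn {H : Type*} [Group H] (φ : G →* H) :
    φ (D.prodOn c i I) = D.prodOn (fun p => φ (c p)) i I := by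
  rw [prodOn, map_list_prod, List.map_map, prodOn]
  refine congrArg List.prod (List.map_congr_left fun t _ => ?_)
  simp [factor]

/-- The colouring `η_q` of the points of the diagram by elements of the free group. -/
def color (D : GaussData n) : ℕ → Fin n × ℝ → FreeGroup (Fin n)
  | 0, _ => 1
  | q + 1, p => (D.prodOn (color D q) p.1 (Set.Iio p.2))⁻¹ * FreeGroup.of p.1 *
      D.prodOn (color D q) p.1 (Set.Iio p.2)

/-- The unframed longitude of the `i`-th component. -/
def longitude (D : GaussData n) (q : ℕ) (i : Fin n) : FreeGroup (Fin n) :=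
  D.prodOn (D.color q) i Set.univ

theorem color_succ (D : GaussData n) (q : ℕ) (i : Fin n) (t : ℝ) : D.color (q + 1) (i, t) =
    (D.prodOn (D.color q) i (Set.Iio t))⁻¹ * FreeGroup.of i *
      D.prodOn (D.color q) i (Set.Iio t) := rfl

theorem color_mem_of_normal (q : ℕ) (p : Fin n × ℝ) (N : Subgroup (FreeGroup (Fin n))) [N.Normal]
    (h : FreeGroup.of p.1 ∈ N) : D.color q p ∈ N := by
  cases q with
  | zero => exact N.one_mem
  | succ q =>
    have := ‹N.Normal›.conj_mem _ h (D.prodOn (D.color q) p.1 (Set.Iio p.2))⁻¹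
    rwa [inv_inv] at this

theorem color_mem_avoidKer (q r : ℕ) (p : Fin n × ℝ) : D.color q p ∈ avoidKer r p.1 :=
  color_mem_of_normal q p _ (of_mem_avoidKer r p.1)

/-- In the quotient by `N` the two colourings coincide, hence so do the products. -/
theorem prodOn_inv_mul_mem (N : Subgroup (FreeGroup (Fin n))) [N.Normal]
    {c c' : Fin n × ℝ → FreeGroup (Fin n)} (h : ∀ p, (c p)⁻¹ * c' p ∈ N) :
    (D.prodOn c i I)⁻¹ * D.prodOn c' i I ∈ N := by
  rw [← QuotientGroup.eq]
  change QuotientGroup.mk' N _ = QuotientGroup.mk' N _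
  rw [map_prodOn, map_prodOn]
  refine prodOn_congr (fun _ _ => Iff.rfl) fun t _ _ => ?_
  have : QuotientGroup.mk' N (c (D.upper (i, t))) = QuotientGroup.mk' N (c' (D.upper (i, t))) :=
    QuotientGroup.eq.mpr (h _)
  simp only [factor, this]

/-- The recursion for the colours stabilizes: passing from level `q` to `q + 1` changes nothing in
degrees up to `q`. Consequently the level `q` colours satisfy the conjugation rule with their own
longitudes modulo `simpleKer n q`. -/
theorem color_stable (q : ℕ) : ∀ p, (D.color q p)⁻¹ * D.color (q + 1) p ∈ simpleKer n q := by
  induction q with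
  | zero =>
    intro p
    -- Modulo `simpleKer n 0` only the constant coefficient counts, so every element is trivial
    -- there, as is the starting colour.
    rw [show D.color 0 p = 1 from rfl, inv_one, one_mul]
    exact color_mem_of_normal 1 p _ (of_mem_simpleKer_zero p.1)
  | succ q ih =>
    rintro ⟨i, t⟩
    exact conj_inv_mul_conj_mem_simpleKer
      (simpleKer_le_avoidKer q i (prodOn_inv_mul_mem (simpleKer n q) ih))

theorem longitude_stable {q r : ℕ} (h : q ≤ r) (i : Fin n) :
    (D.longitude q i)⁻¹ * D.longitude r i ∈ avoidKer q i := by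
  induction r, h using Nat.le_induction with
  | base => simp
  | succ r hr ih =>
    have h1 : (D.longitude r i)⁻¹ * D.longitude (r + 1) i ∈ avoidKer q i :=
      simpleKer_le_avoidKer q i (prodOn_inv_mul_mem (simpleKer n q) fun p =>
        simpleKer_anti hr (color_stable r p))
    simpa [mul_assoc] using mul_mem ih h1

/-- The colours of the points of the window `W` are related by the conjugation rule. -/
def ColoringOn (D : GaussData n) (c : Fin n × ℝ → G) (W : Window n) : Prop :=
  ∀ t ∈ Set.Icc W.lo W.hi, c (W.comp, t) =
    (D.prodOn c W.comp (Set.Ico W.lo t))⁻¹ * c (W.comp, W.lo) * D.prodOn c W.comp (Set.Ico W.lo t)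

/-- Two Gauss data that coincide outside of the windows `W j`, while in the windows every
colouring that agrees at the initial points of the windows gives the same longitudes. -/
structure LocallyEquivalent {ι : Type} (D D' : GaussData n) (W : ι → Window n) : Prop where
  disjoint : ∀ j l, j ≠ l → Disjoint (W j).points (W l).points
  under_iff : ∀ i t, (∀ j, (i, t) ∉ (W j).points) → (t ∈ D.under i ↔ t ∈ D'.under i)
  outside : ∀ i t, (∀ j, (i, t) ∉ (W j).points) → t ∈ D.under i →
    D.upper (i, t) = D'.upper (i, t) ∧ D.sgn (i, t) = D'.sgn (i, t) ∧
      ∀ j, D.upper (i, t) ∉ (W j).points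
  inside : ∀ (G : Type) [Group G] (N : Fin n → Subgroup G) [∀ i, (N i).Normal]
    (c c' : Fin n × ℝ → G), (∀ p, c p ∈ N p.1) → (∀ p, c' p ∈ N p.1) →
    (∀ j, D.ColoringOn c (W j)) → (∀ j, D'.ColoringOn c' (W j)) →
    (∀ j, c ((W j).comp, (W j).lo) = c' ((W j).comp, (W j).lo)) → ∀ j,
    (D.prodOn c (W j).comp (Set.Icc (W j).lo (W j).hi))⁻¹ *
      D'.prodOn c' (W j).comp (Set.Icc (W j).lo (W j).hi) ∈ N (W j).comp

/-- By definition the level `q + 1` colour is the conjugate of `α_i` by the level `q` partial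
longitude; modulo `simpleKer n q` the two levels agree. Cutting the partial longitude at `W.lo`
gives the rule relative to the initial point of the window. -/
theorem coloringOn_color (q : ℕ) (W : Window n) :
    D.ColoringOn (fun p => QuotientGroup.mk' (simpleKer n q) (D.color q p)) W := by
  have key : ∀ t, QuotientGroup.mk' (simpleKer n q) (D.color q (W.comp, t)) =
      QuotientGroup.mk' (simpleKer n q) ((D.prodOn (D.color q) W.comp (Set.Iio t))⁻¹ *
        FreeGroup.of W.comp * D.prodOn (D.color q) W.comp (Set.Iio t)) := fun t =>
    QuotientGroup.eq.mpr (color_stable q (W.comp, t))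
  intro t ht
  beta_reduce
  rw [key t, key W.lo, ← map_prodOn, ← map_inv, ← map_mul, ← map_mul,
    show Set.Iio t = Set.Iio W.lo ∪ Set.Ico W.lo t from
      (Set.Iio_union_Ico_eq_Iio ht.1).symm,
    prodOn_union (I := Set.Iio W.lo) fun a ha b hb => lt_of_lt_of_le ha hb.1]
  congr 1
  group

/-! ### Invariance of the longitudes under changes inside windows. -/

section Invariance

variable {ι : Type} {W : ι → Window n}

/-- No window contains the point, except possibly as its initial point. -/
def Avoids (W : ι → Window n) (i : Fin n) (t : ℝ) : Prop :=
  ∀ j, (W j).comp = i → t ≤ (W j).lo ∨ (W j).hi < t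

theorem avoids_of_notMem {i : Fin n} {t : ℝ} (h : ∀ j, (i, t) ∉ (W j).points) :
    Avoids W i t := by
  intro j hj
  by_contra! hc
  exact h j ⟨hj.symm, hc.1.le, hc.2⟩

theorem LocallyEquivalent.avoids_lo (h : LocallyEquivalent D D' W) (j : ι) :
    Avoids W (W j).comp (W j).lo := by
  intro l hl
  by_contra! hc
  by_cases hjl : j = l
  · subst hjl; exact absurd hc.1 (lt_irrefl _)
  · refine Set.disjoint_left.mp (h.disjoint j l hjl) (?_ : ((W j).comp, (W j).lo) ∈ _)
      ⟨hl.symm, hc.1.le, hc.2⟩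
    exact ⟨rfl, le_rfl, (W j).le⟩

/-- Up to an admissible time, a component is a chain of gaps and complete windows. Contributions
from gaps agree by the hypothesis on colours, and those from windows by `inside`. The induction is
on the number `m` of windows completed before `t`. -/
theorem LocallyEquivalent.prodOn_mem_avoidKer [Finite ι] (h : LocallyEquivalent D D' W) (q : ℕ)
    (hq : ∀ i t, Avoids W i t → (D.color q (i, t))⁻¹ * D'.color q (i, t) ∈ simpleKer n q)
    (i : Fin n) (m : ℕ) : ∀ t, Avoids W i t → {j | (W j).comp = i ∧ (W j).hi < t}.ncard = m →
      (D.prodOn (D.color q) i (Set.Iio t))⁻¹ * D'.prodOn (D'.color q) i (Set.Iio t) ∈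
        avoidKer q i := by
  -- Outside the windows the crossings are the same, and their over-passing points lie outside too,
  -- where the colours are comparable.
  have hout : ∀ I : Set ℝ, (∀ u ∈ I, ∀ j, (i, u) ∉ (W j).points) →
      (D.prodOn (D.color q) i I)⁻¹ * D'.prodOn (D'.color q) i I ∈ avoidKer q i := by
    intro I hI
    apply simpleKer_le_avoidKer
    rw [← QuotientGroup.eq]
    change QuotientGroup.mk' (simpleKer n q) _ = QuotientGroup.mk' (simpleKer n q) _
    rw [map_prodOn, map_prodOn]
    refine prodOn_congr (fun u hu => h.under_iff i u (hI u hu)) fun u hu hu' => ?_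
    obtain ⟨h1, h2, h3⟩ := h.outside i u (hI u hu) hu'
    have h4 : QuotientGroup.mk' (simpleKer n q) (D.color q (D'.upper (i, u))) =
        QuotientGroup.mk' (simpleKer n q) (D'.color q (D'.upper (i, u))) :=
      QuotientGroup.eq.mpr (hq _ _ (avoids_of_notMem fun j => by
        change D'.upper (i, u) ∉ _
        rw [← h1]
        exact h3 j))
    simp only [factor, h1, h2, h4]
  have hin : ∀ j, (W j).comp = i → (D.prodOn (D.color q) i (Set.Icc (W j).lo (W j).hi))⁻¹ *
      D'.prodOn (D'.color q) i (Set.Icc (W j).lo (W j).hi) ∈ avoidKer q i := by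
    rintro j rfl
    -- The local condition is applied in the quotient by `simpleKer n q`, where the colours obey the
    -- conjugation rule exactly. Its kernel lies in `avoidKer q i`, so the conclusion can be pulled
    -- back to the free group.
    have hker : ∀ i, (QuotientGroup.mk' (simpleKer n q)).ker ≤ avoidKer q i := fun i => by
      rw [QuotientGroup.ker_mk']; exact simpleKer_le_avoidKer q i
    have := fun i => Subgroup.Normal.map (magnusKer_normal _ (factorClosed_simpleWordsAvoiding q i))
      (QuotientGroup.mk' (simpleKer n q)) (QuotientGroup.mk'_surjective _)
    have := h.inside (FreeGroup (Fin n) ⧸ simpleKer n q)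
      (fun i => (avoidKer q i).map (QuotientGroup.mk' (simpleKer n q)))
      (fun p => QuotientGroup.mk' _ (D.color q p)) (fun p => QuotientGroup.mk' _ (D'.color q p))
      (fun p => Subgroup.mem_map_of_mem _ (color_mem_avoidKer q q p))
      (fun p => Subgroup.mem_map_of_mem _ (color_mem_avoidKer q q p))
      (fun j => coloringOn_color q (W j)) (fun j => coloringOn_color q (W j))
      (fun j => QuotientGroup.eq.mpr (hq _ _ (h.avoids_lo j))) j
    rwa [← map_prodOn, ← map_prodOn, ← map_inv, ← map_mul, ← Subgroup.mem_comap,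
      Subgroup.comap_map_eq_self (hker _)] at this
  induction m using Nat.strong_induction_on with
  | _ m ih =>
    intro t ht hm
    rcases Set.eq_empty_or_nonempty {j | (W j).comp = i ∧ (W j).hi < t} with he | hne
    · refine hout _ fun u hu j hj => ?_
      rcases ht j hj.1.symm with h1 | h1
      · exact absurd (hj.2.1.trans_lt hu) (not_lt.mpr h1)
      · exact Set.eq_empty_iff_forall_notMem.mp he j ⟨hj.1.symm, h1⟩
    -- Peel off the last window completed before `t`; maximality of its end makes the interval from
    -- that end to `t` a gap.
    · obtain ⟨j, ⟨hj, hjt⟩, hmax⟩ :=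
        Set.exists_max_image _ (fun j => (W j).hi) (Set.toFinite _) hne
      have hlo := h.avoids_lo j
      rw [hj] at hlo
      have h1 := ih _ ?_ (W j).lo hlo rfl
      · have h2 := hin j hj
        have h3 := hout (Set.Ioo (W j).hi t) ?_
        · have hu : Set.Iio t = (Set.Iio (W j).lo ∪ Set.Icc (W j).lo (W j).hi) ∪
              Set.Ioo (W j).hi t := by
            have := (W j).le
            ext u
            simp only [Set.mem_Iio, Set.mem_union, Set.mem_Icc, Set.mem_Ioo]
            constructor
            · intro hu
              rcases lt_or_ge u (W j).lo with h | h
              · exact Or.inl (Or.inl h)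
              · rcases le_or_gt u (W j).hi with h' | h'
                · exact Or.inl (Or.inr ⟨h, h'⟩)
                · exact Or.inr ⟨h', hu⟩
            · rintro ((h | h) | h)
              · linarith
              · linarith [h.2]
              · exact h.2
          have hs : ∀ (E : GaussData n) (d : Fin n × ℝ → FreeGroup (Fin n)),
              E.prodOn d i (Set.Iio t) = E.prodOn d i (Set.Iio (W j).lo) *
                E.prodOn d i (Set.Icc (W j).lo (W j).hi) * E.prodOn d i (Set.Ioo (W j).hi t) := by
            intro E d
            rw [hu, prodOn_union, prodOn_union]
            · intro a ha b hb
              exact lt_of_lt_of_le ha hb.1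
            · rintro a (ha | ha) b hb
              · exact (lt_of_lt_of_le ha (W j).le).trans hb.1
              · exact ha.2.trans_lt hb.1
          rw [hs, hs]
          rw [← QuotientGroup.eq] at h1 h2 h3 ⊢
          rw [QuotientGroup.mk_mul, QuotientGroup.mk_mul, h1, h2, h3]
          rfl
        · intro u hu l hl
          rcases ht l hl.1.symm with h4 | h4
          · exact absurd (hl.2.1.trans_lt hu.2) (not_lt.mpr h4)
          · exact absurd (hu.1.trans_le hl.2.2) (not_lt.mpr (hmax l ⟨hl.1.symm, h4⟩))
      · rw [← hm]
        refine Set.ncard_lt_ncard ⟨fun l hl => ⟨hl.1, hl.2.trans_le ((W j).le.trans hjt.le)⟩, ?_⟩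
          (Set.toFinite _)
        intro hsub
        exact absurd (hsub (show j ∈ {j | (W j).comp = i ∧ (W j).hi < t} from ⟨hj, hjt⟩)).2
          (not_lt.mpr (W j).le)

/-- Agreement of the colours at level `q` gives agreement of partial longitudes modulo `avoidKer q
i`, and the commutator estimate turns this into agreement of colours at level `q + 1`. -/
theorem LocallyEquivalent.color_mem_simpleKer [Finite ι] (h : LocallyEquivalent D D' W) (q : ℕ) :
    ∀ i t, Avoids W i t → (D.color q (i, t))⁻¹ * D'.color q (i, t) ∈ simpleKer n q := by
  induction q with
  | zero => intro i t _; simp [color]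
  | succ q ih =>
    intro i t ht
    exact conj_inv_mul_conj_mem_simpleKer (h.prodOn_mem_avoidKer q ih i _ t ht rfl)

theorem LocallyEquivalent.longitude_mem_avoidKer [Finite ι] (h : LocallyEquivalent D D' W) (q : ℕ)
    (i : Fin n) : (D.longitude q i)⁻¹ * D'.longitude q i ∈ avoidKer q i := by
  -- A time beyond all under-crossings and all windows, so that the partial longitude up to `t` is
  -- the whole longitude.
  obtain ⟨t, ht⟩ : ∃ t : ℝ, ∀ u ∈ (↑(D.under i) ∪ ↑(D'.under i)) ∪
      Set.range fun j => (W j).hi, u < t := by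
    obtain ⟨b, hb⟩ := (((D.under i).finite_toSet.union (D'.under i).finite_toSet).union
      (Set.finite_range fun j => (W j).hi)).bddAbove
    exact ⟨b + 1, fun u hu => (hb hu).trans_lt (lt_add_one b)⟩
  have := h.prodOn_mem_avoidKer q (h.color_mem_simpleKer q) i _ t
    (fun j _ => Or.inr (ht _ (Or.inr ⟨j, rfl⟩))) rfl
  rwa [prodOn_inter (Set.Iio t) Set.univ, prodOn_inter (Set.Iio t) Set.univ] at this
  · intro u hu; simpa using ht u (Or.inl (Or.inr hu))
  · intro u hu; simpa using ht u (Or.inl (Or.inl hu))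

end Invariance

end GaussData

/-! ### The Gauss data of a diagram -/

section Plane

theorem cross_swap (u v : ℝ × ℝ) : cross v u = -cross u v := by
  simp only [cross]; ring

theorem cross_smul (a b : ℝ) (u v : ℝ × ℝ) : cross (a • u) (b • v) = a * b * cross u v := by
  simp only [cross, Prod.smul_fst, Prod.smul_snd, smul_eq_mul]; ring

theorem det_eq_cross (L : ℝ × ℝ →L[ℝ] ℝ × ℝ) : L.det = cross (L (1, 0)) (L (0, 1)) := by
  rw [ContinuousLinearMap.det, ← LinearMap.det_toMatrix (Module.Basis.finTwoProd ℝ),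
    Matrix.det_fin_two]
  simp [LinearMap.toMatrix_apply, cross]
  ring

theorem cross_map (L : ℝ × ℝ →L[ℝ] ℝ × ℝ) (u v : ℝ × ℝ) :
    cross (L u) (L v) = L.det * cross u v := by
  have h : ∀ w : ℝ × ℝ, L w = w.1 • L (1, 0) + w.2 • L (0, 1) := fun w => by
    rw [← map_smul, ← map_smul, ← map_add]; simp
  rw [det_eq_cross, h u, h v]
  simp only [cross, Prod.fst_add, Prod.snd_add, Prod.smul_fst, Prod.smul_snd, smul_eq_mul]
  ring

end Plane

namespace Meet

variable {n : ℕ} {γ γ' : Fin n × ℝ → ℝ × ℝ} {p q : Fin n × ℝ}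

theorem symm (h : Meet γ p q) : Meet γ q p := ⟨h.2.1, h.1, h.2.2.1.symm, h.2.2.2.symm⟩

theorem congr (h : Meet γ p q) (hp : γ' p = γ p) (hq : γ' q = γ q) : Meet γ' p q :=
  ⟨h.1, h.2.1, h.2.2.1, by rw [hp, hq, h.2.2.2]⟩

end Meet

namespace Diagram

variable {n : ℕ} {x : Fin n → ℝ} (S S' : Diagram n x)

/-- The Gauss data of a diagram. -/
def gauss : GaussData n := ⟨S.underTimes, S.partner, S.sign⟩

variable {S S'}

theorem mem_underTimes {i : Fin n} {t : ℝ} :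
    t ∈ S.underTimes i ↔ (∃ q, Meet S.curve (i, t) q) ∧ S.kind (i, t) = Passage.below := by
  simp [underTimes]

theorem partner_eq {p q : Fin n × ℝ} (h : Meet S.curve p q) : S.partner p = q := by
  have h' : ∃ q, Meet S.curve p q := ⟨q, h⟩
  rw [partner, dif_pos h']
  exact S.no_triple p _ _ h'.choose_spec h

theorem sign_eq {p q : Fin n × ℝ} (h : Meet S.curve p q) :
    S.sign p = (SignType.sign (cross (velocity S.curve q) (velocity S.curve p)) : ℤ) := by
  rw [sign, partner_eq h]

/-! ### The homomorphisms `η_q` on arcs as colours of points. -/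

/-- The index of the arc through time `t` is the number of under-crossings strictly before `t`.
Hence the initial piece of that length in the sorted list consists exactly of the times below `t`.
-/
theorem sort_take_eq_timesIn (i : Fin n) (t : ℝ) :
    ((S.underTimes i).sort).take ((S.underTimes i).filter (· < t)).card =
      S.gauss.timesIn i (Set.Iio t) := by
  have h1 : S.gauss.timesIn i (Set.Iio t) ++ S.gauss.timesIn i (Set.Ici t) =
      (S.underTimes i).sort := by
    rw [← GaussData.timesIn_eq (D := S.gauss) (i := i) (I := Set.univ)
      (S.underTimes i).sortedLT_sort (by simp [gauss])]
    symm
    refine GaussData.timesIn_eq ((List.pairwise_append.mpr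
      ⟨GaussData.timesIn_sortedLT.pairwise, GaussData.timesIn_sortedLT.pairwise,
        fun a ha b hb => ?_⟩).sortedLT) fun u => ?_
    · exact lt_of_lt_of_le (GaussData.mem_timesIn.mp ha).2 (GaussData.mem_timesIn.mp hb).2
    · simp [← and_or_left, lt_or_ge]
  have h2 : ((S.underTimes i).filter (· < t)).card = (S.gauss.timesIn i (Set.Iio t)).length := by
    rw [← List.toFinset_card_of_nodup GaussData.timesIn_sortedLT.nodup]
    congr 1
    ext u
    simp [gauss]
  rw [← h1, h2, List.take_left]

theorem eta_partialLongitude (q : ℕ) (i : Fin n) (j : ℕ)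
    (h : ∀ p, S.eta q (FreeGroup.of (S.arcAt p)) = S.gauss.color q p) :
    S.eta q (S.partialLongitude i j) = ((((S.underTimes i).sort).take j).map fun t =>
      S.gauss.factor (S.gauss.color q) (i, t)).prod := by
  rw [partialLongitude, map_list_prod, List.map_map,
    ← Finset.listMap_orderEmbOfFin_finRange (S.underTimes i) rfl, ← List.map_take, List.map_map]
  refine congrArg List.prod (List.map_congr_left fun k _ => ?_)
  simp only [Function.comp_apply, map_zpow, h, GaussData.factor]
  rfl

theorem eta_of_arcAt (q : ℕ) :
    ∀ p, S.eta q (FreeGroup.of (S.arcAt p)) = S.gauss.color q p := by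
  induction q with
  | zero => intro p; rfl
  | succ q ih =>
    rintro ⟨i, t⟩
    rw [eta, FreeGroup.lift_apply_of, eta_partialLongitude q _ _ ih]
    change _⁻¹ * FreeGroup.of i * _ = _
    rw [GaussData.color_succ, GaussData.prodOn, ← sort_take_eq_timesIn]
    rfl

theorem eta_of_zero_mem (q : ℕ) (i : Fin n) (r : ℕ) :
    S.eta q (FreeGroup.of (⟨i, 0⟩ : S.Arc)) ∈ avoidKer r i := by
  cases q with
  | zero => exact one_mem _
  | succ q =>
    rw [eta, FreeGroup.lift_apply_of]
    have := (magnusKer_normal _ (factorClosed_simpleWordsAvoiding r i)).conj_mem _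
      (of_mem_avoidKer r i) (S.eta q (S.partialLongitude i (0 : Fin (S.numUnder i + 1))))⁻¹
    rwa [inv_inv] at this

/-- The preferred and the unframed longitude differ by a power of the image of `a_{i,1}`, which is
trivial or a conjugate of `α_i` and so lies in `avoidKer r i` for every `r`. The framing therefore
plays no role in the comparison. -/
theorem eta_longitude (q : ℕ) (i : Fin n) (r : ℕ) :
    (S.eta q (S.longitude i))⁻¹ * S.gauss.longitude q i ∈ avoidKer r i := by
  have h1 : S.eta q (S.partialLongitude i (S.numUnder i)) = S.gauss.longitude q i := by
    rw [eta_partialLongitude q i _ (eta_of_arcAt q), GaussData.longitude,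
      GaussData.prodOn_eq (S.underTimes i).sortedLT_sort (by simp [gauss]),
      List.take_of_length_le (by simp)]
  rw [Diagram.longitude, map_mul, h1, map_zpow]
  have h2 := zpow_mem (eta_of_zero_mem (S := S) q i r) (-S.selfWrithe i)
  have := (magnusKer_normal _ (factorClosed_simpleWordsAvoiding r i)).conj_mem _
    (inv_mem h2) (S.gauss.longitude q i)⁻¹
  convert this using 1
  group

/-- The unframed longitudes of two diagrams agree on non-repeated words. -/
def SameLongitudes (S S' : Diagram n x) : Prop :=
  ∀ q i, (S.gauss.longitude q i)⁻¹ * S'.gauss.longitude q i ∈ avoidKer q i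

theorem SameLongitudes.refl (S : Diagram n x) : SameLongitudes S S := fun q i => by simp

theorem SameLongitudes.symm (h : SameLongitudes S S') : SameLongitudes S' S := fun q i => by
  have := inv_mem (h q i)
  rwa [mul_inv_rev, inv_inv] at this

theorem SameLongitudes.trans {S'' : Diagram n x} (h : SameLongitudes S S')
    (h' : SameLongitudes S' S'') : SameLongitudes S S'' := fun q i => by
  have := mul_mem (h q i) (h' q i)
  rwa [mul_assoc, mul_inv_cancel_left] at this

theorem SameLongitudes.of_eqvGen {R : Diagram n x → Diagram n x → Prop}
    (hR : ∀ S S', R S S' → SameLongitudes S S') (h : Relation.EqvGen R S S') :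
    SameLongitudes S S' := by
  induction h with
  | rel _ _ h => exact hR _ _ h
  | refl _ => exact SameLongitudes.refl _
  | symm _ _ _ ih => exact ih.symm
  | trans _ _ _ _ _ ih ih' => exact ih.trans ih'

theorem SameLongitudes.milnor_eq_of_le (h : SameLongitudes S S') {q q' : ℕ} (hqq' : q ≤ q')
    {J : List (Fin n)} {i : Fin n} (hI : (J ++ [i]).Nodup) (hq : J.length < q) :
    S.milnor q J i = S'.milnor q' J i := by
  refine coeff_magnus_eq_of_mem_avoidKer (q := q) (i := i) ?_
    ⟨⟨(List.nodup_append.mp hI).1, hq.le⟩,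
      fun hi => List.disjoint_of_nodup_append hI hi (by simp)⟩
  -- The chain of congruences: drop the framing of `S`, pass to `S'` at level `q`, raise the level
  -- to `q'`, restore the framing of `S'`.
  have h1 := eta_longitude (S := S) q i q
  have h2 := eta_longitude (S := S') q' i q
  have h3 := GaussData.longitude_stable (D := S'.gauss) hqq' i
  have := mul_mem (mul_mem (mul_mem h1 (h q i)) h3) (inv_mem h2)
  convert this using 1
  group

theorem SameLongitudes.milnor_eq (h : SameLongitudes S S') {q q' : ℕ}
    {J : List (Fin n)} {i : Fin n} (hI : (J ++ [i]).Nodup) (hq : J.length < q)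
    (hq' : J.length < q') : S.milnor q J i = S'.milnor q' J i := by
  rcases le_total q q' with h' | h'
  · exact h.milnor_eq_of_le h' hI hq
  · exact (h.symm.milnor_eq_of_le h' hI hq').symm

/-! ### Double points of a diagram -/

/-- Distinct endpoints lie at distinct boundary points, and interior times map to the open square.
Thus double points occur at interior times, where velocities are determined by the curve on `[0,1]`.
-/
theorem time_mem_Ioo (hx : Function.Injective x) {p q : Fin n × ℝ} (h : Meet S.curve p q) :
    p.2 ∈ Set.Ioo (0 : ℝ) 1 := by
  have hsnd : ∀ r : Fin n × ℝ, r.2 ∈ Set.Icc (0 : ℝ) 1 →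
      (S.curve r).2 = 0 ∧ r.2 = 0 ∨ (S.curve r).2 = 1 ∧ r.2 = 1 ∨
        (S.curve r).2 ∈ Set.Ioo (0 : ℝ) 1 := by
    rintro ⟨i, t⟩ ht
    rcases ht.1.eq_or_lt with h0 | h0
    · subst h0; exact Or.inl ⟨by rw [S.source], rfl⟩
    · rcases ht.2.eq_or_lt with h1 | h1
      · change t = 1 at h1
        subst h1; exact Or.inr (Or.inl ⟨by rw [S.target], rfl⟩)
      · exact Or.inr (Or.inr (S.proper i t ⟨h0, h1⟩).2)
  obtain ⟨hp, hq, hne, heq⟩ := h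
  obtain ⟨i, t⟩ := p
  obtain ⟨j, u⟩ := q
  have hpq := congrArg Prod.snd heq
  have hends : ∀ a : ℝ, a = 0 ∨ a = 1 → t = a → u = a → False := by
    rintro a ha rfl rfl
    apply hne
    have : x i = x j := by
      rcases ha with rfl | rfl
      · simpa [S.source] using congrArg Prod.fst heq
      · simpa [S.target] using congrArg Prod.fst heq
    rw [hx this]
  rcases hsnd _ hp with ⟨h1, h2⟩ | ⟨h1, h2⟩ | h1
  · rcases hsnd _ hq with ⟨h3, h4⟩ | ⟨h3, h4⟩ | h3
    · exact (hends 0 (Or.inl rfl) h2 h4).elim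
    · rw [h1, h3] at hpq; norm_num at hpq
    · rw [← hpq, h1] at h3; exact absurd h3.1 (lt_irrefl _)
  · rcases hsnd _ hq with ⟨h3, h4⟩ | ⟨h3, h4⟩ | h3
    · rw [h1, h3] at hpq; norm_num at hpq
    · exact (hends 1 (Or.inr rfl) h2 h4).elim
    · rw [← hpq, h1] at h3; exact absurd h3.2 (lt_irrefl _)
  · have ht0 : t ≠ 0 := by
      rintro rfl
      rw [S.source] at h1
      exact absurd h1.1 (lt_irrefl _)
    have ht1 : t ≠ 1 := by
      rintro rfl
      rw [S.target] at h1
      exact absurd h1.2 (lt_irrefl _)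
    exact ⟨lt_of_le_of_ne hp.1 ht0.symm, lt_of_le_of_ne hp.2 ht1⟩

end Diagram

namespace GaussData

variable {n : ℕ} {D D' : GaussData n}

/-- If all under-crossings in the windows are self-crossings of the components, then the
longitudes do not depend on them. -/
theorem inside_of_self {ι : Type} {W : ι → Window n}
    (h : ∀ j, ∀ t ∈ Set.Icc (W j).lo (W j).hi, t ∈ D.under (W j).comp →
      (D.upper ((W j).comp, t)).1 = (W j).comp)
    (h' : ∀ j, ∀ t ∈ Set.Icc (W j).lo (W j).hi, t ∈ D'.under (W j).comp →
      (D'.upper ((W j).comp, t)).1 = (W j).comp)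
    (G : Type) [Group G] (N : Fin n → Subgroup G) (c c' : Fin n × ℝ → G)
    (hc : ∀ p, c p ∈ N p.1) (hc' : ∀ p, c' p ∈ N p.1) (j : ι) :
    (D.prodOn c (W j).comp (Set.Icc (W j).lo (W j).hi))⁻¹ *
      D'.prodOn c' (W j).comp (Set.Icc (W j).lo (W j).hi) ∈ N (W j).comp := by
  refine mul_mem (inv_mem (prodOn_mem _ fun t ht htu => zpow_mem ?_ _))
    (prodOn_mem _ fun t ht htu => zpow_mem ?_ _)
  · have := hc (D.upper ((W j).comp, t)); rwa [h j t ht htu] at this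
  · have := hc' (D'.upper ((W j).comp, t)); rwa [h' j t ht htu] at this

/-! ### Transport of Gauss data along an increasing change of time. -/

theorem prodOn_map {ρ : Fin n → ℝ → ℝ} (hρ : ∀ i, StrictMonoOn (ρ i) (Set.Icc 0 1))
    (hsub : ∀ i, ∀ t ∈ D'.under i, t ∈ Set.Icc (0 : ℝ) 1)
    (hu : ∀ i s, s ∈ D.under i ↔ ∃ t ∈ D'.under i, ρ i t = s)
    {G : Type*} [Group G] {c c' : Fin n × ℝ → G} {i : Fin n}
    (hf : ∀ t ∈ D'.under i, D.factor c (i, ρ i t) = D'.factor c' (i, t)) {I I' : Set ℝ}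
    (hI : ∀ t ∈ D'.under i, ρ i t ∈ I ↔ t ∈ I') :
    D.prodOn c i I = D'.prodOn c' i I' := by
  rw [prodOn_eq (l := (D'.timesIn i I').map (ρ i)), List.map_map, prodOn]
  · exact congrArg List.prod (List.map_congr_left fun t ht => hf t (mem_timesIn.mp ht).1)
  · refine (List.pairwise_map.mpr ?_).sortedLT
    refine timesIn_sortedLT.pairwise.imp_of_mem fun {a b} ha hb hab => ?_
    exact hρ i (hsub i a (mem_timesIn.mp ha).1) (hsub i b (mem_timesIn.mp hb).1) hab
  · intro s
    rw [List.mem_map, hu]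
    constructor
    · rintro ⟨t, ht, rfl⟩
      rw [mem_timesIn] at ht
      exact ⟨⟨t, ht.1, rfl⟩, (hI t ht.1).mpr ht.2⟩
    · rintro ⟨⟨t, ht, rfl⟩, hs⟩
      exact ⟨t, mem_timesIn.mpr ⟨ht, (hI t ht).mp hs⟩, rfl⟩

theorem color_map {ρ : Fin n → ℝ → ℝ} (hρ : ∀ i, StrictMonoOn (ρ i) (Set.Icc 0 1))
    (hsub : ∀ i, ∀ t ∈ D'.under i, t ∈ Set.Icc (0 : ℝ) 1)
    (hu : ∀ i s, s ∈ D.under i ↔ ∃ t ∈ D'.under i, ρ i t = s)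
    (hup : ∀ i, ∀ t ∈ D'.under i, (D'.upper (i, t)).2 ∈ Set.Icc (0 : ℝ) 1 ∧
      D.upper (i, ρ i t) = ((D'.upper (i, t)).1, ρ (D'.upper (i, t)).1 (D'.upper (i, t)).2) ∧
      D.sgn (i, ρ i t) = D'.sgn (i, t)) (q : ℕ) :
    ∀ i, ∀ t ∈ Set.Icc (0 : ℝ) 1, D.color q (i, ρ i t) = D'.color q (i, t) := by
  induction q with
  | zero => intro i t _; rfl
  | succ q ih =>
    intro i t ht
    have : D.prodOn (D.color q) i (Set.Iio (ρ i t)) = D'.prodOn (D'.color q) i (Set.Iio t) := by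
      refine prodOn_map hρ hsub hu (fun s hs => ?_) fun s hs =>
        (hρ i).lt_iff_lt (hsub i s hs) ht
      obtain ⟨h1, h2, h3⟩ := hup i s hs
      rw [factor, factor, h2, h3, ih _ _ h1]
    rw [color_succ, color_succ, this]

theorem longitude_map {ρ : Fin n → ℝ → ℝ} (hρ : ∀ i, StrictMonoOn (ρ i) (Set.Icc 0 1))
    (hsub : ∀ i, ∀ t ∈ D'.under i, t ∈ Set.Icc (0 : ℝ) 1)
    (hu : ∀ i s, s ∈ D.under i ↔ ∃ t ∈ D'.under i, ρ i t = s)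
    (hup : ∀ i, ∀ t ∈ D'.under i, (D'.upper (i, t)).2 ∈ Set.Icc (0 : ℝ) 1 ∧
      D.upper (i, ρ i t) = ((D'.upper (i, t)).1, ρ (D'.upper (i, t)).1 (D'.upper (i, t)).2) ∧
      D.sgn (i, ρ i t) = D'.sgn (i, t)) (q : ℕ) (i : Fin n) :
    D.longitude q i = D'.longitude q i := by
  refine prodOn_map hρ hsub hu (fun s hs => ?_) fun s hs => by simp
  obtain ⟨h1, h2, h3⟩ := hup i s hs
  rw [factor, factor, h2, h3, color_map hρ hsub hu hup q _ _ h1]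

end GaussData

namespace Diagram

variable {n : ℕ} {x : Fin n → ℝ} {S S' : Diagram n x}

/-! ### Diagrams that agree off a set of windows. -/

theorem hasDerivAt_curve (S : Diagram n x) (p : Fin n × ℝ) :
    HasDerivAt (fun t => S.curve (p.1, t)) (velocity S.curve p) p.2 :=
  ((S.smooth p.1).differentiable (by simp)).differentiableAt.hasDerivAt

theorem velocity_congr {γ γ' : Fin n × ℝ → ℝ × ℝ} {p : Fin n × ℝ}
    (h : ∀ᶠ t in 𝓝 p.2, γ' (p.1, t) = γ (p.1, t)) : velocity γ' p = velocity γ p :=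
  Filter.EventuallyEq.deriv_eq h

theorem eventually_mem_Icc {p : Fin n × ℝ} (hp : p.2 ∈ Set.Ioo (0 : ℝ) 1) :
    ∀ᶠ t in 𝓝 p.2, t ∈ Set.Icc (0 : ℝ) 1 :=
  mem_of_superset (Ioo_mem_nhds hp.1 hp.2) Set.Ioo_subset_Icc_self

theorem velocity_eq_of_eqOn {γ γ' : Fin n × ℝ → ℝ × ℝ} {p : Fin n × ℝ}
    (hp : p.2 ∈ Set.Ioo (0 : ℝ) 1)
    (h : ∀ t ∈ Set.Icc (0 : ℝ) 1, γ' (p.1, t) = γ (p.1, t)) : velocity γ' p = velocity γ p :=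
  velocity_congr ((eventually_mem_Icc hp).mono h)

/-- The two diagrams have the same double points outside of `A`, with the same marks and with
crossings of the same orientation. -/
structure AgreeOff (S S' : Diagram n x) (A : Set (Fin n × ℝ)) : Prop where
  notMem : ∀ p q, p ∉ A → Meet S.curve p q → q ∉ A
  meet_iff : ∀ p q, p ∉ A → (Meet S.curve p q ↔ Meet S'.curve p q)
  kind_eq : ∀ p q, p ∉ A → Meet S.curve p q → S'.kind p = S.kind p
  sign_eq : ∀ p q, p ∉ A → Meet S.curve p q →
    SignType.sign (cross (velocity S'.curve q) (velocity S'.curve p)) =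
      SignType.sign (cross (velocity S.curve q) (velocity S.curve p))

theorem AgreeOff.locallyEquivalent {ι : Type} {W : ι → Window n}
    (h : AgreeOff S S' (⋃ j, (W j).points))
    (hW : ∀ j l, j ≠ l → Disjoint (W j).points (W l).points)
    (hin : ∀ (G : Type) [Group G] (N : Fin n → Subgroup G) [∀ i, (N i).Normal]
      (c c' : Fin n × ℝ → G), (∀ p, c p ∈ N p.1) → (∀ p, c' p ∈ N p.1) →
      (∀ j, S.gauss.ColoringOn c (W j)) → (∀ j, S'.gauss.ColoringOn c' (W j)) →
      (∀ j, c ((W j).comp, (W j).lo) = c' ((W j).comp, (W j).lo)) → ∀ j,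
      (S.gauss.prodOn c (W j).comp (Set.Icc (W j).lo (W j).hi))⁻¹ *
        S'.gauss.prodOn c' (W j).comp (Set.Icc (W j).lo (W j).hi) ∈ N (W j).comp) :
    S.gauss.LocallyEquivalent S'.gauss W where
  disjoint := hW
  inside := hin
  under_iff i t ht := by
    have ht' : (i, t) ∉ ⋃ j, (W j).points := by simpa using ht
    change t ∈ S.underTimes i ↔ t ∈ S'.underTimes i
    rw [mem_underTimes, mem_underTimes]
    constructor
    · rintro ⟨⟨q, hq⟩, hk⟩
      exact ⟨⟨q, (h.meet_iff _ _ ht').mp hq⟩, by rw [h.kind_eq _ q ht' hq, hk]⟩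
    · rintro ⟨⟨q, hq⟩, hk⟩
      have hq' := (h.meet_iff _ _ ht').mpr hq
      exact ⟨⟨q, hq'⟩, by rw [← h.kind_eq _ q ht' hq', hk]⟩
  outside i t ht hu := by
    have ht' : (i, t) ∉ ⋃ j, (W j).points := by simpa using ht
    obtain ⟨⟨q, hq⟩, -⟩ := mem_underTimes.mp hu
    have hq' := (h.meet_iff _ _ ht').mp hq
    change S.partner _ = S'.partner _ ∧ S.sign _ = S'.sign _ ∧ ∀ j, S.partner _ ∉ _
    rw [partner_eq hq, partner_eq hq', Diagram.sign_eq hq, Diagram.sign_eq hq',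
      h.sign_eq _ _ ht' hq]
    exact ⟨rfl, rfl, by simpa using h.notMem _ _ ht' hq⟩

theorem upper_fst_of_forall_meet {W : Window n}
    (h : ∀ p q, p ∈ W.points → Meet S.curve p q → q.1 = W.comp) :
    ∀ t ∈ Set.Icc W.lo W.hi, t ∈ S.gauss.under W.comp →
      (S.gauss.upper (W.comp, t)).1 = W.comp := by
  intro t ht hu
  obtain ⟨⟨q, hq⟩, -⟩ := mem_underTimes.mp hu
  change (S.partner _).1 = _
  rw [partner_eq hq]
  exact h _ q ⟨rfl, ht⟩ hq

theorem AgreeOff.sameLongitudes_of_self {ι : Type} [Finite ι] {W : ι → Window n}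
    (h : AgreeOff S S' (⋃ j, (W j).points))
    (hW : ∀ j l, j ≠ l → Disjoint (W j).points (W l).points)
    (hS : ∀ j p q, p ∈ (W j).points → Meet S.curve p q → q.1 = (W j).comp)
    (hS' : ∀ j p q, p ∈ (W j).points → Meet S'.curve p q → q.1 = (W j).comp) :
    SameLongitudes S S' := by
  have := h.locallyEquivalent hW fun G _ N _ c c' hc hc' _ _ _ =>
    GaussData.inside_of_self (fun j => upper_fst_of_forall_meet (hS j))
      (fun j => upper_fst_of_forall_meet (hS' j)) G N c c' hc hc'
  exact this.longitude_mem_avoidKer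

/-! ### Reparametrization, planar isotopy and self-crossing virtualization -/

theorem curve_mem_square (hx : ∀ i, x i ∈ Set.Ioo (0 : ℝ) 1) (p : Fin n × ℝ)
    (hp : p.2 ∈ Set.Icc (0 : ℝ) 1) :
    S.curve p ∈ Set.Icc (0 : ℝ) 1 ×ˢ Set.Icc (0 : ℝ) 1 := by
  obtain ⟨i, t⟩ := p
  have h1 := Set.Ioo_subset_Icc_self (hx i)
  rcases hp.1.eq_or_lt with h | h
  · change 0 = t at h
    subst h
    rw [S.source]
    exact ⟨h1, by simp⟩
  rcases hp.2.eq_or_lt with h' | h'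
  · change t = 1 at h'
    subst h'
    rw [S.target]
    exact ⟨h1, by simp⟩
  have := S.proper i t ⟨h, h'⟩
  exact ⟨Set.Ioo_subset_Icc_self this.1, Set.Ioo_subset_Icc_self this.2⟩

theorem sameLongitudes_of_planarIsotopy (hinj : Function.Injective x)
    (hx : ∀ i, x i ∈ Set.Ioo (0 : ℝ) 1) (h : PlanarIsotopy S S') : SameLongitudes S S' := by
  obtain ⟨Φ, -, hbij, -, hsmooth, hdet, hcurve, hkind⟩ := h
  have hc : ∀ p : Fin n × ℝ, p.2 ∈ Set.Icc (0 : ℝ) 1 → S'.curve p = Φ (S.curve p) :=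
    fun p hp => hcurve p.1 p.2 hp
  have hvel : ∀ p : Fin n × ℝ, p.2 ∈ Set.Ioo (0 : ℝ) 1 →
      velocity S'.curve p = fderiv ℝ Φ (S.curve p) (velocity S.curve p) := by
    intro p hp
    have hopen : IsOpen (Set.Ioo (0 : ℝ) 1 ×ˢ Set.Ioo (0 : ℝ) 1) := isOpen_Ioo.prod isOpen_Ioo
    have hd : DifferentiableAt ℝ Φ (S.curve p) :=
      (hsmooth.differentiableOn (by simp)).differentiableAt
        (hopen.mem_nhds (S.proper p.1 p.2 hp))
    have h1 : HasDerivAt (fun t => Φ (S.curve (p.1, t))) _ p.2 :=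
      hd.hasFDerivAt.comp_hasDerivAt p.2 (S.hasDerivAt_curve p)
    rw [← h1.deriv]
    exact Filter.EventuallyEq.deriv_eq
      ((eventually_mem_Icc hp).mono fun t ht => hc (p.1, t) ht)
  have hmeet : ∀ p q, Meet S.curve p q ↔ Meet S'.curve p q := by
    intro p q
    refine ⟨fun h => ⟨h.1, h.2.1, h.2.2.1, by rw [hc p h.1, hc q h.2.1, h.2.2.2]⟩,
      fun h => ⟨h.1, h.2.1, h.2.2.1, ?_⟩⟩
    have := h.2.2.2
    rw [hc p h.1, hc q h.2.1] at this
    exact hbij.injOn (curve_mem_square hx p h.1) (curve_mem_square hx q h.2.1) this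
  -- No window is needed: the double points and marks are the same, and crossing signs are preserved
  -- because the Jacobian determinant is positive.
  refine AgreeOff.sameLongitudes_of_self (ι := Empty) (W := Empty.elim) ⟨?_, ?_, ?_, ?_⟩
    (fun j => j.elim) (fun j => j.elim) (fun j => j.elim)
  · simp
  · exact fun p q _ => hmeet p q
  · exact fun p q _ h => hkind p ⟨q, h⟩
  · intro p q _ h
    have hp := time_mem_Ioo hinj h
    rw [hvel p hp, hvel q (time_mem_Ioo hinj h.symm), h.2.2.2, cross_map, sign_mul,
      sign_pos, one_mul]
    rw [← h.2.2.2]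
    exact hdet _ (S.proper p.1 p.2 hp)

theorem sameLongitudes_of_selfVirtualization (hinj : Function.Injective x)
    (h : SelfVirtualization S S') : SameLongitudes S S' := by
  obtain ⟨hcurve, p, q, hpq, hcomp, -, -, hkind⟩ := h
  have hmeet : ∀ r s, Meet S.curve r s ↔ Meet S'.curve r s := fun r s =>
    ⟨fun h => h.congr (hcurve r h.1) (hcurve s h.2.1),
      fun h => h.congr (hcurve r h.1).symm (hcurve s h.2.1).symm⟩
  have hvel : ∀ r s, Meet S.curve r s → velocity S'.curve r = velocity S.curve r := fun r s h =>
    velocity_eq_of_eqOn (time_mem_Ioo hinj h) fun t ht => hcurve (r.1, t) ht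
  -- Two windows of length zero, one at each preimage of the virtualized crossing.
  let W : Bool → Window n := fun b => ⟨p.1, (if b then p else q).2, (if b then p else q).2, le_rfl⟩
  have hW : ∀ b, (W b).points = {if b then p else q} := by
    intro b
    ext r
    simp only [Window.points, W, Set.Icc_self, Set.mem_ofPred_eq, Set.mem_singleton_iff]
    cases b
    · simp [Prod.ext_iff, hcomp]
    · simp [Prod.ext_iff]
  have hU : ∀ r, r ∉ ⋃ b, (W b).points ↔ r ≠ q ∧ r ≠ p := by
    intro r
    simp [hW]
  have hself : ∀ b r s, r ∈ (W b).points → Meet S.curve r s → s.1 = (W b).comp := by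
    intro b r s hr hrs
    rw [hW] at hr
    change s.1 = p.1
    cases b
    · change r = q at hr
      rw [S.no_triple r s p hrs (hr ▸ hpq.symm)]
    · change r = p at hr
      rw [S.no_triple r s q hrs (hr ▸ hpq), hcomp]
  refine AgreeOff.sameLongitudes_of_self (W := W) ⟨?_, ?_, ?_, ?_⟩ ?_ hself
    fun b r s hr hrs => hself b r s hr ((hmeet r s).mpr hrs)
  · intro r s hr hrs
    rw [hU] at hr ⊢
    constructor
    · rintro rfl
      exact hr.2 (S.no_triple s r p hrs.symm hpq.symm)
    · rintro rfl
      exact hr.1 (S.no_triple s r q hrs.symm hpq)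
  · exact fun r s _ => hmeet r s
  · intro r s hr hrs
    rw [hU] at hr
    exact hkind r ⟨s, hrs⟩ hr.2 hr.1
  · intro r s _ hrs
    rw [hvel r s hrs, hvel s r hrs.symm]
  · have : p ≠ q := hpq.2.2.1
    intro a b hab
    rw [hW, hW, Set.disjoint_singleton]
    cases a <;> cases b <;> simp_all [this.symm]

theorem sameLongitudes_of_reparametrization (hinj : Function.Injective x)
    (h : Reparametrization S S') : SameLongitudes S S' := by
  obtain ⟨ρ, hρ, hcurve, hkind⟩ := h
  have hmono : ∀ i, StrictMonoOn (ρ i) (Set.Icc 0 1) := fun i =>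
    strictMonoOn_of_deriv_pos (convex_Icc 0 1) (hρ i).1.continuous.continuousOn fun t ht =>
      (hρ i).2.2.2 t (interior_subset ht)
  have hmaps : ∀ i, ∀ t ∈ Set.Icc (0 : ℝ) 1, ρ i t ∈ Set.Icc (0 : ℝ) 1 := by
    intro i t ht
    have h0 := (hmono i).monotoneOn (Set.left_mem_Icc.mpr zero_le_one) ht ht.1
    have h1 := (hmono i).monotoneOn ht (Set.right_mem_Icc.mpr zero_le_one) ht.2
    rw [(hρ i).2.1] at h0
    rw [(hρ i).2.2.1] at h1
    exact ⟨h0, h1⟩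
  have hsurj : ∀ i, ∀ s ∈ Set.Icc (0 : ℝ) 1, ∃ t ∈ Set.Icc (0 : ℝ) 1, ρ i t = s := by
    intro i s hs
    have := intermediate_value_Icc zero_le_one ((hρ i).1.continuous.continuousOn (s := Set.Icc 0 1))
    rw [(hρ i).2.1, (hρ i).2.2.1] at this
    exact this hs
  let f : Fin n × ℝ → Fin n × ℝ := fun p => (p.1, ρ p.1 p.2)
  have hc : ∀ p : Fin n × ℝ, p.2 ∈ Set.Icc (0 : ℝ) 1 → S'.curve p = S.curve (f p) :=
    fun p hp => hcurve p.1 p.2 hp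
  have hmeet : ∀ p q : Fin n × ℝ, p.2 ∈ Set.Icc (0 : ℝ) 1 → q.2 ∈ Set.Icc (0 : ℝ) 1 →
      (Meet S'.curve p q ↔ Meet S.curve (f p) (f q)) := by
    intro p q hp hq
    have hne : p ≠ q ↔ f p ≠ f q := by
      rw [not_iff_not]
      refine ⟨fun h => by rw [h], fun h => ?_⟩
      obtain ⟨h1, h2⟩ := Prod.ext_iff.mp h
      obtain ⟨i, t⟩ := p
      obtain ⟨j, u⟩ := q
      change i = j at h1
      subst h1
      have : t = u := (hmono i).injOn hp hq h2
      rw [this]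
    exact ⟨fun h => ⟨hmaps _ _ hp, hmaps _ _ hq, hne.mp h.2.2.1, by
        rw [← hc p hp, ← hc q hq, h.2.2.2]⟩,
      fun h => ⟨hp, hq, hne.mpr h.2.2.1, by rw [hc p hp, hc q hq, h.2.2.2]⟩⟩
  have hvel : ∀ p : Fin n × ℝ, p.2 ∈ Set.Ioo (0 : ℝ) 1 →
      velocity S'.curve p = deriv (ρ p.1) p.2 • velocity S.curve (f p) := by
    intro p hp
    have h1 : HasDerivAt (fun t => S.curve (p.1, ρ p.1 t)) _ p.2 :=
      HasDerivAt.scomp (h := ρ p.1) p.2 (S.hasDerivAt_curve (f p))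
        ((hρ p.1).1.differentiable (by simp)).differentiableAt.hasDerivAt
    rw [← h1.deriv]
    exact Filter.EventuallyEq.deriv_eq ((eventually_mem_Icc hp).mono fun t ht => hc (p.1, t) ht)
  have hsub : ∀ i, ∀ t ∈ S'.gauss.under i, t ∈ Set.Icc (0 : ℝ) 1 := by
    intro i t ht
    obtain ⟨⟨q, hq⟩, -⟩ := mem_underTimes.mp ht
    exact hq.1
  have hu : ∀ i s, s ∈ S.gauss.under i ↔ ∃ t ∈ S'.gauss.under i, ρ i t = s := by
    intro i s
    change s ∈ S.underTimes i ↔ ∃ t ∈ S'.underTimes i, ρ i t = s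
    simp only [mem_underTimes]
    constructor
    · rintro ⟨⟨⟨j, u⟩, hq⟩, hk⟩
      obtain ⟨t, ht, rfl⟩ := hsurj i s hq.1
      obtain ⟨v, hv, rfl⟩ := hsurj j u hq.2.1
      have := (hmeet (i, t) (j, v) ht hv).mpr hq
      exact ⟨t, ⟨⟨_, this⟩, by rw [hkind i t ⟨_, this⟩, hk]⟩, rfl⟩
    · rintro ⟨t, ⟨⟨q, hq⟩, hk⟩, rfl⟩
      exact ⟨⟨f q, (hmeet _ _ hq.1 hq.2.1).mp hq⟩, by rw [← hkind i t ⟨q, hq⟩, hk]⟩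
  intro q i
  -- The Gauss data correspond under `ρ`, the signs because both velocities are multiplied by
  -- positive factors. The longitudes are then equal, not merely congruent.
  rw [GaussData.longitude_map hmono hsub hu, inv_mul_cancel]
  · exact one_mem _
  · intro i t ht
    obtain ⟨⟨q, hq⟩, hk⟩ := mem_underTimes.mp ht
    have hq' := (hmeet _ _ hq.1 hq.2.1).mp hq
    change (S'.partner (i, t)).2 ∈ _ ∧ S.partner (f (i, t)) = f (S'.partner (i, t)) ∧
      S.sign (f (i, t)) = S'.sign (i, t)
    have h1 := time_mem_Ioo hinj hq
    have h2 := time_mem_Ioo hinj hq.symm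
    rw [partner_eq hq, partner_eq hq', Diagram.sign_eq hq, Diagram.sign_eq hq', hvel _ h1,
      hvel _ h2, cross_smul, sign_mul,
      sign_pos (mul_pos ((hρ _).2.2.2 _ hq.2.1) ((hρ _).2.2.2 _ hq.1)), one_mul]
    exact ⟨hq.2.1, rfl, rfl⟩

end Diagram

/-! ### Tangles -/

/-- A strand as a window. -/
def Strand.window {n : ℕ} (s : Strand n) : Window n := ⟨s.comp, s.lo, s.hi, s.lt.le⟩

namespace Tangle

variable {n : ℕ} {x : Fin n → ℝ} {S S' : Diagram n x} {δ : Disk} {k : ℕ} {s : Fin k → Strand n}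
  {τ τ' : Fin k → ℝ → ℝ × ℝ}

theorem mem_Icc {j : Fin k} {t : ℝ} (ht : t ∈ Set.Icc (s j).lo (s j).hi) :
    t ∈ Set.Icc (0 : ℝ) 1 :=
  ⟨(s j).pos.le.trans ht.1, ht.2.trans (s j).lt_one.le⟩

theorem mem_Ioo {j : Fin k} {t : ℝ} (ht : t ∈ Set.Icc (s j).lo (s j).hi) :
    t ∈ Set.Ioo (0 : ℝ) 1 :=
  ⟨(s j).pos.trans_le ht.1, ht.2.trans_lt (s j).lt_one⟩

/-- The chart describes the curve only on the closed interval of the strand, so at its ends the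
derivatives are compared from one side; uniqueness of derivatives within an interval suffices. -/
theorem velocity_eq (T : Tangle S δ s τ) {j : Fin k} {t : ℝ}
    (ht : t ∈ Set.Icc (s j).lo (s j).hi) :
    velocity S.curve ((s j).comp, t) = fderiv ℝ δ.chart (τ j t) (deriv (τ j) t) := by
  have h1 : HasDerivAt (fun u => δ.chart (τ j u)) (fderiv ℝ δ.chart (τ j t) (deriv (τ j) t)) t :=
    ((δ.smooth.differentiable (by simp)) (τ j t)).hasFDerivAt.comp_hasDerivAt t
      ((T.smooth j).differentiable (by simp)).differentiableAt.hasDerivAt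
  have h2 := (S.hasDerivAt_curve ((s j).comp, t)).hasDerivWithinAt (s := Set.Icc (s j).lo (s j).hi)
  refine (uniqueDiffOn_Icc (s j).lt t ht).eq_deriv _ (h2.congr (fun u hu => ?_) ?_)
    h1.hasDerivWithinAt
  · exact (T.chart_eq j u hu).symm
  · exact (T.chart_eq j t ht).symm

theorem deriv_ne_zero (T : Tangle S δ s τ) {j : Fin k} {t : ℝ}
    (ht : t ∈ Set.Icc (s j).lo (s j).hi) : deriv (τ j) t ≠ 0 := by
  intro h
  have := T.velocity_eq ht
  rw [h, map_zero] at this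
  exact S.immersed _ t (mem_Icc ht) this

/-- The disk contains no other part of the diagram, so the partner of a point on a strand lies on a
strand as well, and injectivity of the chart moves the coincidence to the model. -/
theorem exists_of_meet (T : Tangle S δ s τ) {j : Fin k} {t : ℝ}
    (ht : t ∈ Set.Icc (s j).lo (s j).hi) {q : Fin n × ℝ} (h : Meet S.curve ((s j).comp, t) q) :
    ∃ l, q.1 = (s l).comp ∧ q.2 ∈ Set.Icc (s l).lo (s l).hi ∧ τ j t = τ l q.2 := by
  have h1 : S.curve q ∈ δ.chart '' Model := by
    rw [← h.2.2.2]
    exact (T.mem_iff _ h.1).mpr ⟨j, rfl, ht⟩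
  obtain ⟨l, hl, hq⟩ := (T.mem_iff q h.2.1).mp h1
  refine ⟨l, hl, hq, δ.injOn (T.mem_model j t ht) (T.mem_model l _ hq) ?_⟩
  rw [← T.chart_eq j t ht, ← T.chart_eq l _ hq, h.2.2.2]
  obtain ⟨i, u⟩ := q
  change i = _ at hl
  rw [hl]

theorem pair_ne (T : Tangle S δ s τ) {j l : Fin k} {t u : ℝ}
    (ht : t ∈ Set.Icc (s j).lo (s j).hi) (hu : u ∈ Set.Icc (s l).lo (s l).hi)
    (h : j ≠ l ∨ t ≠ u) : ((s j).comp, t) ≠ ((s l).comp, u) := by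
  intro he
  by_cases hjl : j = l
  · exact (h.resolve_left (not_not.mpr hjl)) (Prod.ext_iff.mp he).2
  · refine Set.disjoint_left.mp (T.disjoint j l hjl)
      (show ((s j).comp, t) ∈ (s j).points from ⟨rfl, ht⟩) ?_
    rw [he]
    exact ⟨rfl, hu⟩

theorem meet_of_eq (T : Tangle S δ s τ) {j l : Fin k} {t u : ℝ}
    (ht : t ∈ Set.Icc (s j).lo (s j).hi) (hu : u ∈ Set.Icc (s l).lo (s l).hi)
    (h : j ≠ l ∨ t ≠ u) (heq : τ j t = τ l u) :
    Meet S.curve ((s j).comp, t) ((s l).comp, u) :=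
  ⟨mem_Icc ht, mem_Icc hu, T.pair_ne ht hu h, by rw [T.chart_eq j t ht, T.chart_eq l u hu, heq]⟩

theorem cross_velocity (T : Tangle S δ s τ) {j l : Fin k} {t u : ℝ}
    (ht : t ∈ Set.Icc (s j).lo (s j).hi) (hu : u ∈ Set.Icc (s l).lo (s l).hi)
    (heq : τ j t = τ l u) :
    cross (velocity S.curve ((s j).comp, t)) (velocity S.curve ((s l).comp, u)) =
      (fderiv ℝ δ.chart (τ j t)).det * cross (deriv (τ j) t) (deriv (τ l) u) := by
  rw [T.velocity_eq ht, T.velocity_eq hu, ← heq, cross_map]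

theorem cross_deriv_ne_zero (T : Tangle S δ s τ) {j l : Fin k} {t u : ℝ}
    (ht : t ∈ Set.Icc (s j).lo (s j).hi) (hu : u ∈ Set.Icc (s l).lo (s l).hi)
    (h : j ≠ l ∨ t ≠ u) (heq : τ j t = τ l u) : cross (deriv (τ j) t) (deriv (τ l) u) ≠ 0 := by
  intro h0
  have := S.transverse _ _ (T.meet_of_eq ht hu h heq)
  rw [T.cross_velocity ht hu heq, h0, mul_zero] at this
  exact this rfl

/-- The chart preserves orientation, so crossing signs can be computed in the model disk. -/
theorem sign_eq (T : Tangle S δ s τ) {j l : Fin k} {t u : ℝ}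
    (ht : t ∈ Set.Icc (s j).lo (s j).hi) (hu : u ∈ Set.Icc (s l).lo (s l).hi)
    (h : j ≠ l ∨ t ≠ u) (heq : τ j t = τ l u) :
    S.sign ((s j).comp, t) = (SignType.sign (cross (deriv (τ l) u) (deriv (τ j) t)) : ℤ) := by
  rw [Diagram.sign_eq (T.meet_of_eq ht hu h heq), T.cross_velocity hu ht heq.symm, sign_mul,
    sign_pos (δ.det_pos _ (T.mem_model l u hu)), one_mul]

theorem mem_under_iff (T : Tangle S δ s τ) {j : Fin k} {t : ℝ}
    (ht : t ∈ Set.Icc (s j).lo (s j).hi) :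
    t ∈ S.gauss.under (s j).comp ↔
      (∃ l, ∃ u ∈ Set.Icc (s l).lo (s l).hi, (j ≠ l ∨ t ≠ u) ∧ τ j t = τ l u) ∧
        S.kind ((s j).comp, t) = Passage.below := by
  change t ∈ S.underTimes _ ↔ _
  rw [Diagram.mem_underTimes]
  refine and_congr_left fun _ => ⟨?_, ?_⟩
  · rintro ⟨q, hq⟩
    obtain ⟨l, hl, hu, heq⟩ := T.exists_of_meet ht hq
    refine ⟨l, q.2, hu, ?_, heq⟩
    by_contra! hc
    exact hq.2.2.1 (Prod.ext (by rw [hl, hc.1]) hc.2)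
  · rintro ⟨l, u, hu, h, heq⟩
    exact ⟨_, T.meet_of_eq ht hu h heq⟩

theorem upper_eq (T : Tangle S δ s τ) {j l : Fin k} {t u : ℝ}
    (ht : t ∈ Set.Icc (s j).lo (s j).hi) (hu : u ∈ Set.Icc (s l).lo (s l).hi)
    (h : j ≠ l ∨ t ≠ u) (heq : τ j t = τ l u) :
    S.gauss.upper ((s j).comp, t) = ((s l).comp, u) :=
  Diagram.partner_eq (T.meet_of_eq ht hu h heq)

theorem disjoint_window (T : Tangle S δ s τ) (j l : Fin k) (h : j ≠ l) :
    Disjoint (s j).window.points (s l).window.points := T.disjoint j l h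

theorem eventually_notMem {m : Strand n} {p : Fin n × ℝ} (hp : p ∉ m.points) :
    ∀ᶠ t in 𝓝 p.2, (p.1, t) ∉ m.points := by
  by_cases h : p.1 = m.comp
  · have : p.2 ∉ Set.Icc m.lo m.hi := fun h' => hp ⟨h, h'⟩
    exact mem_of_superset (isClosed_Icc.isOpen_compl.mem_nhds this) fun t ht h' => ht h'.2
  · exact Eventually.of_forall fun t ht => h ht.1

theorem agreeOff (hx : Function.Injective x) (T : Tangle S δ s τ) (T' : Tangle S' δ s τ')
    {m : Fin k} (h : AgreeExcept S S' s m) :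
    Diagram.AgreeOff S S' (⋃ j, (s j).window.points) := by
  have hU : ∀ p, p ∉ (⋃ j, (s j).window.points) ↔ ∀ j, p ∉ (s j).points := by
    intro p
    rw [Set.mem_iUnion, not_exists]
    rfl
  have hnot : ∀ (R : Diagram n x) (σ : Fin k → ℝ → ℝ × ℝ), Tangle R δ s σ → ∀ p q,
      p ∉ (⋃ j, (s j).window.points) → Meet R.curve p q → q ∉ (⋃ j, (s j).window.points) := by
    intro R σ Q p q hp hpq hq
    rw [Set.mem_iUnion] at hq hp
    refine hp ((Q.mem_iff p hpq.1).mp ?_)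
    rw [hpq.2.2.2]
    exact (Q.mem_iff q hpq.2.1).mpr hq
  have hcurve : ∀ p, p ∉ (⋃ j, (s j).window.points) → p.2 ∈ Set.Icc (0 : ℝ) 1 →
      S'.curve p = S.curve p := fun p hp ht => h.1 p ht ((hU p).mp hp m)
  have hvel : ∀ p, p ∉ (⋃ j, (s j).window.points) → p.2 ∈ Set.Ioo (0 : ℝ) 1 →
      velocity S'.curve p = velocity S.curve p := by
    intro p hp ht
    refine Diagram.velocity_congr ?_
    filter_upwards [Diagram.eventually_mem_Icc ht, eventually_notMem ((hU p).mp hp m)] with u hu hu'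
    exact h.1 (p.1, u) hu hu'
  refine ⟨hnot S τ T, fun p q hp => ⟨fun hpq => ?_, fun hpq => ?_⟩,
    fun p q hp hpq => h.2 p ⟨q, hpq⟩ ((hU p).mp hp), fun p q hp hpq => ?_⟩
  · exact hpq.congr (hcurve p hp hpq.1) (hcurve q (hnot S τ T p q hp hpq) hpq.2.1)
  · exact hpq.congr (hcurve p hp hpq.1).symm (hcurve q (hnot S' τ' T' p q hp hpq) hpq.2.1).symm
  · rw [hvel p hp (Diagram.time_mem_Ioo hx hpq),
      hvel q (hnot S τ T p q hp hpq) (Diagram.time_mem_Ioo hx hpq.symm)]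

theorem chart_eq_of_agree (T : Tangle S δ s τ) (T' : Tangle S' δ s τ') {m : Fin k}
    (h : AgreeExcept S S' s m) {j : Fin k} (hj : j ≠ m) {t : ℝ}
    (ht : t ∈ Set.Icc (s j).lo (s j).hi) : τ' j t = τ j t := by
  refine δ.injOn (T'.mem_model j t ht) (T.mem_model j t ht) ?_
  rw [← T.chart_eq j t ht, ← T'.chart_eq j t ht]
  exact h.1 _ (mem_Icc ht) fun hm => Set.disjoint_left.mp (T.disjoint j m hj)
    (show ((s j).comp, t) ∈ (s j).points from ⟨rfl, ht⟩) hm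

/-- The diagrams agree just before the moving strand begins, hence at its initial point by
continuity. This later shows that the strand has the same direction on both sides of a triangle
move. -/
theorem chart_lo_eq_of_agree (T : Tangle S δ s τ) (T' : Tangle S' δ s τ') {m : Fin k}
    (h : AgreeExcept S S' s m) : τ' m (s m).lo = τ m (s m).lo := by
  have hlo : (s m).lo ∈ Set.Icc (s m).lo (s m).hi := Set.left_mem_Icc.mpr (s m).lt.le
  refine δ.injOn (T'.mem_model m _ hlo) (T.mem_model m _ hlo) ?_
  rw [← T.chart_eq m _ hlo, ← T'.chart_eq m _ hlo]
  have h1 := ((S.smooth (s m).comp).continuous.tendsto (s m).lo).mono_left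
    (nhdsWithin_le_nhds (s := Set.Iio (s m).lo))
  have h2 := ((S'.smooth (s m).comp).continuous.tendsto (s m).lo).mono_left
    (nhdsWithin_le_nhds (s := Set.Iio (s m).lo))
  refine tendsto_nhds_unique_of_eventuallyEq h2 h1 ?_
  have h3 : ∀ᶠ t in 𝓝[<] (s m).lo, t ∈ Set.Icc (0 : ℝ) 1 :=
    nhdsWithin_le_nhds (Diagram.eventually_mem_Icc (p := ((s m).comp, (s m).lo)) (mem_Ioo hlo))
  filter_upwards [h3, self_mem_nhdsWithin] with t ht ht'
  exact h.1 _ ht fun hm => absurd hm.2.1 (not_le.mpr ht')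

end Tangle

/-! ### The moves with one strand. -/

namespace Diagram

variable {n : ℕ} {x : Fin n → ℝ} {S S' : Diagram n x}

/-- With a single strand in the disk, every crossing there is a self-crossing of its component. -/
theorem sameLongitudes_of_kinkMove (hx : Function.Injective x) {c : Passage}
    (h : KinkMove S S' c) : SameLongitudes S S' := by
  obtain ⟨δ, s, τ, τ', T, T', hagree, -⟩ := h
  have key : ∀ (R : Diagram n x) (σ : Fin 1 → ℝ → ℝ × ℝ), Tangle R δ s σ →
      ∀ (j : Fin 1) p q, p ∈ (s j).window.points → Meet R.curve p q → q.1 = (s j).window.comp := by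
    rintro R σ Q j ⟨i, t⟩ q ⟨hi, ht⟩ hpq
    change i = (s j).comp at hi
    subst hi
    obtain ⟨l, hl, -⟩ := Q.exists_of_meet ht hpq
    rw [hl, Subsingleton.elim l j]
    rfl
  exact (T.agreeOff hx T' hagree).sameLongitudes_of_self T.disjoint_window (key S τ T)
    (key S' τ' T')

end Diagram

/-! ### Curves that run across the model disk -/

section Calculus

theorem hasDerivAt_fst {τ : ℝ → ℝ × ℝ} (h : ContDiff ℝ ∞ τ) (t : ℝ) :
    HasDerivAt (fun u => (τ u).1) (deriv τ t).1 t :=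
  (ContinuousLinearMap.fst ℝ ℝ ℝ).hasFDerivAt.comp_hasDerivAt t
    ((h.differentiable (by simp)) t).hasDerivAt

theorem hasDerivAt_snd {τ : ℝ → ℝ × ℝ} (h : ContDiff ℝ ∞ τ) (t : ℝ) :
    HasDerivAt (fun u => (τ u).2) (deriv τ t).2 t :=
  (ContinuousLinearMap.snd ℝ ℝ ℝ).hasFDerivAt.comp_hasDerivAt t
    ((h.differentiable (by simp)) t).hasDerivAt

theorem continuous_deriv {τ : ℝ → ℝ × ℝ} (h : ContDiff ℝ ∞ τ) : Continuous (deriv τ) :=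
  h.continuous_deriv (by simp)

theorem deriv_eq_of_eqOn_Icc {f g : ℝ → ℝ} {f' g' lo hi t : ℝ} (hlt : lo < hi)
    (ht : t ∈ Set.Icc lo hi) (hf : HasDerivAt f f' t) (hg : HasDerivAt g g' t)
    (h : ∀ u ∈ Set.Icc lo hi, f u = g u) : f' = g' :=
  (uniqueDiffOn_Icc hlt t ht).eq_deriv _ hf.hasDerivWithinAt
    (hg.hasDerivWithinAt.congr h (h t ht))

theorem pos_of_ne_zero_of_exists_pos {f : ℝ → ℝ} (hf : Continuous f) {lo hi : ℝ}
    (hne : ∀ t ∈ Set.Icc lo hi, f t ≠ 0) (hpos : ∃ t ∈ Set.Icc lo hi, 0 < f t) :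
    ∀ t ∈ Set.Icc lo hi, 0 < f t := by
  intro t ht
  obtain ⟨r, hr, hr0⟩ := hpos
  by_contra! h
  obtain ⟨u, hu, hu0⟩ := isPreconnected_Icc.intermediate_value ht hr hf.continuousOn ⟨h, hr0.le⟩
  exact hne u hu hu0

/-- The direction, right or left, in which a curve runs across the model disk. -/
structure HasDirection (τ : ℝ → ℝ × ℝ) (lo hi d : ℝ) : Prop where
  sq : d * d = 1
  lo_eq : d * (τ lo).1 = -1
  hi_eq : d * (τ hi).1 = 1
  pos : ∀ t ∈ Set.Icc lo hi, 0 < d * (deriv τ t).1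

theorem RunsAcross.exists_hasDirection {τ : ℝ → ℝ × ℝ} {lo hi : ℝ} (h : RunsAcross τ lo hi)
    (hτ : ContDiff ℝ ∞ τ) (hlt : lo < hi) (hne : ∀ t ∈ Set.Icc lo hi, (deriv τ t).1 ≠ 0) :
    ∃ d, HasDirection τ lo hi d := by
  obtain ⟨d, hd, h1, h2⟩ : ∃ d : ℝ, d * d = 1 ∧ d * (τ lo).1 = -1 ∧ d * (τ hi).1 = 1 := by
    rcases h with h | h
    · exact ⟨1, by norm_num, by rw [h.1]; norm_num, by rw [h.2]; norm_num⟩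
    · exact ⟨-1, by norm_num, by rw [h.1]; norm_num, by rw [h.2]; norm_num⟩
  refine ⟨d, hd, h1, h2, pos_of_ne_zero_of_exists_pos ?_ ?_ ?_⟩
  · exact continuous_const.mul (continuous_fst.comp (continuous_deriv hτ))
  · intro t ht
    exact mul_ne_zero (left_ne_zero_of_mul_eq_one hd) (hne t ht)
  -- The horizontal velocity keeps its sign; the mean value theorem between the two edges provides
  -- one point where `d` times it is positive.
  · obtain ⟨c, hc, hc'⟩ := exists_hasDerivAt_eq_slope (fun t => d * (τ t).1)
      (fun t => d * (deriv τ t).1) hlt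
      (continuous_const.mul (continuous_fst.comp hτ.continuous)).continuousOn
      fun t _ => (hasDerivAt_fst hτ t).const_mul d
    refine ⟨c, Set.Ioo_subset_Icc_self hc, ?_⟩
    rw [hc', h1, h2]
    exact div_pos (by norm_num) (sub_pos.mpr hlt)

namespace HasDirection

variable {τ : ℝ → ℝ × ℝ} {lo hi d : ℝ}

theorem strictMonoOn (h : HasDirection τ lo hi d) (hτ : ContDiff ℝ ∞ τ) :
    StrictMonoOn (fun t => d * (τ t).1) (Set.Icc lo hi) := by
  refine strictMonoOn_of_deriv_pos (convex_Icc lo hi)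
    (continuous_const.mul (continuous_fst.comp hτ.continuous)).continuousOn fun t ht => ?_
  rw [((hasDerivAt_fst hτ t).const_mul d).deriv]
  exact h.pos t (interior_subset ht)

theorem injOn_fst (h : HasDirection τ lo hi d) (hτ : ContDiff ℝ ∞ τ) {t u : ℝ}
    (ht : t ∈ Set.Icc lo hi) (hu : u ∈ Set.Icc lo hi) (heq : (τ t).1 = (τ u).1) : t = u :=
  (h.strictMonoOn hτ).injOn ht hu (by simp only [heq])

theorem exists_fst_eq (h : HasDirection τ lo hi d) (hτ : ContDiff ℝ ∞ τ) (hlt : lo < hi) {a : ℝ}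
    (ha : a ∈ Set.Icc (-1 : ℝ) 1) : ∃ t ∈ Set.Icc lo hi, (τ t).1 = a := by
  have hivt := intermediate_value_Icc hlt.le
    ((continuous_const.mul (continuous_fst.comp hτ.continuous)).continuousOn
      (s := Set.Icc lo hi) (f := fun t => d * (τ t).1))
  simp only [h.lo_eq, h.hi_eq] at hivt
  have hda : d * a ∈ Set.Icc (-1 : ℝ) 1 := by
    rcases mul_self_eq_one_iff.mp h.sq with hd | hd
    · simpa [hd] using ha
    · rw [hd]; exact ⟨by linarith [ha.2], by linarith [ha.1]⟩
  obtain ⟨t, ht, hta⟩ := hivt hda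
  exact ⟨t, ht, mul_left_cancel₀ (left_ne_zero_of_mul_eq_one h.sq) hta⟩

end HasDirection

theorem deriv_nonpos_of_pos_left {f : ℝ → ℝ} {f' a t : ℝ} (hf : HasDerivAt f f' t) (ha : a < t)
    (h : ∀ u ∈ Set.Ico a t, 0 < f u) (ht : f t = 0) : f' ≤ 0 := by
  have h1 := (hasDerivWithinAt_iff_tendsto_slope' (by simp)).mp
    (hf.hasDerivWithinAt (s := Set.Iio t))
  refine le_of_tendsto h1 ?_
  filter_upwards [Ioo_mem_nhdsLT ha] with u hu
  rw [slope_def_field, ht, sub_zero]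
  exact (div_neg_of_pos_of_neg (h u ⟨hu.1.le, hu.2⟩) (sub_neg.mpr hu.2)).le

theorem deriv_nonneg_of_pos_right {f : ℝ → ℝ} {f' b t : ℝ} (hf : HasDerivAt f f' t) (hb : t < b)
    (h : ∀ u ∈ Set.Ioc t b, 0 < f u) (ht : f t = 0) : 0 ≤ f' := by
  have h1 := (hasDerivWithinAt_iff_tendsto_slope' (by simp)).mp
    (hf.hasDerivWithinAt (s := Set.Ioi t))
  refine ge_of_tendsto h1 ?_
  filter_upwards [Ioo_mem_nhdsGT hb] with u hu
  rw [slope_def_field, ht, sub_zero]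
  exact (div_pos (h u ⟨hu.1, hu.2.le⟩) (sub_pos.mpr hu.1)).le

end Calculus

/-! ### The moves with two strands -/

namespace GaussData

variable {n : ℕ} {D : GaussData n} {G : Type*} [Group G] {c : Fin n × ℝ → G}

theorem prodOn_pair_eq_one {i : Fin n} {I : Set ℝ} {t u : ℝ} (htu : t ≠ u)
    (h : ∀ v, v ∈ D.under i ∧ v ∈ I ↔ v = t ∨ v = u)
    (hc : c (D.upper (i, t)) = c (D.upper (i, u))) (hs : D.sgn (i, u) = -D.sgn (i, t)) :
    D.prodOn c i I = 1 := by
  rcases htu.lt_or_gt with h1 | h1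
  · rw [prodOn_pair h1 h, factor, factor, hc, hs, ← zpow_add, add_neg_cancel, zpow_zero]
  · rw [prodOn_pair h1 fun v => by rw [h, or_comm], factor, factor, hc, hs, ← zpow_add,
      neg_add_cancel, zpow_zero]

theorem ColoringOn.eq_lo {W : Window n} (h : D.ColoringOn c W) {t : ℝ}
    (ht : t ∈ Set.Icc W.lo W.hi) (hu : ∀ u ∈ Set.Ico W.lo t, u ∉ D.under W.comp) :
    c (W.comp, t) = c (W.comp, W.lo) := by
  rw [h t ht, prodOn_eq_one hu, inv_one, one_mul, mul_one]

end GaussData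

theorem sign_intCast_neg (a : ℝ) :
    (SignType.sign (-a) : ℤ) = -(SignType.sign a : ℤ) := by
  rw [Left.sign_neg, SignType.coe_neg]

namespace Diagram

variable {n : ℕ} {x : Fin n → ℝ} {S S' : Diagram n x}

/-- The two crossings have opposite signs, and the over-strand has no under-crossing in its window,
hence one colour at both of them. Their contributions cancel, matching the absence of crossings in
`S'`. -/
theorem sameLongitudes_of_bigonMove (hx : Function.Injective x) {c : Passage}
    (h : BigonMove S S' c) : SameLongitudes S S' := by
  obtain ⟨δ, s, τ, τ', T, T', hagree, hrun, hax, hinj, hinj', habove, t₁, t₂, hlt₁, ht₁₂, hlt₂,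
    hpos₁, hz₁, hneg, hz₂, hpos₂, hk₁, hk₂⟩ := h
  have hτ0 := T.smooth 0
  have hτ1 := T.smooth 1
  have hsnd : ∀ t ∈ Set.Icc (s 0).lo (s 0).hi, (deriv (τ 0) t).2 = 0 := fun t ht =>
    deriv_eq_of_eqOn_Icc (s 0).lt ht (hasDerivAt_snd hτ0 t) (hasDerivAt_const t 0) hax
  obtain ⟨d, hd⟩ := hrun.exists_hasDirection hτ0 (s 0).lt fun t ht h0 =>
    T.deriv_ne_zero ht (Prod.ext h0 (hsnd t ht))
  have hm₁ : t₁ ∈ Set.Icc (s 1).lo (s 1).hi := ⟨hlt₁.le, (ht₁₂.trans hlt₂).le⟩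
  have hm₂ : t₂ ∈ Set.Icc (s 1).lo (s 1).hi := ⟨(hlt₁.trans ht₁₂).le, hlt₂.le⟩
  obtain ⟨r₁, hr₁, he₁⟩ := hd.exists_fst_eq hτ0 (s 0).lt (T.mem_model 1 t₁ hm₁).1
  obtain ⟨r₂, hr₂, he₂⟩ := hd.exists_fst_eq hτ0 (s 0).lt (T.mem_model 1 t₂ hm₂).1
  have hE₁ : τ 0 r₁ = τ 1 t₁ := Prod.ext he₁ (by rw [hax r₁ hr₁, hz₁])
  have hE₂ : τ 0 r₂ = τ 1 t₂ := Prod.ext he₂ (by rw [hax r₂ hr₂, hz₂])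
  have hr : r₁ ≠ r₂ := by
    rintro rfl
    exact ht₁₂.ne (hinj hm₁ hm₂ (hE₁.symm.trans hE₂))
  have hcross : ∀ t ∈ Set.Icc (s 1).lo (s 1).hi, (τ 1 t).2 = 0 → t = t₁ ∨ t = t₂ := by
    intro t ht h0
    by_contra! hne
    rcases hne.1.lt_or_gt with h1 | h1
    · exact (hpos₁ t ⟨ht.1, h1⟩).ne' h0
    rcases hne.2.lt_or_gt with h2 | h2
    · exact (hneg t ⟨h1, h2⟩).ne h0
    · exact (hpos₂ t ⟨h2, ht.2⟩).ne' h0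
  have h01 : (0 : Fin 2) ≠ 1 := by decide
  have hS1 : ∀ t ∈ Set.Icc (s 1).lo (s 1).hi,
      (∃ l, ∃ u ∈ Set.Icc (s l).lo (s l).hi, ((1 : Fin 2) ≠ l ∨ t ≠ u) ∧ τ 1 t = τ l u) ↔
        t = t₁ ∨ t = t₂ := by
    intro t ht
    constructor
    · rintro ⟨l, u, hu, hne, heq⟩
      fin_cases l
      · exact hcross t ht (by rw [heq]; exact hax u hu)
      · exact absurd (hinj ht hu heq) (hne.resolve_left (by simp))
    · rintro (rfl | rfl)
      · exact ⟨0, r₁, hr₁, Or.inl h01.symm, hE₁.symm⟩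
      · exact ⟨0, r₂, hr₂, Or.inl h01.symm, hE₂.symm⟩
  have hS0 : ∀ t ∈ Set.Icc (s 0).lo (s 0).hi,
      (∃ l, ∃ u ∈ Set.Icc (s l).lo (s l).hi, ((0 : Fin 2) ≠ l ∨ t ≠ u) ∧ τ 0 t = τ l u) ↔
        t = r₁ ∨ t = r₂ := by
    intro t ht
    constructor
    · rintro ⟨l, u, hu, hne, heq⟩
      fin_cases l
      · exact absurd (hd.injOn_fst hτ0 ht hu (congrArg Prod.fst heq)) (hne.resolve_left (by simp))
      · rcases hcross u hu (by rw [← hax t ht]; exact (congrArg Prod.snd heq).symm) with h | h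
        · subst h
          exact Or.inl (hd.injOn_fst hτ0 ht hr₁ (congrArg Prod.fst (heq.trans hE₁.symm)))
        · subst h
          exact Or.inr (hd.injOn_fst hτ0 ht hr₂ (congrArg Prod.fst (heq.trans hE₂.symm)))
    · rintro (rfl | rfl)
      · exact ⟨1, t₁, hm₁, Or.inl h01, hE₁⟩
      · exact ⟨1, t₂, hm₂, Or.inl h01, hE₂⟩
  have hS' : ∀ j, ∀ t ∈ Set.Icc (s j).lo (s j).hi, t ∉ S'.gauss.under (s j).comp := by
    intro j t ht hu
    have h0 : ∀ t ∈ Set.Icc (s 0).lo (s 0).hi, τ' 0 t = τ 0 t := fun t ht =>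
      T.chart_eq_of_agree T' hagree h01 ht
    have hne : ∀ t ∈ Set.Icc (s 0).lo (s 0).hi, ∀ u ∈ Set.Icc (s 1).lo (s 1).hi,
        τ' 0 t ≠ τ' 1 u := by
      intro t ht u hu heq
      have := congrArg Prod.snd heq
      rw [h0 t ht, hax t ht] at this
      exact (habove u hu).ne this
    obtain ⟨⟨l, u, hu, hjl, heq⟩, -⟩ := (T'.mem_under_iff ht).mp hu
    fin_cases j <;> fin_cases l
    · refine hjl.elim (by simp) fun h => h (hd.injOn_fst hτ0 ht hu ?_)
      rw [← h0 t ht, ← h0 u hu]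
      exact congrArg Prod.fst heq
    · exact hne t ht u hu heq
    · exact hne u hu t ht heq.symm
    · exact hjl.elim (by simp) fun h => h (hinj' ht hu heq)
  have hd₁ : (deriv (τ 1) t₁).2 ≤ 0 :=
    deriv_nonpos_of_pos_left (hasDerivAt_snd hτ1 t₁) hlt₁ hpos₁ hz₁
  have hd₂ : 0 ≤ (deriv (τ 1) t₂).2 :=
    deriv_nonneg_of_pos_right (hasDerivAt_snd hτ1 t₂) hlt₂ hpos₂ hz₂
  have hX : ∀ r ∈ Set.Icc (s 0).lo (s 0).hi, ∀ t, cross (deriv (τ 0) r) (deriv (τ 1) t) =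
      (d * (deriv (τ 0) r).1) * (d * (deriv (τ 1) t).2) := by
    intro r hr t
    rw [cross, hsnd r hr]
    linear_combination (-(deriv (τ 0) r).1 * (deriv (τ 1) t).2) * hd.sq
  -- The second strand comes down through the axis at `t₁` and up at `t₂`; transversality excludes
  -- vertical velocity zero, while the first strand keeps its direction.
  have hsign : (SignType.sign (cross (deriv (τ 0) r₂) (deriv (τ 1) t₂)) : ℤ) =
      -SignType.sign (cross (deriv (τ 0) r₁) (deriv (τ 1) t₁)) := by
    have hn₁ := T.cross_deriv_ne_zero hr₁ hm₁ (Or.inl h01) hE₁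
    have hn₂ := T.cross_deriv_ne_zero hr₂ hm₂ (Or.inl h01) hE₂
    rw [hX _ hr₁] at hn₁
    rw [hX _ hr₂] at hn₂
    rw [hX _ hr₁, hX _ hr₂, sign_mul (d * (deriv (τ 0) r₁).1), sign_mul (d * (deriv (τ 0) r₂).1),
      sign_pos (hd.pos r₁ hr₁), sign_pos (hd.pos r₂ hr₂), one_mul, one_mul, sign_mul d, sign_mul d,
      sign_neg (lt_of_le_of_ne hd₁ (right_ne_zero_of_mul (right_ne_zero_of_mul hn₁))),
      sign_pos (lt_of_le_of_ne hd₂ (right_ne_zero_of_mul (right_ne_zero_of_mul hn₂)).symm)]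
    simp
  have hsign₂ : S.sign ((s 1).comp, t₂) = -S.sign ((s 1).comp, t₁) := by
    rw [T.sign_eq hm₁ hr₁ (Or.inl h01.symm) hE₁.symm, T.sign_eq hm₂ hr₂ (Or.inl h01.symm) hE₂.symm,
      hsign]
  have hsign₁ : S.sign ((s 0).comp, r₂) = -S.sign ((s 0).comp, r₁) := by
    rw [T.sign_eq hr₁ hm₁ (Or.inl h01) hE₁, T.sign_eq hr₂ hm₂ (Or.inl h01) hE₂,
      cross_swap, cross_swap (deriv (τ 0) r₁), sign_intCast_neg, sign_intCast_neg, hsign]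
  have hkind₁ : S.kind ((s 0).comp, r₁) = c.opp := by
    rw [← hk₁]; exact S.kind_opp _ _ (T.meet_of_eq hm₁ hr₁ (Or.inl h01.symm) hE₁.symm)
  have hkind₂ : S.kind ((s 0).comp, r₂) = c.opp := by
    rw [← hk₂]; exact S.kind_opp _ _ (T.meet_of_eq hm₂ hr₂ (Or.inl h01.symm) hE₂.symm)
  have hup0 : S.gauss.upper ((s 0).comp, r₁) = ((s 1).comp, t₁) ∧
      S.gauss.upper ((s 0).comp, r₂) = ((s 1).comp, t₂) :=
    ⟨T.upper_eq hr₁ hm₁ (Or.inl h01) hE₁, T.upper_eq hr₂ hm₂ (Or.inl h01) hE₂⟩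
  have hup1 : S.gauss.upper ((s 1).comp, t₁) = ((s 0).comp, r₁) ∧
      S.gauss.upper ((s 1).comp, t₂) = ((s 0).comp, r₂) :=
    ⟨T.upper_eq hm₁ hr₁ (Or.inl h01.symm) hE₁.symm, T.upper_eq hm₂ hr₂ (Or.inl h01.symm) hE₂.symm⟩
  have hu0 : ∀ t ∈ Set.Icc (s 0).lo (s 0).hi, t ∈ S.gauss.under (s 0).comp ↔
      (t = r₁ ∨ t = r₂) ∧ c.opp = Passage.below := by
    intro t ht
    rw [T.mem_under_iff ht, hS0 t ht]
    refine and_congr_right fun h => ?_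
    rcases h with rfl | rfl
    · rw [hkind₁]
    · rw [hkind₂]
  have hu1 : ∀ t ∈ Set.Icc (s 1).lo (s 1).hi, t ∈ S.gauss.under (s 1).comp ↔
      (t = t₁ ∨ t = t₂) ∧ c = Passage.below := by
    intro t ht
    rw [T.mem_under_iff ht, hS1 t ht]
    refine and_congr_right fun h => ?_
    rcases h with rfl | rfl
    · rw [hk₁]
    · rw [hk₂]
  refine ((T.agreeOff hx T' hagree).locallyEquivalent T.disjoint_window ?_).longitude_mem_avoidKer
  intro G _ N _ a a' _ _ ha _ _ j
  have h1 : S'.gauss.prodOn a' (s j).comp (Set.Icc (s j).lo (s j).hi) = 1 :=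
    GaussData.prodOn_eq_one (hS' j)
  have h2 : S.gauss.prodOn a (s j).comp (Set.Icc (s j).lo (s j).hi) = 1 := by
    by_cases hex : ∃ t ∈ Set.Icc (s j).lo (s j).hi, t ∈ S.gauss.under (s j).comp
    · obtain ⟨t, ht, htu⟩ := hex
      fin_cases j
      · have hc := ((hu0 t ht).mp htu).2
        have hno : ∀ u ∈ Set.Icc (s 1).lo (s 1).hi, u ∉ S.gauss.under (s 1).comp := by
          intro u hu hu'
          rw [((hu1 u hu).mp hu').2] at hc
          cases hc
        refine GaussData.prodOn_pair_eq_one hr (fun v => ⟨fun hv => ((hu0 v hv.2).mp hv.1).1,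
          fun hv => ?_⟩) ?_ hsign₁
        · have : v ∈ Set.Icc (s 0).lo (s 0).hi := by rcases hv with rfl | rfl <;> assumption
          exact ⟨(hu0 v this).mpr ⟨hv, hc⟩, this⟩
        · change a (S.gauss.upper ((s 0).comp, r₁)) = a (S.gauss.upper ((s 0).comp, r₂))
          rw [hup0.1, hup0.2]
          exact ((ha 1).eq_lo hm₁ fun u hu => hno u ⟨hu.1, hu.2.le.trans hm₁.2⟩).trans
            ((ha 1).eq_lo hm₂ fun u hu => hno u ⟨hu.1, hu.2.le.trans hm₂.2⟩).symm
      · have hc := ((hu1 t ht).mp htu).2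
        have hno : ∀ u ∈ Set.Icc (s 0).lo (s 0).hi, u ∉ S.gauss.under (s 0).comp := by
          intro u hu hu'
          have := ((hu0 u hu).mp hu').2
          rw [hc] at this
          cases this
        refine GaussData.prodOn_pair_eq_one ht₁₂.ne (fun v => ⟨fun hv => ((hu1 v hv.2).mp hv.1).1,
          fun hv => ?_⟩) ?_ hsign₂
        · have : v ∈ Set.Icc (s 1).lo (s 1).hi := by rcases hv with rfl | rfl <;> assumption
          exact ⟨(hu1 v this).mpr ⟨hv, hc⟩, this⟩
        · change a (S.gauss.upper ((s 1).comp, t₁)) = a (S.gauss.upper ((s 1).comp, t₂))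
          rw [hup1.1, hup1.2]
          exact ((ha 0).eq_lo hr₁ fun u hu => hno u ⟨hu.1, hu.2.le.trans hr₁.2⟩).trans
            ((ha 0).eq_lo hr₂ fun u hu => hno u ⟨hu.1, hu.2.le.trans hr₂.2⟩).symm
    · push Not at hex
      exact GaussData.prodOn_eq_one hex
  change (S.gauss.prodOn a (s j).comp (Set.Icc (s j).lo (s j).hi))⁻¹ *
    S'.gauss.prodOn a' (s j).comp (Set.Icc (s j).lo (s j).hi) ∈ N _
  rw [h1, h2, inv_one, one_mul]
  exact one_mem _

end Diagram

/-! ### Colourings of three strands that cross each other once -/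

namespace GaussData

variable {n : ℕ}

/-- Three windows whose strands cross each other once: `θ j l` is the time at which the strand `j`
crosses the strand `l`, `b j l` says that it passes below it, and `σ j l` is the sign of the
crossing in this case. -/
structure Triangle (D : GaussData n) (W : Fin 3 → Window n) (b : Fin 3 → Fin 3 → Prop)
    (σ : Fin 3 → Fin 3 → ℤ) (θ : Fin 3 → Fin 3 → ℝ) : Prop where
  mem : ∀ j l, j ≠ l → θ j l ∈ Set.Icc (W j).lo (W j).hi
  ne : ∀ j l m, j ≠ l → j ≠ m → l ≠ m → θ j l ≠ θ j m
  under_iff : ∀ j, ∀ t ∈ Set.Icc (W j).lo (W j).hi,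
    t ∈ D.under (W j).comp ↔ ∃ l, j ≠ l ∧ t = θ j l ∧ b j l
  upper_eq : ∀ j l, j ≠ l → D.upper ((W j).comp, θ j l) = ((W l).comp, θ l j)
  sgn_eq : ∀ j l, j ≠ l → D.sgn ((W j).comp, θ j l) = σ j l

namespace Triangle

variable {D D' : GaussData n} {W : Fin 3 → Window n} {b : Fin 3 → Fin 3 → Prop}
  {σ : Fin 3 → Fin 3 → ℤ} {θ θ' : Fin 3 → Fin 3 → ℝ} {G : Type*} [Group G]
  {c c' : Fin n × ℝ → G} {j l m : Fin 3}

theorem eq_or_eq (hjl : j ≠ l) (hjm : j ≠ m) (hlm : l ≠ m) (r : Fin 3) (hr : j ≠ r) :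
    r = l ∨ r = m := by
  revert j l m r; decide

open Classical in
/-- The contribution of the crossing with the strand `l` to the longitude along the strand `j`. -/
def contribution (W : Fin 3 → Window n) (b : Fin 3 → Fin 3 → Prop) (σ : Fin 3 → Fin 3 → ℤ)
    (θ : Fin 3 → Fin 3 → ℝ) (c : Fin n × ℝ → G) (j l : Fin 3) : G :=
  if b j l then c ((W l).comp, θ l j) ^ σ j l else 1

theorem prodOn_eq_contribution (h : D.Triangle W b σ θ) (hjl : j ≠ l) (hjm : j ≠ m) (hlm : l ≠ m)
    {I : Set ℝ} (hI : I ⊆ Set.Icc (W j).lo (W j).hi) (hl : θ j l ∈ I) (hm : θ j m ∉ I) :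
    D.prodOn c (W j).comp I = contribution W b σ θ c j l := by
  have hu : ∀ t ∈ I, t ∈ D.under (W j).comp ↔ t = θ j l ∧ b j l := by
    intro t ht
    rw [h.under_iff j t (hI ht)]
    constructor
    · rintro ⟨r, hr, rfl, hb⟩
      rcases eq_or_eq hjl hjm hlm r hr with rfl | rfl
      · exact ⟨rfl, hb⟩
      · exact absurd ht hm
    · rintro ⟨rfl, hb⟩
      exact ⟨l, hjl, rfl, hb⟩
  rw [contribution]
  split_ifs with hb
  · rw [prodOn_singleton (t := θ j l), factor, h.upper_eq j l hjl, h.sgn_eq j l hjl]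
    intro t
    constructor
    · exact fun ht => ((hu t ht.2).mp ht.1).1
    · rintro rfl
      exact ⟨(hu _ hl).mpr ⟨rfl, hb⟩, hl⟩
  · exact prodOn_eq_one fun t ht htu => hb ((hu t ht).mp htu).2

theorem color_first (h : D.Triangle W b σ θ) (hc : ∀ j, D.ColoringOn c (W j)) (hjl : j ≠ l)
    (hjm : j ≠ m) (hlm : l ≠ m) (hlt : θ j l < θ j m) :
    c ((W j).comp, θ j l) = c ((W j).comp, (W j).lo) := by
  have hmem := h.mem j l hjl
  refine (hc j).eq_lo hmem fun u hu htu => ?_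
  obtain ⟨r, hr, rfl, -⟩ := (h.under_iff j u ⟨hu.1, hu.2.le.trans hmem.2⟩).mp htu
  rcases eq_or_eq hjl hjm hlm r hr with rfl | rfl
  · exact lt_irrefl _ hu.2
  · exact lt_asymm hlt hu.2

theorem color_second (h : D.Triangle W b σ θ) (hc : ∀ j, D.ColoringOn c (W j)) (hjl : j ≠ l)
    (hjm : j ≠ m) (hlm : l ≠ m) (hlt : θ j l < θ j m) :
    c ((W j).comp, θ j m) = (contribution W b σ θ c j l)⁻¹ * c ((W j).comp, (W j).lo) *
      contribution W b σ θ c j l := by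
  have hmem := h.mem j m hjm
  rw [hc j _ hmem, h.prodOn_eq_contribution hjl hjm hlm (I := Set.Ico (W j).lo (θ j m))
    (fun u hu => ⟨hu.1, hu.2.le.trans hmem.2⟩) ⟨(h.mem j l hjl).1, hlt⟩ fun hu => lt_irrefl _ hu.2]

theorem prodOn_Icc (h : D.Triangle W b σ θ) (hjl : j ≠ l) (hjm : j ≠ m) (hlm : l ≠ m)
    (hlt : θ j l < θ j m) : D.prodOn c (W j).comp (Set.Icc (W j).lo (W j).hi) =
      contribution W b σ θ c j l * contribution W b σ θ c j m := by
  have hmem := h.mem j m hjm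
  rw [← Set.Ico_union_Icc_eq_Icc hmem.1 hmem.2, prodOn_union fun t ht u hu => ht.2.trans_le hu.1,
    h.prodOn_eq_contribution hjl hjm hlm (I := Set.Ico (W j).lo (θ j m))
      (fun u hu => ⟨hu.1, hu.2.le.trans hmem.2⟩)
      ⟨(h.mem j l hjl).1, hlt⟩ fun hu => lt_irrefl _ hu.2,
    h.prodOn_eq_contribution hjm hjl hlm.symm (I := Set.Icc (θ j m) (W j).hi)
      (fun u hu => ⟨hmem.1.trans hu.1, hu.2⟩)
      ⟨le_rfl, hmem.2⟩ fun hu => absurd hu.1 (not_le.mpr hlt)]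

/-- The order of the crossings is irrelevant here: only a passage below `m` could recolour the
strand `j` before it meets `l`. -/
theorem color_of_not (h : D.Triangle W b σ θ) (hc : ∀ j, D.ColoringOn c (W j)) (hjl : j ≠ l)
    (hjm : j ≠ m) (hlm : l ≠ m) (hb : ¬ b j m) :
    c ((W j).comp, θ j l) = c ((W j).comp, (W j).lo) := by
  rcases (h.ne j l m hjl hjm hlm).lt_or_gt with hlt | hlt
  · exact h.color_first hc hjl hjm hlm hlt
  · rw [h.color_second hc hjm hjl hlm.symm hlt, contribution, if_neg hb, inv_one, one_mul, mul_one]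

theorem contribution_of_not (h : D.Triangle W b σ θ) (hc : ∀ j, D.ColoringOn c (W j)) (hjl : j ≠ l)
    (hjm : j ≠ m) (hlm : l ≠ m) (hb : b j l) (hb' : ¬ b l m) :
    contribution W b σ θ c j l = c ((W l).comp, (W l).lo) ^ σ j l := by
  rw [contribution, if_pos hb, h.color_of_not hc hjl.symm hlm hjm hb']

theorem prodOn_of_not (h : D.Triangle W b σ θ) (hc : ∀ j, D.ColoringOn c (W j)) (hjl : j ≠ l)
    (hjm : j ≠ m) (hlm : l ≠ m) (hb : b j l) (hb' : ¬ b l m) (hb'' : ¬ b j m) :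
    D.prodOn c (W j).comp (Set.Icc (W j).lo (W j).hi) = c ((W l).comp, (W l).lo) ^ σ j l := by
  have h1 : contribution W b σ θ c j m = 1 := by rw [contribution, if_neg hb'']
  rw [← h.contribution_of_not hc hjl hjm hlm hb hb']
  rcases (h.ne j l m hjl hjm hlm).lt_or_gt with hlt | hlt
  · rw [h.prodOn_Icc hjl hjm hlm hlt, h1, mul_one]
  · rw [h.prodOn_Icc hjm hjl hlm.symm hlt, h1, one_mul]

theorem prodOn_of_not_not (h : D.Triangle W b σ θ) (hjl : j ≠ l) (hjm : j ≠ m) (hlm : l ≠ m)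
    (hb : ¬ b j l) (hb' : ¬ b j m) :
    D.prodOn c (W j).comp (Set.Icc (W j).lo (W j).hi) = 1 := by
  refine prodOn_eq_one fun t ht htu => ?_
  obtain ⟨r, hr, -, hr'⟩ := (h.under_iff j t ht).mp htu
  rcases eq_or_eq hjl hjm hlm r hr with rfl | rfl
  · exact hb hr'
  · exact hb' hr'

/-- The longitude along the lowest strand `j` does not change, if `l` is the highest one. -/
theorem prodOn_lowest (h : D.Triangle W b σ θ) (h' : D'.Triangle W b σ θ')
    (hc : ∀ j, D.ColoringOn c (W j)) (hc' : ∀ j, D'.ColoringOn c' (W j))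
    (hlo : ∀ j, c ((W j).comp, (W j).lo) = c' ((W j).comp, (W j).lo))
    (hrev : ∀ j l m, j ≠ l → j ≠ m → l ≠ m → (θ j l < θ j m ↔ θ' j m < θ' j l))
    (hjl : j ≠ l) (hjm : j ≠ m) (hlm : l ≠ m) (hbl : b j l) (hbm : b j m) (hml : b m l)
    (hlj : ¬ b l j) (hlm' : ¬ b l m)
    (hσ : σ m l = if (θ m l < θ m j ↔ θ j l < θ j m) then σ j l else -σ j l) :
    D.prodOn c (W j).comp (Set.Icc (W j).lo (W j).hi) =
      D'.prodOn c' (W j).comp (Set.Icc (W j).lo (W j).hi) := by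
  have hl := h.contribution_of_not hc hjl hjm hlm hbl hlm'
  have hl' := h'.contribution_of_not hc' hjl hjm hlm hbl hlm'
  have hn := (h.ne j l m hjl hjm hlm).lt_or_gt
  have hn' := (h.ne m l j hlm.symm hjm.symm hjl.symm).lt_or_gt
  have hm := h.contribution_of_not hc hlm.symm hjm.symm hjl.symm hml hlj
  have hm' := h'.contribution_of_not hc' hlm.symm hjm.symm hjl.symm hml hlj
  have hB : contribution W b σ θ c j m = c ((W m).comp, θ m j) ^ σ j m := if_pos hbm
  have hB' : contribution W b σ θ' c' j m = c' ((W m).comp, θ' m j) ^ σ j m := if_pos hbm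
  rw [← hlo] at hl' hm'
  have hprod : θ j l < θ j m → θ' j m < θ' j l := (hrev j l m hjl hjm hlm).mp
  have hprod' : θ j m < θ j l → θ' j l < θ' j m := (hrev j m l hjm hjl hlm.symm).mp
  have hcm : θ m l < θ m j → θ' m j < θ' m l := (hrev m l j hlm.symm hjm.symm hjl.symm).mp
  have hcm' : θ m j < θ m l → θ' m l < θ' m j := (hrev m j l hjm.symm hlm.symm hjl).mp
  -- Let `x` and `y` be the initial colours of the highest strand `l` and the middle strand `m`. At
  -- its crossing with `j`, the strand `m` has the colour `y`, or `y` conjugated by `x ^ σ m l` if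
  -- it has already met `l`. The move reverses the order of crossings on both `j` and `m`. In the
  -- four cases `hσ` makes the two products equal, since conjugating compensates for exchanging the
  -- factors.
  have hconj : ∀ (x y : G) (a b : ℤ), ((x ^ a)⁻¹ * y * x ^ a) ^ b = (x ^ a)⁻¹ * y ^ b * x ^ a := by
    intro x y a b
    have := conj_zpow (i := b) (a := (x ^ a)⁻¹) (b := y)
    rwa [inv_inv] at this
  rcases hn with hj1 | hj1 <;> rcases hn' with hm1 | hm1
  · rw [if_pos (by simp [hj1, hm1])] at hσ
    rw [h.prodOn_Icc hjl hjm hlm hj1, h'.prodOn_Icc hjm hjl hlm.symm (hprod hj1), hl, hl', hB, hB',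
      h.color_second hc hlm.symm hjm.symm hjl.symm hm1, h'.color_first hc' hjm.symm hlm.symm hjl
        (hcm hm1), hm, hσ, hconj, hlo m]
    group
  · rw [if_neg (by simp [hj1, hm1.le])] at hσ
    rw [h.prodOn_Icc hjl hjm hlm hj1, h'.prodOn_Icc hjm hjl hlm.symm (hprod hj1), hl, hl', hB, hB',
      h.color_first hc hjm.symm hlm.symm hjl hm1, h'.color_second hc' hlm.symm hjm.symm hjl.symm
        (hcm' hm1), hm', hσ, hconj, hlo m]
    group
  · rw [if_neg (by simp [hj1.le, hm1])] at hσ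
    rw [h.prodOn_Icc hjm hjl hlm.symm hj1, h'.prodOn_Icc hjl hjm hlm (hprod' hj1), hl, hl', hB, hB',
      h.color_second hc hlm.symm hjm.symm hjl.symm hm1, h'.color_first hc' hjm.symm hlm.symm hjl
        (hcm hm1), hm, hσ, hconj, hlo m]
    group
  · rw [if_pos (by simp [hj1.not_gt, hm1.not_gt])] at hσ
    rw [h.prodOn_Icc hjm hjl hlm.symm hj1, h'.prodOn_Icc hjl hjm hlm (hprod' hj1), hl, hl', hB, hB',
      h.color_first hc hjm.symm hlm.symm hjl hm1, h'.color_second hc' hlm.symm hjm.symm hjl.symm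
        (hcm' hm1), hm', hσ, hconj, hlo m]
    group

/-- Every strand passes below at most one other strand, and the latter is the highest one. -/
theorem prodOn_eq_of_simple (h : D.Triangle W b σ θ) (h' : D'.Triangle W b σ θ')
    (hc : ∀ j, D.ColoringOn c (W j)) (hc' : ∀ j, D'.ColoringOn c' (W j))
    (hlo : ∀ j, c ((W j).comp, (W j).lo) = c' ((W j).comp, (W j).lo))
    (hb : ∀ j l m, j ≠ l → j ≠ m → l ≠ m → b j l → ¬ b l m ∧ ¬ b j m) (j : Fin 3) :
    D.prodOn c (W j).comp (Set.Icc (W j).lo (W j).hi) =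
      D'.prodOn c' (W j).comp (Set.Icc (W j).lo (W j).hi) := by
  obtain ⟨l, m, hjl, hjm, hlm⟩ : ∃ l m : Fin 3, j ≠ l ∧ j ≠ m ∧ l ≠ m := by revert j; decide
  by_cases hl : b j l
  · obtain ⟨h1, h2⟩ := hb j l m hjl hjm hlm hl
    rw [h.prodOn_of_not hc hjl hjm hlm hl h1 h2, h'.prodOn_of_not hc' hjl hjm hlm hl h1 h2, hlo]
  by_cases hm : b j m
  · obtain ⟨h1, -⟩ := hb j m l hjm hjl hlm.symm hm
    rw [h.prodOn_of_not hc hjm hjl hlm.symm hm h1 hl, h'.prodOn_of_not hc' hjm hjl hlm.symm hm h1 hl,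
      hlo]
  · rw [h.prodOn_of_not_not hjl hjm hlm hl hm, h'.prodOn_of_not_not hjl hjm hlm hl hm]

/-- The three strands lie at different heights. -/
theorem prodOn_eq_of_height {height : Fin 3 → ℕ} (hh : Function.Injective height)
    (h : D.Triangle W (fun j l => height j < height l) σ θ)
    (h' : D'.Triangle W (fun j l => height j < height l) σ θ')
    (hc : ∀ j, D.ColoringOn c (W j)) (hc' : ∀ j, D'.ColoringOn c' (W j))
    (hlo : ∀ j, c ((W j).comp, (W j).lo) = c' ((W j).comp, (W j).lo))
    (hrev : ∀ j l m, j ≠ l → j ≠ m → l ≠ m → (θ j l < θ j m ↔ θ' j m < θ' j l))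
    (hσ : ∀ j l m, j ≠ l → j ≠ m → l ≠ m →
      σ m l = if (θ m l < θ m j ↔ θ j l < θ j m) then σ j l else -σ j l) (j : Fin 3) :
    D.prodOn c (W j).comp (Set.Icc (W j).lo (W j).hi) =
      D'.prodOn c' (W j).comp (Set.Icc (W j).lo (W j).hi) := by
  obtain ⟨l, m, hjl, hjm, hlm, hlt⟩ :
      ∃ l m : Fin 3, j ≠ l ∧ j ≠ m ∧ l ≠ m ∧ height m < height l := by
    obtain ⟨l, m, hjl, hjm, hlm⟩ : ∃ l m : Fin 3, j ≠ l ∧ j ≠ m ∧ l ≠ m := by revert j; decide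
    rcases (hh.ne hlm).lt_or_gt with h | h
    · exact ⟨m, l, hjm, hjl, hlm.symm, h⟩
    · exact ⟨l, m, hjl, hjm, hlm, h⟩
  by_cases hm : height j < height m
  · exact h.prodOn_lowest h' hc hc' hlo hrev hjl hjm hlm (hm.trans hlt) hm hlt
      (hm.trans hlt).not_gt hlt.not_gt (hσ j l m hjl hjm hlm)
  by_cases hl : height j < height l
  · rw [h.prodOn_of_not hc hjl hjm hlm hl hlt.not_gt hm,
      h'.prodOn_of_not hc' hjl hjm hlm hl hlt.not_gt hm, hlo]
  · rw [h.prodOn_of_not_not hjl hjm hlm hl hm, h'.prodOn_of_not_not hjl hjm hlm hl hm]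

end Triangle

end GaussData

/-! ### The moves with three strands -/

/-- The slopes of the three strands in the model of the moves with three strands. -/
def modelSlope : Fin 3 → ℝ := ![1, -1, 0]

theorem modelSlope_injective : Function.Injective modelSlope := by
  intro j l h
  fin_cases j <;> fin_cases l <;> simp [modelSlope] at h ⊢ <;> norm_num at h

theorem abs_mul_of_mul_self_eq_one {a : ℝ} (h : a * a = 1) (y : ℝ) : |a * y| = |y| := by
  rcases mul_self_eq_one_iff.mp h with rfl | rfl <;> simp

theorem sign_eq_of_mul_pos {a b : ℝ} (h : 0 < a * b) : SignType.sign a = SignType.sign b := by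
  rcases mul_pos_iff.mp h with ⟨ha, hb⟩ | ⟨ha, hb⟩
  · rw [sign_pos ha, sign_pos hb]
  · rw [sign_neg ha, sign_neg hb]

/-- The strands `j` and `l` cross each other exactly once; `η` tells the two sides of the move
apart, and `d` gives the directions of the strands. -/
structure CrossOnce {n : ℕ} (s : Fin 3 → Strand n) (τ : Fin 3 → ℝ → ℝ × ℝ) (η : ℝ) (d : Fin 3 → ℝ)
    (j l : Fin 3) : Prop where
  exists_eq : ∃ t ∈ Set.Icc (s j).lo (s j).hi, ∃ u ∈ Set.Icc (s l).lo (s l).hi, τ j t = τ l u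
  unique : ∀ t ∈ Set.Icc (s j).lo (s j).hi, ∀ u ∈ Set.Icc (s l).lo (s l).hi,
    ∀ t' ∈ Set.Icc (s j).lo (s j).hi, ∀ u' ∈ Set.Icc (s l).lo (s l).hi,
    τ j t = τ l u → τ j t' = τ l u' → t = t' ∧ u = u'
  position : ∀ t ∈ Set.Icc (s j).lo (s j).hi, ∀ u ∈ Set.Icc (s l).lo (s l).hi, τ j t = τ l u →
    SignType.sign (η * (τ j t).1) = SignType.sign (modelSlope j + modelSlope l)
  orientation : ∀ t ∈ Set.Icc (s j).lo (s j).hi, ∀ u ∈ Set.Icc (s l).lo (s l).hi, τ j t = τ l u →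
    SignType.sign (cross (deriv (τ l) u) (deriv (τ j) t)) =
      SignType.sign (d j * d l * (modelSlope j - modelSlope l))

namespace CrossOnce

variable {n : ℕ} {s : Fin 3 → Strand n} {τ : Fin 3 → ℝ → ℝ × ℝ} {η : ℝ} {d : Fin 3 → ℝ}
  {j l : Fin 3}

theorem symm (h : CrossOnce s τ η d j l) : CrossOnce s τ η d l j where
  exists_eq := by
    obtain ⟨t, ht, u, hu, heq⟩ := h.exists_eq
    exact ⟨u, hu, t, ht, heq.symm⟩
  unique u hu t ht u' hu' t' ht' heq heq' := (h.unique t ht u hu t' ht' u' hu' heq.symm heq'.symm).symm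
  position u hu t ht heq := by
    rw [heq, h.position t ht u hu heq.symm, add_comm]
  orientation u hu t ht heq := by
    rw [cross_swap, Left.sign_neg, h.orientation t ht u hu heq.symm, ← Left.sign_neg]
    congr 1
    ring

theorem of_diagonals {a b : Fin 3} (ha : a = 0) (hb : b = 1)
    (hτ : ∀ j, ContDiff ℝ ∞ (τ j))
    (hd : ∀ j, HasDirection (τ j) (s j).lo (s j).hi (d j))
    (h0 : ∀ t ∈ Set.Icc (s 0).lo (s 0).hi, (τ 0 t).2 = (τ 0 t).1)
    (h1 : ∀ t ∈ Set.Icc (s 1).lo (s 1).hi, (τ 1 t).2 = -(τ 1 t).1) :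
    CrossOnce s τ η d a b := by
  subst ha hb
  have hz : ∀ t ∈ Set.Icc (s 0).lo (s 0).hi, ∀ u ∈ Set.Icc (s 1).lo (s 1).hi, τ 0 t = τ 1 u →
      (τ 0 t).1 = 0 ∧ (τ 1 u).1 = 0 := by
    intro t ht u hu heq
    have e1 := congrArg Prod.fst heq
    have e2 := congrArg Prod.snd heq
    rw [h0 t ht, h1 u hu] at e2
    constructor <;> linarith
  have hz0 : (0 : ℝ) ∈ Set.Icc (-1) 1 := by norm_num
  refine ⟨?_, ?_, ?_, ?_⟩
  · obtain ⟨t, ht, ht0⟩ := (hd 0).exists_fst_eq (hτ 0) (s 0).lt hz0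
    obtain ⟨u, hu, hu0⟩ := (hd 1).exists_fst_eq (hτ 1) (s 1).lt hz0
    exact ⟨t, ht, u, hu, Prod.ext (by rw [ht0, hu0]) (by rw [h0 t ht, h1 u hu, ht0, hu0, neg_zero])⟩
  · intro t ht u hu t' ht' u' hu' heq heq'
    obtain ⟨e1, e2⟩ := hz t ht u hu heq
    obtain ⟨e3, e4⟩ := hz t' ht' u' hu' heq'
    exact ⟨(hd 0).injOn_fst (hτ 0) ht ht' (e1.trans e3.symm),
      (hd 1).injOn_fst (hτ 1) hu hu' (e2.trans e4.symm)⟩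
  · intro t ht u hu heq
    rw [(hz t ht u hu heq).1]
    simp [modelSlope]
  · intro t ht u hu _
    have e0 := deriv_eq_of_eqOn_Icc (s 0).lt ht (hasDerivAt_snd (hτ 0) t) (hasDerivAt_fst (hτ 0) t) h0
    have e1 := deriv_eq_of_eqOn_Icc (s 1).lt hu (hasDerivAt_snd (hτ 1) u)
      (hasDerivAt_fst (hτ 1) u).neg h1
    have hX : cross (deriv (τ 1) u) (deriv (τ 0) t) = (d 0 * d 1 * (modelSlope 0 - modelSlope 1)) *
        ((d 0 * (deriv (τ 0) t).1) * (d 1 * (deriv (τ 1) u).1)) := by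
      rw [cross, e0, e1]
      simp only [modelSlope, Matrix.cons_val_zero, Matrix.cons_val_one]
      linear_combination (-2 * (deriv (τ 0) t).1 * (deriv (τ 1) u).1) *
        (d 1 * d 1 * (hd 0).sq + (hd 1).sq)
    rw [hX, sign_mul, sign_pos (mul_pos ((hd 0).pos t ht) ((hd 1).pos u hu)), mul_one]

/-- Strand 2 has slopes between -1 and 1, so relative to a diagonal it behaves like a horizontal
line, and slope 0 can stand for it in the signs. -/
theorem of_transversal {a : Fin 3} (ha : a ≠ 2)
    (hτ : ∀ j, ContDiff ℝ ∞ (τ j))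
    (hd : ∀ j, HasDirection (τ j) (s j).lo (s j).hi (d j))
    (hm : ∀ t ∈ Set.Icc (s 2).lo (s 2).hi, τ 2 t ∈ Model)
    (hline : ∀ t ∈ Set.Icc (s a).lo (s a).hi, (τ a t).2 = modelSlope a * (τ a t).1)
    (htr : Transversal (τ 2) (s 2).lo (s 2).hi)
    (hside : ∀ t ∈ Set.Icc (s 2).lo (s 2).hi, (τ 2 t).1 = 0 → 0 < η * (τ 2 t).2) :
    CrossOnce s τ η d a 2 := by
  obtain ⟨-, hylo, hyhi, hslope⟩ := htr
  have he2 : modelSlope 2 = 0 := rfl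
  have he : modelSlope a * modelSlope a = 1 := by fin_cases a <;> simp_all [modelSlope]
  set e := modelSlope a with hedef
  have hde : ∀ y : ℝ, |d 2 * e * y| = |y| := abs_mul_of_mul_self_eq_one (by
    linear_combination e * e * (hd 2).sq + he)
  -- With `e = ±1`, `h` vanishes exactly on the diagonal `y = e x`. The slope bound makes it
  -- increasing along strand 2, and its end values have opposite weak signs, so the diagonal is met
  -- exactly once.
  set h : ℝ → ℝ := fun t => d 2 * (τ 2 t).1 - d 2 * e * (τ 2 t).2 with hh
  have hdh : ∀ t, HasDerivAt h (d 2 * (deriv (τ 2) t).1 - d 2 * e * (deriv (τ 2) t).2) t := fun t =>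
    ((hasDerivAt_fst (hτ 2) t).const_mul _).sub ((hasDerivAt_snd (hτ 2) t).const_mul _)
  have hpos : ∀ t ∈ Set.Icc (s 2).lo (s 2).hi,
      0 < d 2 * (deriv (τ 2) t).1 - d 2 * e * (deriv (τ 2) t).2 := by
    intro t ht
    have h1 := hslope t ht
    rw [← hde, ← abs_mul_of_mul_self_eq_one (hd 2).sq (deriv (τ 2) t).1,
      abs_of_pos ((hd 2).pos t ht)] at h1
    exact sub_pos.mpr ((le_abs_self _).trans_lt h1)
  have hcont : ContinuousOn h (Set.Icc (s 2).lo (s 2).hi) := fun t _ =>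
    (hdh t).continuousAt.continuousWithinAt
  have hmono : StrictMonoOn h (Set.Icc (s 2).lo (s 2).hi) :=
    strictMonoOn_of_deriv_pos (convex_Icc _ _) hcont fun t ht => by
      rw [(hdh t).deriv]
      exact hpos t (interior_subset ht)
  have hzero : ∀ t ∈ Set.Icc (s a).lo (s a).hi, ∀ u, τ a t = τ 2 u → h u = 0 := by
    intro t ht u heq
    have h1 := hline t ht
    rw [heq] at h1
    simp only [hh, h1]
    linear_combination (-(d 2) * (τ 2 u).1) * he
  have hz0 : (0 : ℝ) ∈ Set.Icc (-1) 1 := by norm_num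
  refine ⟨?_, ?_, ?_, ?_⟩
  · have hlo : h (s 2).lo ≤ 0 := by
      simp only [hh, (hd 2).lo_eq]
      rw [← hde] at hylo
      linarith [neg_abs_le (d 2 * e * (τ 2 (s 2).lo).2)]
    have hhi : 0 ≤ h (s 2).hi := by
      simp only [hh, (hd 2).hi_eq]
      rw [← hde] at hyhi
      linarith [le_abs_self (d 2 * e * (τ 2 (s 2).hi).2)]
    obtain ⟨u, hu, hu0⟩ := intermediate_value_Icc (s 2).lt.le hcont ⟨hlo, hhi⟩
    obtain ⟨t, ht, htu⟩ := (hd a).exists_fst_eq (hτ a) (s a).lt (hm u hu).1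
    refine ⟨t, ht, u, hu, Prod.ext htu ?_⟩
    rw [hline t ht, htu]
    simp only [hh] at hu0
    linear_combination d 2 * e * hu0 + ((τ 2 u).2 * (d 2 * d 2)) * he +
      ((τ 2 u).2 - e * (τ 2 u).1) * (hd 2).sq
  · intro t ht u hu t' ht' u' hu' heq heq'
    have huu : u = u' := hmono.injOn hu hu' ((hzero t ht u heq).trans (hzero t' ht' u' heq').symm)
    subst huu
    exact ⟨(hd a).injOn_fst (hτ a) ht ht' (congrArg Prod.fst (heq.trans heq'.symm)), rfl⟩
  · intro t ht u hu heq
    have hu0 := hzero t ht u heq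
    have hyu : (τ 2 u).2 = e * (τ 2 u).1 := by rw [← heq]; exact hline t ht
    rw [heq, he2, add_zero]
    refine sign_eq_of_mul_pos ?_
    -- At `r` the strand crosses the vertical axis, on the side given by `η`. Comparing `r` with `u`
    -- through the two increasing functions `h` and `d 2` times the horizontal coordinate tells on
    -- which side of the axis the diagonal is met.
    obtain ⟨r, hr, hr0⟩ := (hd 2).exists_fst_eq (hτ 2) (s 2).lt hz0
    have hY := hside r hr hr0
    have hhr : h r = -(d 2 * e * (τ 2 r).2) := by simp only [hh, hr0]; ring
    have hmx := (hd 2).strictMonoOn (hτ 2)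
    have hprod : 0 < (d 2 * (τ 2 u).1) * (d 2 * e * (τ 2 r).2) := by
      rcases lt_trichotomy r u with hru | rfl | hru
      · have h1 := hmx hr hu hru
        have h2 := hmono hr hu hru
        simp only [hr0, mul_zero] at h1
        rw [hhr, hu0] at h2
        exact mul_pos h1 (by linarith)
      · rw [hyu, hr0] at hY
        simp at hY
      · have h1 := hmx hu hr hru
        have h2 := hmono hu hr hru
        simp only [hr0, mul_zero] at h1
        rw [hhr, hu0] at h2
        exact mul_pos_of_neg_of_neg h1 (by linarith)
    have hY0 : (τ 2 r).2 ≠ 0 := right_ne_zero_of_mul hY.ne'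
    have h3 := mul_pos hprod hY
    rw [show d 2 * (τ 2 u).1 * (d 2 * e * (τ 2 r).2) * (η * (τ 2 r).2) =
      (η * (τ 2 u).1 * e) * ((τ 2 r).2 * (τ 2 r).2) by
        linear_combination ((τ 2 u).1 * e * (τ 2 r).2 * (η * (τ 2 r).2)) * (hd 2).sq] at h3
    exact (mul_pos_iff_of_pos_right (mul_self_pos.mpr hY0)).mp h3
  · intro t ht u hu _
    have ea := deriv_eq_of_eqOn_Icc (s a).lt ht (hasDerivAt_snd (hτ a) t)
      ((hasDerivAt_fst (hτ a) t).const_mul e) hline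
    refine sign_eq_of_mul_pos ?_
    have h3 := mul_pos ((hd a).pos t ht) (hpos u hu)
    refine lt_of_lt_of_eq h3 ?_
    simp only [cross, ea, he2]
    linear_combination -(d a * d 2 * (deriv (τ a) t).1 * (deriv (τ 2) u).1) * he

theorem of_ne (hτ : ∀ j, ContDiff ℝ ∞ (τ j))
    (hd : ∀ j, HasDirection (τ j) (s j).lo (s j).hi (d j))
    (hm : ∀ t ∈ Set.Icc (s 2).lo (s 2).hi, τ 2 t ∈ Model)
    (h0 : ∀ t ∈ Set.Icc (s 0).lo (s 0).hi, (τ 0 t).2 = (τ 0 t).1)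
    (h1 : ∀ t ∈ Set.Icc (s 1).lo (s 1).hi, (τ 1 t).2 = -(τ 1 t).1)
    (htr : Transversal (τ 2) (s 2).lo (s 2).hi)
    (hside : ∀ t ∈ Set.Icc (s 2).lo (s 2).hi, (τ 2 t).1 = 0 → 0 < η * (τ 2 t).2) (hjl : j ≠ l) :
    CrossOnce s τ η d j l := by
  have h01 : CrossOnce s τ η d 0 1 := of_diagonals rfl rfl hτ hd h0 h1
  have h02 : CrossOnce s τ η d 0 2 := of_transversal (by decide) hτ hd hm
    (fun t ht => by rw [h0 t ht]; simp [modelSlope]) htr hside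
  have h12 : CrossOnce s τ η d 1 2 := of_transversal (by decide) hτ hd hm
    (fun t ht => by rw [h1 t ht]; simp [modelSlope]) htr hside
  fin_cases j <;> fin_cases l
  · exact absurd rfl hjl
  · exact h01
  · exact h02
  · exact h01.symm
  · exact absurd rfl hjl
  · exact h12
  · exact h02.symm
  · exact h12.symm
  · exact absurd rfl hjl

end CrossOnce

/-- On each strand the crossings, read in the direction of increasing `η x`, are ordered by the
slopes of the strands crossed. -/
theorem sign_modelSlope_add_lt {j l m : Fin 3} (hjl : j ≠ l) (hjm : j ≠ m)
    (h : modelSlope l < modelSlope m) :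
    SignType.sign (modelSlope j + modelSlope l) < SignType.sign (modelSlope j + modelSlope m) := by
  fin_cases j <;> fin_cases l <;> fin_cases m <;> first
    | exact absurd rfl hjl
    | exact absurd rfl hjm
    | (simp [modelSlope] at h ⊢ <;> norm_num at h)

theorem lt_of_sign_lt {a b : ℝ} (h : SignType.sign a < SignType.sign b) : a < b := by
  by_contra! hab
  exact absurd (SignType.sign.monotone hab) (not_le.mpr h)

/-! ### From the model picture to the combinatorial triangle. -/

theorem Tangle.exists_triangle {n : ℕ} {x : Fin n → ℝ} {S : Diagram n x} {δ : Disk}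
    {s : Fin 3 → Strand n} {τ : Fin 3 → ℝ → ℝ × ℝ} (T : Tangle S δ s τ) {η : ℝ} {d : Fin 3 → ℝ}
    (hη : η * η = 1) (hd : ∀ j, HasDirection (τ j) (s j).lo (s j).hi (d j))
    (hC : ∀ j l, j ≠ l → CrossOnce s τ η d j l) {c : Fin 3 → Fin 3 → Passage}
    (hk : ∀ j l, j ≠ l → ∀ p ∈ (s j).points, ∀ q ∈ (s l).points,
      Meet S.curve p q → S.kind p = c j l) :
    ∃ θ, S.gauss.Triangle (fun j => (s j).window) (fun j l => c j l = Passage.below)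
      (fun j l => (SignType.sign (d j * d l * (modelSlope j - modelSlope l)) : ℤ)) θ ∧
      ∀ j l m, j ≠ l → j ≠ m → l ≠ m →
        (θ j l < θ j m ↔ 0 < η * d j * (modelSlope m - modelSlope l)) := by
  -- The condition `j ≠ l` is placed inside so that one function `θ` can be chosen; its diagonal
  -- values have no meaning.
  have hex : ∀ j l, ∃ t, j ≠ l →
      t ∈ Set.Icc (s j).lo (s j).hi ∧ ∃ u ∈ Set.Icc (s l).lo (s l).hi, τ j t = τ l u := by
    intro j l
    by_cases h : j = l
    · exact ⟨0, fun h' => absurd h h'⟩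
    · obtain ⟨t, ht, hu⟩ := (hC j l h).exists_eq
      exact ⟨t, fun _ => ⟨ht, hu⟩⟩
  choose θ hθ using hex
  have hmem : ∀ j l, j ≠ l → θ j l ∈ Set.Icc (s j).lo (s j).hi := fun j l h => (hθ j l h).1
  have heq : ∀ j l, j ≠ l → τ j (θ j l) = τ l (θ l j) := by
    intro j l h
    obtain ⟨u, hu, he⟩ := (hθ j l h).2
    obtain ⟨v, hv, he'⟩ := (hθ l j h.symm).2
    rw [he, ((hC j l h).unique _ (hmem j l h) u hu v hv _ (hmem l j h.symm) he he'.symm).2]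
  have horder : ∀ j l m, j ≠ l → j ≠ m → l ≠ m →
      (θ j l < θ j m ↔ 0 < η * d j * (modelSlope m - modelSlope l)) := by
    intro j l m hjl hjm hlm
    have hX : ∀ l m, j ≠ l → j ≠ m → modelSlope l < modelSlope m →
        η * (τ j (θ j l)).1 < η * (τ j (θ j m)).1 := by
      intro l m hjl hjm hlt
      apply lt_of_sign_lt
      rw [(hC j l hjl).position _ (hmem j l hjl) _ (hmem l j hjl.symm) (heq j l hjl),
        (hC j m hjm).position _ (hmem j m hjm) _ (hmem m j hjm.symm) (heq j m hjm)]
      exact sign_modelSlope_add_lt hjl hjm hlt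
    have hX' : η * (τ j (θ j l)).1 < η * (τ j (θ j m)).1 ↔ modelSlope l < modelSlope m := by
      refine ⟨fun h => ?_, hX l m hjl hjm⟩
      rcases (modelSlope_injective.ne hlm).lt_or_gt with h' | h'
      · exact h'
      · exact absurd (hX m l hjm hjl h') h.not_gt
    have hX'' : η * (τ j (θ j m)).1 < η * (τ j (θ j l)).1 ↔ modelSlope m < modelSlope l := by
      refine ⟨fun h => ?_, hX m l hjm hjl⟩
      rcases (modelSlope_injective.ne hlm).lt_or_gt with h' | h'
      · exact absurd (hX l m hjl hjm h') h.not_gt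
      · exact h'
    rw [← ((hd j).strictMonoOn (T.smooth j)).lt_iff_lt (hmem j l hjl) (hmem j m hjm)]
    rcases mul_self_eq_one_iff.mp hη with h | h <;>
      rcases mul_self_eq_one_iff.mp (hd j).sq with h' | h' <;>
      simp only [h, h', one_mul, neg_mul, neg_lt_neg_iff, neg_neg, mul_neg, mul_one, Left.neg_pos_iff,
        sub_pos, sub_neg] at hX' hX'' ⊢ <;> assumption
  refine ⟨θ, ⟨hmem, ?_, ?_, ?_, ?_⟩, horder⟩
  · intro j l m hjl hjm hlm h
    have h1 := (horder j l m hjl hjm hlm).not.mp (by rw [h]; exact lt_irrefl _)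
    have h2 := (horder j m l hjm hjl hlm.symm).not.mp (by rw [h]; exact lt_irrefl _)
    have h3 : η * d j * (modelSlope m - modelSlope l) = 0 := by linarith
    have h4 := left_ne_zero_of_mul_eq_one hη
    have h5 := left_ne_zero_of_mul_eq_one (hd j).sq
    exact modelSlope_injective.ne hlm.symm
      (sub_eq_zero.mp ((mul_eq_zero.mp h3).resolve_left (mul_ne_zero h4 h5)))
  · intro j t ht
    change t ∈ S.gauss.under (s j).comp ↔ _
    rw [T.mem_under_iff ht]
    constructor
    · rintro ⟨⟨l, u, hu, hne, he⟩, hb⟩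
      have hjl : j ≠ l := by
        rintro rfl
        exact hne.elim (fun h => h rfl) fun h =>
          h ((hd j).injOn_fst (T.smooth j) ht hu (congrArg Prod.fst he))
      refine ⟨l, hjl, ((hC j l hjl).unique t ht u hu _ (hmem j l hjl) _ (hmem l j hjl.symm) he
        (heq j l hjl)).1, ?_⟩
      rw [← hb]
      exact (hk j l hjl ((s j).comp, t) ⟨rfl, ht⟩ _ ⟨rfl, hu⟩ (T.meet_of_eq ht hu hne he)).symm
    · rintro ⟨l, hjl, rfl, hb⟩
      have hu := hmem l j hjl.symm
      refine ⟨⟨l, _, hu, Or.inl hjl, heq j l hjl⟩, ?_⟩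
      rw [← hb]
      exact hk j l hjl _ ⟨rfl, ht⟩ _ ⟨rfl, hu⟩ (T.meet_of_eq ht hu (Or.inl hjl) (heq j l hjl))
  · exact fun j l hjl =>
      T.upper_eq (hmem j l hjl) (hmem l j hjl.symm) (Or.inl hjl) (heq j l hjl)
  · intro j l hjl
    change S.sign ((s j).comp, θ j l) = _
    rw [T.sign_eq (hmem j l hjl) (hmem l j hjl.symm) (Or.inl hjl) (heq j l hjl),
      (hC j l hjl).orientation _ (hmem j l hjl) _ (hmem l j hjl.symm) (heq j l hjl)]

theorem Tangle.exists_hasDirection {n : ℕ} {x : Fin n → ℝ} {S : Diagram n x} {δ : Disk}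
    {s : Fin 3 → Strand n} {τ : Fin 3 → ℝ → ℝ × ℝ} (T : Tangle S δ s τ)
    (hrun₀ : RunsAcross (τ 0) (s 0).lo (s 0).hi) (hrun₁ : RunsAcross (τ 1) (s 1).lo (s 1).hi)
    (h0 : ∀ t ∈ Set.Icc (s 0).lo (s 0).hi, (τ 0 t).2 = (τ 0 t).1)
    (h1 : ∀ t ∈ Set.Icc (s 1).lo (s 1).hi, (τ 1 t).2 = -(τ 1 t).1)
    (htr : Transversal (τ 2) (s 2).lo (s 2).hi) :
    ∃ d : Fin 3 → ℝ, ∀ j, HasDirection (τ j) (s j).lo (s j).hi (d j) := by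
  have hne₀ : ∀ t ∈ Set.Icc (s 0).lo (s 0).hi, (deriv (τ 0) t).1 ≠ 0 := by
    intro t ht h
    refine T.deriv_ne_zero ht (Prod.ext h ?_)
    rw [deriv_eq_of_eqOn_Icc (s 0).lt ht (hasDerivAt_snd (T.smooth 0) t)
      (hasDerivAt_fst (T.smooth 0) t) h0, h]
    rfl
  have hne₁ : ∀ t ∈ Set.Icc (s 1).lo (s 1).hi, (deriv (τ 1) t).1 ≠ 0 := by
    intro t ht h
    refine T.deriv_ne_zero ht (Prod.ext h ?_)
    rw [deriv_eq_of_eqOn_Icc (s 1).lt ht (hasDerivAt_snd (T.smooth 1) t)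
      (hasDerivAt_fst (T.smooth 1) t).neg h1, h, neg_zero]
    rfl
  obtain ⟨d₀, hd₀⟩ := hrun₀.exists_hasDirection (T.smooth 0) (s 0).lt hne₀
  obtain ⟨d₁, hd₁⟩ := hrun₁.exists_hasDirection (T.smooth 1) (s 1).lt hne₁
  obtain ⟨d₂, hd₂⟩ := htr.1.exists_hasDirection (T.smooth 2) (s 2).lt fun t ht =>
    abs_pos.mp ((abs_nonneg _).trans_lt (htr.2.2.2 t ht))
  refine ⟨![d₀, d₁, d₂], fun j => ?_⟩
  fin_cases j
  · exact hd₀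
  · exact hd₁
  · exact hd₂

theorem HasDirection.eq {τ τ' : ℝ → ℝ × ℝ} {lo hi d d' : ℝ} (h : HasDirection τ lo hi d)
    (h' : HasDirection τ' lo hi d') (heq : τ' lo = τ lo) : d' = d := by
  have h1 := h.lo_eq
  have h2 := h'.lo_eq
  rw [heq] at h2
  have h3 : (τ lo).1 ≠ 0 := fun h0 => by rw [h0, mul_zero] at h1; norm_num at h1
  exact mul_right_cancel₀ h3 (h2.trans h1.symm)

theorem GaussData.Triangle.congr {n : ℕ} {D : GaussData n} {W : Fin 3 → Window n}
    {b b' : Fin 3 → Fin 3 → Prop} {σ : Fin 3 → Fin 3 → ℤ} {θ : Fin 3 → Fin 3 → ℝ}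
    (h : D.Triangle W b σ θ) (hb : ∀ j l, j ≠ l → (b j l ↔ b' j l)) : D.Triangle W b' σ θ where
  mem := h.mem
  ne := h.ne
  under_iff j t ht := by
    rw [h.under_iff j t ht]
    exact exists_congr fun l => and_congr_right fun hjl => and_congr_right fun _ => hb j l hjl
  upper_eq := h.upper_eq
  sgn_eq := h.sgn_eq

/-- Here `P` and `Q` stand for the orders of the crossings on two strands. Multiplying the two signs
removes `w`, as `w * w = 1`, and leaves the product of the quantities that decide these orders. -/
theorem sign_mul_eq_ite {a b u v w : ℝ} (hau : a * u ≠ 0) (hbv : b * v ≠ 0) (hw : w * w = 1)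
    {P Q : Prop} (hP : P ↔ 0 < a * u) (hQ : Q ↔ 0 < b * v) [Decidable (P ↔ Q)] :
    (SignType.sign (a * w * v) : ℤ) =
      if (P ↔ Q) then (SignType.sign (b * w * u) : ℤ) else -(SignType.sign (b * w * u) : ℤ) := by
  have key : (a * w * v) * (b * w * u) = (a * u) * (b * v) := by
    linear_combination (a * v * b * u) * hw
  split_ifs with h
  · rw [sign_eq_of_mul_pos (a := a * w * v) (b := b * w * u)]
    rw [key]
    by_cases hp : P
    · exact mul_pos (hP.mp hp) (hQ.mp (h.mp hp))
    · exact mul_pos_of_neg_of_neg (lt_of_le_of_ne (not_lt.mp (hP.not.mp hp)) hau)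
        (lt_of_le_of_ne (not_lt.mp (hQ.not.mp (h.not.mp hp))) hbv)
  · rw [← sign_intCast_neg, sign_eq_of_mul_pos (a := a * w * v) (b := -(b * w * u))]
    rw [mul_neg, key, neg_pos]
    by_cases hp : P
    · have hq : ¬ Q := fun hq => h (iff_of_true hp hq)
      exact mul_neg_of_pos_of_neg (hP.mp hp) (lt_of_le_of_ne (not_lt.mp (hQ.not.mp hq)) hbv)
    · have hq : Q := by
        by_contra hq
        exact h (iff_of_false hp hq)
      exact mul_neg_of_neg_of_pos (lt_of_le_of_ne (not_lt.mp (hP.not.mp hp)) hau) (hQ.mp hq)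

/-! ### The three-strand moves and the conclusion. -/

namespace Diagram

variable {n : ℕ} {x : Fin n → ℝ} {S S' : Diagram n x}

-- The two sides have the same marks, directions and signs, but the value of `η` changes from 1 to
-- -1, which reverses the order of the two crossings on every strand. The alternative in `hc`
-- separates V3, V4 and OC, where the order does not matter, from R3, where it does.
open Classical in
theorem sameLongitudes_of_triangleMove (hx : Function.Injective x)
    {c : Fin 3 → Fin 3 → Passage} (h : TriangleMove S S' c)
    (hc : (∀ j l m, j ≠ l → j ≠ m → l ≠ m → c j l = Passage.below →
        c l m ≠ Passage.below ∧ c j m ≠ Passage.below) ∨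
      ∃ height : Fin 3 → ℕ, Function.Injective height ∧
        ∀ j l, j ≠ l → (c j l = Passage.below ↔ height j < height l)) : SameLongitudes S S' := by
  obtain ⟨δ, s, τ, τ', T, T', hagree, hrun₀, hrun₁, h0, h1, htr, htr', hside, hside', hk⟩ := h
  have hch : ∀ j, j ≠ 2 → ∀ t ∈ Set.Icc (s j).lo (s j).hi, τ' j t = τ j t := fun j hj t ht =>
    T.chart_eq_of_agree T' hagree hj ht
  have hlo : ∀ j, (s j).lo ∈ Set.Icc (s j).lo (s j).hi := fun j =>
    Set.left_mem_Icc.mpr (s j).lt.le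
  have hhi : ∀ j, (s j).hi ∈ Set.Icc (s j).lo (s j).hi := fun j =>
    Set.right_mem_Icc.mpr (s j).lt.le
  have h02 : (0 : Fin 3) ≠ 2 := by decide
  have h12 : (1 : Fin 3) ≠ 2 := by decide
  have h0' : ∀ t ∈ Set.Icc (s 0).lo (s 0).hi, (τ' 0 t).2 = (τ' 0 t).1 := fun t ht => by
    rw [hch 0 h02 t ht, h0 t ht]
  have h1' : ∀ t ∈ Set.Icc (s 1).lo (s 1).hi, (τ' 1 t).2 = -(τ' 1 t).1 := fun t ht => by
    rw [hch 1 h12 t ht, h1 t ht]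
  obtain ⟨d, hd⟩ := T.exists_hasDirection hrun₀ hrun₁ h0 h1 htr
  obtain ⟨d', hd'⟩ := T'.exists_hasDirection
    (by rwa [RunsAcross, hch 0 h02 _ (hlo 0), hch 0 h02 _ (hhi 0)])
    (by rwa [RunsAcross, hch 1 h12 _ (hlo 1), hch 1 h12 _ (hhi 1)]) h0' h1' htr'
  obtain rfl : d' = d := by
    funext j
    refine (hd j).eq (hd' j) ?_
    by_cases hj : j = 2
    · subst hj; exact T.chart_lo_eq_of_agree T' hagree
    · exact hch j hj _ (hlo j)
  obtain ⟨θ, hθ, hord⟩ := T.exists_triangle (η := 1) (by norm_num) hd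
    (fun j l => CrossOnce.of_ne T.smooth hd (T.mem_model 2) h0 h1 htr
      fun t ht ht0 => by rw [one_mul]; exact hside t ht ht0)
    fun j l hjl p hp q hq => (hk j l hjl p hp q hq).1
  obtain ⟨θ', hθ', hord'⟩ := T'.exists_triangle (η := -1) (by norm_num) hd'
    (fun j l => CrossOnce.of_ne T'.smooth hd' (T'.mem_model 2) h0' h1' htr'
      fun t ht ht0 => by linarith [hside' t ht ht0])
    fun j l hjl p hp q hq => (hk j l hjl p hp q hq).2
  have hrev : ∀ j l m, j ≠ l → j ≠ m → l ≠ m → (θ j l < θ j m ↔ θ' j m < θ' j l) := by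
    intro j l m hjl hjm hlm
    rw [hord j l m hjl hjm hlm, hord' j m l hjm hjl hlm.symm]
    ring_nf
  have hσ : ∀ j l m, j ≠ l → j ≠ m → l ≠ m →
      (SignType.sign (d' m * d' l * (modelSlope m - modelSlope l)) : ℤ) =
        if (θ m l < θ m j ↔ θ j l < θ j m) then
          (SignType.sign (d' j * d' l * (modelSlope j - modelSlope l)) : ℤ)
        else -(SignType.sign (d' j * d' l * (modelSlope j - modelSlope l)) : ℤ) := by
    intro j l m hjl hjm hlm
    have hne : ∀ i, d' i ≠ 0 := fun i => left_ne_zero_of_mul_eq_one (hd i).sq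
    have hsub : ∀ i k, i ≠ k → modelSlope i - modelSlope k ≠ 0 := fun i k hik =>
      sub_ne_zero.mpr (modelSlope_injective.ne hik)
    refine sign_mul_eq_ite (mul_ne_zero (hne m) (hsub j l hjl))
      (mul_ne_zero (hne j) (hsub m l hlm.symm)) (hd l).sq ?_ ?_
    · rw [hord m l j hlm.symm hjm.symm hjl.symm, one_mul]
    · rw [hord j l m hjl hjm hlm, one_mul]
  refine ((T.agreeOff hx T' hagree).locallyEquivalent T.disjoint_window ?_).longitude_mem_avoidKer
  intro G _ N _ a a' _ _ ha ha' hlo j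
  have key : S.gauss.prodOn a (s j).window.comp (Set.Icc (s j).window.lo (s j).window.hi) =
      S'.gauss.prodOn a' (s j).window.comp (Set.Icc (s j).window.lo (s j).window.hi) := by
    rcases hc with hc | ⟨height, hh, hc⟩
    · exact hθ.prodOn_eq_of_simple hθ' ha ha' hlo hc j
    · exact (hθ.congr hc).prodOn_eq_of_height hh (hθ'.congr hc) ha ha' hlo hrev
        (fun j l m hjl hjm hlm => by convert hσ j l m hjl hjm hlm) j
  rw [key, inv_mul_cancel]
  exact one_mem _

theorem sameLongitudes_of_weldedMove (hx : Function.Injective x) (h : WeldedMove S S') :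
    SameLongitudes S S' := by
  cases h with
  | R1 c hc h => exact sameLongitudes_of_kinkMove hx h
  | V1 h => exact sameLongitudes_of_kinkMove hx h
  | R2 c hc h => exact sameLongitudes_of_bigonMove hx h
  | V2 h => exact sameLongitudes_of_bigonMove hx h
  | R3 height hh h =>
    refine sameLongitudes_of_triangleMove hx h (Or.inr ⟨height, hh, fun j l hjl => ?_⟩)
    have := hh.ne hjl
    split_ifs with hlt
    · simp [hlt.le]
    · simp; omega
  | V3 h => exact sameLongitudes_of_triangleMove hx h (Or.inl fun _ _ _ _ _ _ h => by cases h)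
  | V4 c m hm hc h =>
    -- An under-passage involves only the two strands other than `m`, so the third strand is `m`,
    -- which meets both virtually.
    refine sameLongitudes_of_triangleMove hx h (Or.inl fun j l r hjl hjr hlr hb => ?_)
    have hjm : j ≠ m := by
      rintro rfl
      rw [(hm l hjl.symm).1] at hb
      cases hb
    have hlm : l ≠ m := by
      rintro rfl
      rw [(hm j hjl).2] at hb
      cases hb
    obtain rfl : m = r :=
      (GaussData.Triangle.eq_or_eq hjl hjr hlr m hjm).resolve_left hlm.symm
    rw [(hm l hlr).2, (hm j hjr).2]
    simp
  | OC c m hm hc h =>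
    -- The only strand passing over another one is `m`, so an under-passage of `j` below `l` forces
    -- `l = m`.
    refine sameLongitudes_of_triangleMove hx h (Or.inl fun j l r hjl hjr hlr hb => ?_)
    have hjm : j ≠ m := by
      rintro rfl
      rw [(hm l hjl.symm).1] at hb
      cases hb
    obtain rfl : l = m := by
      by_contra hlm
      rw [hc j l hjm hlm hjl] at hb
      cases hb
    rw [(hm r hlr.symm).1, hc j r hjl hlr.symm hjr]
    simp

theorem sameLongitudes_of_svEquivalent (hinj : Function.Injective x)
    (hx : ∀ i, x i ∈ Set.Ioo (0 : ℝ) 1) (h : SVEquivalent S S') : SameLongitudes S S' := by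
  refine SameLongitudes.of_eqvGen (fun R R' hR => ?_) h
  rcases hR with hR | hR
  · exact sameLongitudes_of_selfVirtualization hinj hR
  · refine SameLongitudes.of_eqvGen (fun Q Q' hQ => ?_) hR
    rcases hQ with hQ | hQ | hQ
    · exact sameLongitudes_of_reparametrization hinj hQ
    · exact sameLongitudes_of_planarIsotopy hinj hx hQ
    · exact sameLongitudes_of_weldedMove hinj hQ

end Diagram

end

end StringLink

theorem mainTheorem8 (n : ℕ) (x : Fin n → ℝ) (hx : StrictMono x)
    (hx' : ∀ i, x i ∈ Set.Ioo (0 : ℝ) 1)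
    (S S' : StringLink.Diagram n x) (h : StringLink.SVEquivalent S S')
    (J : List (Fin n)) (i : Fin n) (hJ : J ≠ []) (hI : (J ++ [i]).Nodup)
    (q q' : ℕ) (hq : J.length < q) (hq' : J.length < q') :
    S.milnor q J i = S'.milnor q' J i :=
  (StringLink.Diagram.sameLongitudes_of_svEquivalent hx.injective hx' h).milnor_eq hI hq hq'
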